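/- **Data.** Let $A=(a_{ij})_{i,j\in I}$ be the Cartan matrix of finite type of a (nonzero) finite-dimensional complex semisimple Lie algebra $\mathfrak g$, where the index set $I$ is totally ordered, and let $d_i$ $(i\in I)$ be relatively prime positive integers with $d_ia_{ij}=d_ja_{ji}$. Put $\langle i,j\rangle=d_ia_{ij}$ if $i<j$, $\langle i,i\rangle=d_i$, and $\langle i,j\rangle=0$ if $i>j$. Let $r,s\in\mathbb C^*$ be such that $rs^{-1}$ is not a root of unity; put $r_i=r^{d_i}$, $s_i=s^{d_i}$, $(n)_v=1+v+\dots+v^{n-1}$, $(n)^!_v=(1)_v\cdots(n)_v$, $\binom nk_v=\frac{(n)^!_v}{(k)^!_v(n-k)^!_v}$, and $c_{ij}^k=(r_is_i^{-1})^{k(k-1)/2}\,r^{k\langle j,i\rangle}s^{-k\langle i,j\rangle}$ for $i\ne j$. All algebras and tensor products are over $\mathbb C$, and Sweedler notation is used. **Hopf algebras.** $U^{\ge}_{r,s}$ is the Hopf algebra generated by $E_i,K_i'^{\pm1}$ $(i\in I)$ with relations $$K_i'^{\pm1}K_i'^{\mp1}=1,\quad K_i'K_j'=K_j'K_i',\quad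 K_i'E_jK_i'^{-1}=r^{-\langle i,j\rangle}s^{\langle j,i\rangle}E_j,$$ $$\sum_{k=0}^{1-a_{ij}}(-1)^k\tbinom{1-a_{ij}}{k}_{r_is_i^{-1}}c_{ij}^kE_i^{1-a_{ij}-k}E_jE_i^k=0\quad(i\neq j),$$ and $\Delta(K_i')=K_i'\otimes K_i'$, $\Delta(E_i)=E_i\otimes K_i'+1\otimes E_i$, $\varepsilon(K_i')=1$, $\varepsilon(E_i)=0$, $S(K_i')=K_i'^{-1}$, $S(E_i)=-E_iK_i'^{-1}$. Likewise $U^{\le}_{r,s}$ is the Hopf algebra generated by $F_i,K_i^{\pm1}$ $(i\in I)$ with relations $$K_i^{\pm1}K_i^{\mp1}=1,\quad K_iK_j=K_jK_i,\quad K_iF_jK_i^{-1}=r^{-\langle j,i\rangle}s^{\langle i,j\rangle}F_j,$$ $$\sum_{k=0}^{1-a_{ij}}(-1)^k\tbinom{1-a_{ij}}{k}_{r_is_i^{-1}}c_{ij}^kF_i^kF_jF_i^{1-a_{ij}-k}=0\quad(i\neq j),$$ and $\Delta(K_i)=K_i\otimes K_i$, $\Delta(F_i)=F_i\otimes1+K_i\otimes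 F_i$, $\varepsilon(K_i)=1$, $\varepsilon(F_i)=0$, $S(K_i)=K_i^{-1}$, $S(F_i)=-K_i^{-1}F_i$. **Pairing and doubles.** Let $\varphi:U^{\ge}_{r,s}\times U^{\le}_{r,s}\to\mathbb C$ be the skew Hopf pairing, i.e. the bilinear form with $\varphi(a,bb')=\sum\varphi(a_{(1)},b)\varphi(a_{(2)},b')$, $\varphi(aa',b)=\sum\varphi(a',b_{(1)})\varphi(a,b_{(2)})$, $\varphi(a,1)=\varepsilon(a)$, $\varphi(1,b)=\varepsilon(b)$, determined by $$\varphi(E_i,F_j)=\frac{\delta_{ij}}{s_i-r_i},\quad\varphi(K_i',K_j)=r^{\langle i,j\rangle}s^{-\langle j,i\rangle},\quad\varphi(E_i,K_j)=\varphi(K_i',F_j)=0.$$ The two-parameter quantum group $U_{r,s}$ is the quantum double: the coalgebra $U^{\ge}_{r,s}\otimes U^{\le}_{r,s}$ with multiplication $(a\otimes b)(a'\otimes b')=\sum\varphi(S^{-1}(a'_{(1)}),b_{(1)})\,\varphi(a'_{(3)},b_{(3)})\,aa'_{(2)}\otimes b_{(2)}b'$. The two-parameter Kashiwara algebra $B_{r,s}$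 is the Heisenberg double: the vector space $U^{\le}_{r,s}\otimes U^{\ge}_{r,s}$, with pure tensors written $b\sharp a$, and multiplication $(b\sharp a)(b'\sharp a')=\sum\varphi(a_{(1)},b'_{(1)})\,bb'_{(2)}\sharp a_{(2)}a'$. In $B_{r,s}$ put $e_i'=(s_i-r_i)\,(1\sharp K_i'^{-1}E_i)$ and $f_i=F_i\sharp1$. Let $B^+_{r,s}$, $B^-_{r,s}$ and $W_{r,s}(\mathfrak g)$ (the two-parameter quantized Weyl algebra) be the subalgebras of $B_{r,s}$ generated by all $e_i'$, by all $f_i$, and by all $e_i'$ and $f_i$, respectively. **Yetter–Drinfeld structure.** $U_{r,s}$ acts on $U^{\ge}_{r,s}$ by $(a\otimes1)\cdot x=\sum a_{(1)}xS(a_{(2)})$, $(1\otimes b)\cdot x=\sum\varphi(x_{(1)},S(b))x_{(2)}$, on $U^{\le}_{r,s}$ by $(a\otimes1)\cdot y=\sum\varphi(a,y_{(1)})y_{(2)}$, $(1\otimes b)\cdot y=\sum b_{(1)}yS(b_{(2)})$, and on $B_{r,s}$ by $h\cdot(b\sharp a)=\sum(h_{(1)}\cdot b)\sharp(h_{(2)}\cdot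 a)$; it coacts on $B_{r,s}$ by $b\sharp a\mapsto\sum(1\otimes b_{(1)})(a_{(1)}\otimes1)\otimes(b_{(2)}\sharp a_{(2)})$. The corresponding braiding $\sigma(v\otimes w)=\sum v_{(-1)}\cdot w\otimes v_{(0)}$ of $B_{r,s}$ with itself maps $B^+_{r,s}\otimes B^-_{r,s}$ into $B^-_{r,s}\otimes B^+_{r,s}$, and $B^-_{r,s}\,\underline\otimes\,B^+_{r,s}$ denotes the associative unital algebra with underlying space $B^-_{r,s}\otimes B^+_{r,s}$, unit $1\otimes1$ and multiplication $(m\otimes m)\circ(\mathrm{id}\otimes\sigma\otimes\mathrm{id})$. **Proposition.** There exists an isomorphism of algebras $$B^-_{r,s}\,\underline\otimes\,B^+_{r,s}\;\cong\;W_{r,s}(\mathfrak g),\qquad f\otimes e\mapsto fe\quad(f\in B^-_{r,s},\ e\in B^+_{r,s}),$$ where the product $fe$ is taken in $B_{r,s}$. -/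

import Mathlib

open scoped TensorProduct

namespace TwoParam

/-! ### Quantum integers and the quantum Serre expression -/

/-- The quantum integer `(n)_v = 1 + v + ⋯ + v ^ (n - 1)`. -/
noncomputable def qNum (v : ℂ) (n : ℕ) : ℂ := ∑ k ∈ Finset.range n, v ^ k

/-- The quantum factorial `(n)_v! = (1)_v (2)_v ⋯ (n)_v`. -/
noncomputable def qFact (v : ℂ) (n : ℕ) : ℂ := ∏ k ∈ Finset.range n, qNum v (k + 1)

/-- The quantum binomial coefficient, used only for `k ≤ n` and `v` not a root of unity. -/
noncomputable def qBinom (v : ℂ) (n k : ℕ) : ℂ := qFact v n / (qFact v k * qFact v (n - k))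

/-- The quantum Serre expression
`∑ k ≤ N, (-1) ^ k * (N choose k)_q * q ^ (k (k - 1) / 2) * x ^ k • X ^ (N - k) * Y * X ^ k`. -/
noncomputable def serre {R : Type*} [Ring R] [Algebra ℂ R] (N : ℕ) (q x : ℂ) (X Y : R) : R :=
  ∑ k ∈ Finset.range (N + 1),
    ((-1) ^ k * qBinom q N k * (q ^ (k * (k - 1) / 2) * x ^ k)) • (X ^ (N - k) * Y * X ^ k)

/-- The quantum Serre expression with the powers of `X` in the opposite order:
`∑ k ≤ N, (-1) ^ k * (N choose k)_q * q ^ (k (k - 1) / 2) * x ^ k • X ^ k * Y * X ^ (N - k)`. -/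
noncomputable def serreOp {R : Type*} [Ring R] [Algebra ℂ R] (N : ℕ) (q x : ℂ) (X Y : R) : R :=
  ∑ k ∈ Finset.range (N + 1),
    ((-1) ^ k * qBinom q N k * (q ^ (k * (k - 1) / 2) * x ^ k)) • (X ^ k * Y * X ^ (N - k))

section qLemmas

variable {q : ℂ}

theorem qNum_succ (v : ℂ) (n : ℕ) : qNum v (n + 1) = qNum v n + v ^ n := by
  simp [qNum, Finset.sum_range_succ]

theorem qNum_add (v : ℂ) (m n : ℕ) : qNum v (m + n) = qNum v m + v ^ m * qNum v n := by
  induction n with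
  | zero => simp [qNum]
  | succ n ih => rw [← add_assoc, qNum_succ, ih, qNum_succ]; ring

theorem qNum_ne_zero (hq : ∀ n, 0 < n → q ^ n ≠ 1) {n : ℕ} (hn : 0 < n) : qNum q n ≠ 0 := by
  intro h
  have := geom_sum_mul q n
  rw [show ∑ i ∈ Finset.range n, q ^ i = 0 from h] at this
  exact hq n hn (by linear_combination -this)

theorem qFact_succ (v : ℂ) (n : ℕ) : qFact v (n + 1) = qFact v n * qNum v (n + 1) := by
  simp [qFact, Finset.prod_range_succ]

theorem qFact_ne_zero (hq : ∀ n, 0 < n → q ^ n ≠ 1) (n : ℕ) : qFact q n ≠ 0 :=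
  Finset.prod_ne_zero_iff.2 fun _ _ => qNum_ne_zero hq (Nat.succ_pos _)

theorem qBinom_zero_right (hq : ∀ n, 0 < n → q ^ n ≠ 1) (n : ℕ) : qBinom q n 0 = 1 := by
  rw [qBinom, Nat.sub_zero, show qFact q 0 = 1 by simp [qFact]]
  simp [qFact_ne_zero hq n]

theorem qBinom_self (hq : ∀ n, 0 < n → q ^ n ≠ 1) (n : ℕ) : qBinom q n n = 1 := by
  rw [qBinom, Nat.sub_self, show qFact q 0 = 1 by simp [qFact]]
  simp [qFact_ne_zero hq n]

theorem qBinom_symm {n k : ℕ} (h : k ≤ n) : qBinom q n (n - k) = qBinom q n k := by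
  rw [qBinom, qBinom, Nat.sub_sub_self h, mul_comm]

theorem qBinom_pascal (hq : ∀ n, 0 < n → q ^ n ≠ 1) (k m : ℕ) :
    qBinom q (k + m + 2) (k + 1) =
      qBinom q (k + m + 1) (k + 1) + q ^ (m + 1) * qBinom q (k + m + 1) k := by
  have e1 : k + m + 2 - (k + 1) = m + 1 := by omega
  have e2 : k + m + 1 - (k + 1) = m := by omega
  have e3 : k + m + 1 - k = m + 1 := by omega
  have h1 := qFact_ne_zero hq k
  have h2 := qFact_ne_zero hq m
  have h3 := qNum_ne_zero hq (Nat.succ_pos k)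
  have h4 := qNum_ne_zero hq (Nat.succ_pos m)
  have h5 : qNum q (k + m + 1 + 1) = qNum q (m + 1) + q ^ (m + 1) * qNum q (k + 1) := by
    rw [← qNum_add]; congr 1; omega
  rw [qBinom, qBinom, qBinom, e1, e2, e3, qFact_succ q (k + m + 1), qFact_succ q k, qFact_succ q m,
    h5]
  field_simp

theorem qBinom_pascal' (hq : ∀ n, 0 < n → q ^ n ≠ 1) (k m : ℕ) :
    qBinom q (k + m + 2) (k + 1) =
      q ^ (k + 1) * qBinom q (k + m + 1) (k + 1) + qBinom q (k + m + 1) k := by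
  have e1 : k + m + 2 - (k + 1) = m + 1 := by omega
  have e2 : k + m + 1 - (k + 1) = m := by omega
  have e3 : k + m + 1 - k = m + 1 := by omega
  have h1 := qFact_ne_zero hq k
  have h2 := qFact_ne_zero hq m
  have h3 := qNum_ne_zero hq (Nat.succ_pos k)
  have h4 := qNum_ne_zero hq (Nat.succ_pos m)
  have h5 : qNum q (k + m + 1 + 1) = qNum q (k + 1) + q ^ (k + 1) * qNum q (m + 1) := by
    rw [← qNum_add]; congr 1; omega
  rw [qBinom, qBinom, qBinom, e1, e2, e3, qFact_succ q (k + m + 1), qFact_succ q k, qFact_succ q m,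
    h5]
  field_simp
  ring

theorem tri_succ (k : ℕ) : (k + 1) * (k + 1 - 1) / 2 = k * (k - 1) / 2 + k := by
  have := Finset.sum_range_id_mul_two (k + 1)
  have h2 := Finset.sum_range_id_mul_two k
  rw [Finset.sum_range_succ] at this
  omega

variable {R : Type*} [Ring R] [Algebra ℂ R]

theorem sub_add_add_eq {G : Type*} [AddCommGroup G] {A B u v u' v' : G} (h : u = u') (h' : v = -v') :
    A - B + u + v = A + u' - (B + v') := by
  rw [h, h']; abel

theorem serre_zero (x : ℂ) (X Y : R) : serre 0 q x X Y = Y := by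
  simp [serre, qBinom, qFact]

theorem serre_succ (hq : ∀ n, 0 < n → q ^ n ≠ 1) (N : ℕ) (x : ℂ) (X Y : R) :
    serre (N + 1) q x X Y = X * serre N q x X Y - (q ^ N * x) • (serre N q x X Y * X) := by
  have hb0 := qBinom_zero_right hq
  have hb1 := qBinom_self hq
  unfold serre
  rw [Finset.mul_sum, Finset.sum_mul, Finset.smul_sum, Finset.sum_range_succ _ (N + 1),
    Finset.sum_range_succ' _ N, Finset.sum_range_succ' (fun k => X * _) N,
    Finset.sum_range_succ _ N]
  have key : ∀ k ∈ Finset.range N,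
      ((-1) ^ (k + 1) * qBinom q (N + 1) (k + 1) * (q ^ ((k + 1) * (k + 1 - 1) / 2) * x ^ (k + 1))) •
        (X ^ (N + 1 - (k + 1)) * Y * X ^ (k + 1)) =
      X * ((-1) ^ (k + 1) * qBinom q N (k + 1) *
        (q ^ ((k + 1) * (k + 1 - 1) / 2) * x ^ (k + 1))) • (X ^ (N - (k + 1)) * Y * X ^ (k + 1)) -
      (q ^ N * x) • (((-1) ^ k * qBinom q N k * (q ^ (k * (k - 1) / 2) * x ^ k)) •
        (X ^ (N - k) * Y * X ^ k) * X) := by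
    intro k hk
    obtain ⟨m, rfl⟩ : ∃ m, N = k + m + 1 := ⟨N - k - 1, by have := Finset.mem_range.1 hk; omega⟩
    rw [show k + m + 1 + 1 - (k + 1) = m + 1 by omega, show k + m + 1 - (k + 1) = m by omega,
      show k + m + 1 - k = m + 1 by omega, show k + m + 1 + 1 = k + m + 2 by omega,
      qBinom_pascal hq, tri_succ]
    simp only [mul_smul_comm, smul_mul_assoc, smul_smul, pow_succ X k, ← mul_assoc, ← pow_succ']
    rw [← sub_smul]
    congr 1
    ring
  rw [Finset.sum_congr rfl key, Finset.sum_sub_distrib, hb0, hb0, hb1, hb1, tri_succ]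
  refine sub_add_add_eq ?_ ?_
  · simp [pow_succ', mul_assoc]
  · rw [smul_mul_assoc, smul_smul, ← neg_smul]
    simp only [Nat.sub_self, pow_zero, one_mul, mul_one, mul_assoc, ← pow_succ]
    congr 1
    ring

theorem serre_succ' (hq : ∀ n, 0 < n → q ^ n ≠ 1) (N : ℕ) (x : ℂ) (X Y : R) :
    serre (N + 1) q x X Y = X * serre N q (q * x) X Y - x • (serre N q (q * x) X Y * X) := by
  have hb0 := qBinom_zero_right hq
  have hb1 := qBinom_self hq
  unfold serre
  rw [Finset.mul_sum, Finset.sum_mul, Finset.smul_sum, Finset.sum_range_succ _ (N + 1),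
    Finset.sum_range_succ' _ N, Finset.sum_range_succ' (fun k => X * _) N,
    Finset.sum_range_succ _ N]
  have key : ∀ k ∈ Finset.range N,
      ((-1) ^ (k + 1) * qBinom q (N + 1) (k + 1) * (q ^ ((k + 1) * (k + 1 - 1) / 2) * x ^ (k + 1))) •
        (X ^ (N + 1 - (k + 1)) * Y * X ^ (k + 1)) =
      X * ((-1) ^ (k + 1) * qBinom q N (k + 1) *
        (q ^ ((k + 1) * (k + 1 - 1) / 2) * (q * x) ^ (k + 1))) •
          (X ^ (N - (k + 1)) * Y * X ^ (k + 1)) -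
      x • (((-1) ^ k * qBinom q N k * (q ^ (k * (k - 1) / 2) * (q * x) ^ k)) •
        (X ^ (N - k) * Y * X ^ k) * X) := by
    intro k hk
    obtain ⟨m, rfl⟩ : ∃ m, N = k + m + 1 := ⟨N - k - 1, by have := Finset.mem_range.1 hk; omega⟩
    rw [show k + m + 1 + 1 - (k + 1) = m + 1 by omega, show k + m + 1 - (k + 1) = m by omega,
      show k + m + 1 - k = m + 1 by omega, show k + m + 1 + 1 = k + m + 2 by omega,
      qBinom_pascal' hq, tri_succ]
    simp only [mul_smul_comm, smul_mul_assoc, smul_smul, pow_succ X k, ← mul_assoc, ← pow_succ']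
    rw [← sub_smul]
    congr 1
    ring
  rw [Finset.sum_congr rfl key, Finset.sum_sub_distrib, hb0, hb0, hb1, hb1, tri_succ]
  refine sub_add_add_eq ?_ ?_
  · simp [pow_succ', mul_assoc]
  · rw [smul_mul_assoc, smul_smul, ← neg_smul]
    simp only [Nat.sub_self, pow_zero, one_mul, mul_one, mul_assoc, ← pow_succ]
    congr 1
    ring

theorem serre_add_left (N : ℕ) (x : ℂ) (X Y Z : R) :
    serre N q x X (Y + Z) = serre N q x X Y + serre N q x X Z := by
  simp [serre, mul_add, add_mul, Finset.sum_add_distrib]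

/-- moving a skew-commuting element through a power -/
theorem pow_skew {X Y : R} {p : ℂ} (h : X * Y = p • (Y * X)) (n : ℕ) :
    X ^ n * Y = p ^ n • (Y * X ^ n) := by
  induction n with
  | zero => simp
  | succ n ih =>
    rw [pow_succ, mul_assoc, h, mul_smul_comm, ← mul_assoc, ih, smul_mul_assoc, smul_smul,
      mul_assoc, pow_succ, mul_comm]

theorem skew_pow {X Y : R} {p : ℂ} (h : X * Y = p • (Y * X)) (n : ℕ) :
    X * Y ^ n = p ^ n • (Y ^ n * X) := by
  induction n with
  | zero => simp
  | succ n ih =>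
    rw [pow_succ, ← mul_assoc, ih, smul_mul_assoc, mul_assoc, h, mul_smul_comm, smul_smul,
      ← mul_assoc, pow_succ]

theorem serre_skew_right {X U Y : R} {p p' x : ℂ} (hX : X * Y = p • (Y * X))
    (hU : U * Y = p' • (Y * U)) (N : ℕ) :
    serre N q x X U * Y = (p ^ N * p') • (Y * serre N q x X U) := by
  unfold serre
  rw [Finset.sum_mul, Finset.mul_sum, Finset.smul_sum]
  refine Finset.sum_congr rfl fun k hk => ?_
  have hk' : k ≤ N := Nat.lt_succ_iff.1 (Finset.mem_range.1 hk)
  rw [smul_mul_assoc, mul_smul_comm, smul_comm _ _ (Y * _)]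
  congr 1
  rw [mul_assoc, pow_skew hX, mul_smul_comm, ← mul_assoc, mul_assoc (X ^ (N - k)) U Y, hU,
    mul_smul_comm, ← mul_assoc, pow_skew hX]
  simp only [smul_mul_assoc, smul_smul, mul_assoc]
  congr 1
  rw [show p ^ N = p ^ k * p ^ (N - k) by rw [← pow_add]; congr 1; omega]
  ring

theorem serre_skew_left {X Y V : R} {p p' x : ℂ} (hX : X * Y = p • (Y * X))
    (hV : X * V = p' • (V * X)) (N : ℕ) :
    X * serre N q x Y V = (p ^ N * p') • (serre N q x Y V * X) := by
  unfold serre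
  rw [Finset.sum_mul, Finset.mul_sum, Finset.smul_sum]
  refine Finset.sum_congr rfl fun k hk => ?_
  have hk' : k ≤ N := Nat.lt_succ_iff.1 (Finset.mem_range.1 hk)
  rw [smul_mul_assoc, mul_smul_comm, smul_comm _ _ (_ * X)]
  congr 1
  rw [mul_assoc (Y ^ (N - k)), ← mul_assoc X, skew_pow hX, smul_mul_assoc, mul_assoc (Y ^ (N - k)),
    ← mul_assoc X V, hV, smul_mul_assoc, mul_assoc V X, skew_pow hX]
  simp only [smul_smul, mul_assoc, mul_smul_comm]
  congr 1
  rw [show p ^ N = p ^ k * p ^ (N - k) by rw [← pow_add]; congr 1; omega]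
  ring

/-- The quantum Serre expression is skew-primitive. -/
theorem serre_add (hq : ∀ n, 0 < n → q ^ n ≠ 1) {X Y U V : R} {p p₁ p₂ x : ℂ} (N : ℕ)
    (hXY : X * Y = p • (Y * X)) (hXV : X * V = p₁ • (V * X)) (hUY : U * Y = p₂ • (Y * U))
    (hp : q * p = 1) (hx : x * p₂ = 1) (hN : 0 < N → x * q ^ N = q * p₁) (hN0 : 0 < N) :
    serre N q x (X + Y) (U + V) = serre N q x X U + serre N q x Y V := by
  have A : ∀ n, serre n q x (X + Y) U = serre n q x X U := by
    intro n
    induction n with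
    | zero => simp [serre_zero]
    | succ n ih =>
      rw [serre_succ hq, serre_succ hq, ih, add_mul, mul_add, serre_skew_right hXY hUY, smul_add,
        smul_smul, show q ^ n * x * (p ^ n * p₂) = (q * p) ^ n * (x * p₂) by ring, hp, hx]
      simp
  have B : ∀ n, ∀ x : ℂ, x * q ^ n = q * p₁ ∨ n = 0 →
      serre n q x (X + Y) V = serre n q x Y V := by
    intro n
    induction n with
    | zero => simp [serre_zero]
    | succ n ih =>
      intro x hx
      have hx : x * q ^ (n + 1) = q * p₁ := by simpa using hx
      have h1 : x * q ^ n = p₁ := by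
        linear_combination p * hx - (x * q ^ n - p₁) * hp
      rw [serre_succ' hq, serre_succ' hq, ih (q * x) (Or.inl (by rw [← hx]; ring)), add_mul,
        mul_add, serre_skew_left hXY hXV, smul_add, ← h1,
        show p ^ n * (x * q ^ n) = (q * p) ^ n * x by ring, hp]
      simp only [one_pow, one_mul]
      abel
  rw [serre_add_left, A, B _ _ (Or.inl (hN hN0))]

theorem serreOp_eq_unop (N : ℕ) (x : ℂ) (X Y : R) :
    MulOpposite.op (serreOp N q x X Y) =
      serre N q x (MulOpposite.op X) (MulOpposite.op Y) := by
  simp [serre, serreOp, Finset.op_sum, mul_assoc]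

theorem serre_op_eq_serreOp (N : ℕ) (x : ℂ) (X Y : R) :
    MulOpposite.op (serre N q x X Y) =
      serreOp N q x (MulOpposite.op X) (MulOpposite.op Y) := by
  simp [serre, serreOp, Finset.op_sum, mul_assoc]

theorem serreOp_add (hq : ∀ n, 0 < n → q ^ n ≠ 1) {X Y U V : R} {p p₁ p₂ x : ℂ} (N : ℕ)
    (hXY : Y * X = p • (X * Y)) (hXV : V * X = p₁ • (X * V)) (hUY : Y * U = p₂ • (U * Y))
    (hp : q * p = 1) (hx : x * p₂ = 1) (hN : 0 < N → x * q ^ N = q * p₁) (hN0 : 0 < N) :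
    serreOp N q x (X + Y) (U + V) = serreOp N q x X U + serreOp N q x Y V := by
  apply MulOpposite.op_injective
  rw [MulOpposite.op_add, serreOp_eq_unop, serreOp_eq_unop, serreOp_eq_unop, MulOpposite.op_add,
    MulOpposite.op_add]
  refine serre_add hq N (p := p) (p₁ := p₁) (p₂ := p₂) ?_ ?_ ?_ hp hx hN hN0 <;>
    simp only [← MulOpposite.op_mul, ← MulOpposite.op_smul, hXY, hXV, hUY]

theorem map_serre {S : Type*} [Ring S] [Algebra ℂ S] (f : R →ₐ[ℂ] S) (N : ℕ) (x : ℂ) (X Y : R) :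
    f (serre N q x X Y) = serre N q x (f X) (f Y) := by
  simp [serre, map_sum]

theorem map_serreOp {S : Type*} [Ring S] [Algebra ℂ S] (f : R →ₐ[ℂ] S) (N : ℕ) (x : ℂ) (X Y : R) :
    f (serreOp N q x X Y) = serreOp N q x (f X) (f Y) := by
  simp [serreOp, map_sum]

theorem mul_pow_skew {X k : R} {a : ℂ} (h : k * X = a • (X * k)) (n : ℕ) :
    (X * k) ^ n = a ^ (n * (n - 1) / 2) • (X ^ n * k ^ n) := by
  induction n with
  | zero => simp
  | succ n ih =>
    rw [pow_succ, ih, smul_mul_assoc, mul_assoc, ← mul_assoc _ X k, pow_skew h, tri_succ, pow_add,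
      smul_mul_assoc, mul_smul_comm, smul_smul, pow_succ, pow_succ]
    simp only [mul_assoc]

theorem tri_add (m n : ℕ) :
    (m + n) * (m + n - 1) / 2 = m * (m - 1) / 2 + n * (n - 1) / 2 + m * n := by
  induction n with
  | zero => simp
  | succ n ih => rw [← add_assoc, tri_succ, ih, tri_succ]; ring

theorem twist_term {X Y k l : R} {a b c : ℂ} (hX : k * X = a • (X * k)) (hY : k * Y = b • (Y * k))
    (hl : l * X = c • (X * l)) (hkl : k * l = l * k) (n m : ℕ) :
    (X * k) ^ n * (Y * l) * (X * k) ^ m =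
      (a ^ ((n + m) * (n + m - 1) / 2) * b ^ n * c ^ m) •
        (X ^ n * Y * X ^ m * (k ^ (n + m) * l)) := by
  have h1 : k ^ n * Y = b ^ n • (Y * k ^ n) := pow_skew hY n
  have h2 : l * X ^ m = c ^ m • (X ^ m * l) := skew_pow hl m
  have h3 : k ^ n * X ^ m = (a ^ m) ^ n • (X ^ m * k ^ n) := pow_skew (skew_pow hX m) n
  have h4 : l * k ^ m = k ^ m * l := (Commute.pow_left hkl m).symm
  rw [mul_pow_skew hX, mul_pow_skew hX]
  calc _ = (a ^ (n * (n - 1) / 2) * a ^ (m * (m - 1) / 2)) •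
        (X ^ n * (k ^ n * Y) * (l * X ^ m) * k ^ m) := by
        simp only [smul_mul_assoc, mul_smul_comm, smul_smul, mul_assoc, mul_comm]
    _ = (a ^ (n * (n - 1) / 2) * a ^ (m * (m - 1) / 2) * (b ^ n * c ^ m)) •
        (X ^ n * Y * (k ^ n * X ^ m) * (l * k ^ m)) := by
        rw [h1, h2]
        simp only [smul_mul_assoc, mul_smul_comm, smul_smul, mul_assoc]
        congr 1
        ring
    _ = _ := by
        rw [h3, h4, tri_add]
        simp only [smul_mul_assoc, mul_smul_comm, smul_smul, mul_assoc, pow_add]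
        congr 1
        ring

theorem twist_scalar (a : ℂ) {b c x : ℂ} (m n : ℕ) (hc : q * c = q ^ (m + n) * x ^ 2 * b)
    (hq0 : q ≠ 0) :
    (-1) ^ m * qBinom q (m + n) m * (q ^ (m * (m - 1) / 2) * x ^ m) *
        (a ^ ((m + n) * (m + n - 1) / 2) * b ^ m * c ^ n) =
      a ^ ((m + n) * (m + n - 1) / 2) *
          ((-1) ^ (m + n) * q ^ ((m + n) * (m + n - 1) / 2) * x ^ (m + n) * b ^ (m + n)) *
        ((-1) ^ n * qBinom q (m + n) n * (q ^ (n * (n - 1) / 2) * x ^ n)) := by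
  rw [← qBinom_symm (show n ≤ m + n by omega), Nat.add_sub_cancel]
  have hc' : c ^ n * q ^ n = (q ^ (m + n) * x ^ 2 * b) ^ n := by rw [← mul_pow, mul_comm c, hc]
  have hsq : q ^ (n * n) = q ^ (n * (n - 1) / 2) * q ^ (n * (n - 1) / 2) * q ^ n := by
    rw [← pow_add, ← pow_add]; congr 1
    rcases n with _ | n
    · simp
    · have h2 := Finset.sum_range_id_mul_two (n + 1)
      have h3 : (∑ i ∈ Finset.range (n + 1), i) = (n + 1) * (n + 1 - 1) / 2 :=
        Finset.sum_range_id (n + 1)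
      rw [h3] at h2
      have : (n + 1) * (n + 1) = (n + 1) * (n + 1 - 1) + (n + 1) := by simp; ring
      omega
  have hs : ((-1 : ℂ)) ^ n * (-1) ^ n = 1 := by rw [← mul_pow]; simp
  rw [tri_add]
  have hc'' : c ^ n = q ^ (m * n) * q ^ (n * (n - 1) / 2) * q ^ (n * (n - 1) / 2) *
      x ^ n * x ^ n * b ^ n := by
    refine mul_right_cancel₀ (pow_ne_zero n hq0) ?_
    rw [hc', mul_pow, mul_pow, ← pow_mul, add_mul, pow_add, hsq]
    ring
  rw [hc'']
  simp only [pow_add]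
  linear_combination (-1) ^ m * qBinom q (m + n) m * q ^ (m * (m - 1) / 2) * x ^ m *
    a ^ (m * (m - 1) / 2) * a ^ (n * (n - 1) / 2) * a ^ (m * n) * b ^ m * q ^ (m * n) *
    q ^ (n * (n - 1) / 2) * q ^ (n * (n - 1) / 2) * x ^ n * x ^ n * b ^ n * (-1 : ℂ) * hs

theorem serreOp_twist {X Y k l : R} {a b c x : ℂ} (N : ℕ) (hX : k * X = a • (X * k))
    (hY : k * Y = b • (Y * k)) (hl : l * X = c • (X * l)) (hkl : k * l = l * k)
    (hc : q * c = q ^ N * x ^ 2 * b) (hq0 : q ≠ 0) :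
    ∃ C : ℂ, serreOp N q x (X * k) (Y * l) = C • (serre N q x X Y * (k ^ N * l)) := by
  refine ⟨a ^ (N * (N - 1) / 2) * ((-1) ^ N * q ^ (N * (N - 1) / 2) * x ^ N * b ^ N), ?_⟩
  unfold serre serreOp
  rw [Finset.sum_mul, Finset.smul_sum, ← Finset.sum_range_reflect]
  refine Finset.sum_congr rfl fun n hn => ?_
  obtain ⟨m, rfl⟩ : ∃ m, N = m + n := ⟨N - n, by have := Finset.mem_range.1 hn; omega⟩
  have e1 : m + n + 1 - 1 - n = m := by omega
  have e2 : m + n - m = n := by omega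
  have e3 : m + n - n = m := by omega
  rw [e1, e2, e3, twist_term hX hY hl hkl, smul_smul, smul_mul_assoc, smul_smul,
    twist_scalar a m n hc hq0]

theorem serre_twist {X Y k l : R} {a b c x : ℂ} (N : ℕ) (hX : k * X = a • (X * k))
    (hY : k * Y = b • (Y * k)) (hl : l * X = c • (X * l)) (hkl : k * l = l * k)
    (hc : q * b = q ^ N * x ^ 2 * c) (hq0 : q ≠ 0) :
    ∃ C : ℂ, serre N q x (X * k) (Y * l) = C • (serreOp N q x X Y * (k ^ N * l)) := by
  refine ⟨a ^ (N * (N - 1) / 2) * ((-1) ^ N * q ^ (N * (N - 1) / 2) * x ^ N * c ^ N), ?_⟩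
  unfold serre serreOp
  rw [Finset.sum_mul, Finset.smul_sum, ← Finset.sum_range_reflect]
  refine Finset.sum_congr rfl fun n hn => ?_
  obtain ⟨m, rfl⟩ : ∃ m, N = m + n := ⟨N - n, by have := Finset.mem_range.1 hn; omega⟩
  have e1 : m + n + 1 - 1 - n = m := by omega
  have e2 : m + n - m = n := by omega
  have e3 : m + n - n = m := by omega
  rw [e1, e2, e3, twist_term hX hY hl hkl, smul_smul, smul_mul_assoc, smul_smul, add_comm n m,
    mul_right_comm _ (b ^ n) (c ^ m), twist_scalar a m n hc hq0]

theorem serre_tmul {S : Type*} [Ring S] [Algebra ℂ S] (N : ℕ) (x : ℂ) (X Y : R) {k l : S}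
    (h : k * l = l * k) :
    serre N q x (X ⊗ₜ[ℂ] k) (Y ⊗ₜ[ℂ] l) = serre N q x X Y ⊗ₜ[ℂ] (k ^ N * l) := by
  unfold serre
  rw [TensorProduct.sum_tmul]
  refine Finset.sum_congr rfl fun n hn => ?_
  have : N - n + n = N := by have := Finset.mem_range.1 hn; omega
  have hc : k ^ (N - n) * l * k ^ n = k ^ N * l := by
    rw [mul_assoc, ← (Commute.pow_left h n : k ^ n * l = l * k ^ n), ← mul_assoc, ← pow_add, this]
  simp only [Algebra.TensorProduct.tmul_pow, Algebra.TensorProduct.tmul_mul_tmul, hc,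
    TensorProduct.smul_tmul']

theorem serreOp_tmul {S : Type*} [Ring S] [Algebra ℂ S] (N : ℕ) (x : ℂ) (X Y : R) {k l : S}
    (h : k * l = l * k) :
    serreOp N q x (k ⊗ₜ[ℂ] X) (l ⊗ₜ[ℂ] Y) = (k ^ N * l) ⊗ₜ[ℂ] serreOp N q x X Y := by
  unfold serreOp
  rw [TensorProduct.tmul_sum]
  refine Finset.sum_congr rfl fun n hn => ?_
  have : n + (N - n) = N := by have := Finset.mem_range.1 hn; omega
  have hc : k ^ n * l * k ^ (N - n) = k ^ N * l := by
    rw [mul_assoc, ← (Commute.pow_left h (N - n) : k ^ (N - n) * l = l * k ^ (N - n)), ← mul_assoc,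
      ← pow_add, this]
  simp only [Algebra.TensorProduct.tmul_pow, Algebra.TensorProduct.tmul_mul_tmul, hc,
    TensorProduct.tmul_smul]

theorem serre_smul (N : ℕ) (x c d : ℂ) (X Y : R) :
    serre N q x (c • X) (d • Y) = (c ^ N * d) • serre N q x X Y := by
  unfold serre
  rw [Finset.smul_sum]
  refine Finset.sum_congr rfl fun k hk => ?_
  obtain ⟨m, rfl⟩ : ∃ m, N = m + k := ⟨N - k, by have := Finset.mem_range.1 hk; omega⟩
  rw [Nat.add_sub_cancel, smul_pow, smul_pow]
  simp only [smul_mul_assoc, mul_smul_comm, smul_smul]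
  congr 1
  ring

theorem serreOp_smul (N : ℕ) (x c d : ℂ) (X Y : R) :
    serreOp N q x (c • X) (d • Y) = (c ^ N * d) • serreOp N q x X Y := by
  apply MulOpposite.op_injective
  rw [serreOp_eq_unop, MulOpposite.op_smul, MulOpposite.op_smul, serre_smul, MulOpposite.op_smul,
    serreOp_eq_unop]

end qLemmas
end TwoParam

namespace TwoParam

/-! ### The two-parameter data -/

/-- A Cartan matrix of finite type `a` (rows and columns indexed by the totally ordered set `ι` of
simple roots), relatively prime positive integers `d` symmetrizing it, and two nonzero complex
parameters `r`, `s` such that `r / s` is not a root of unity. -/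
structure Datum (ι : Type*) [Fintype ι] [LinearOrder ι] where
  a : ι → ι → ℤ
  a_diag : ∀ i, a i i = 2
  a_offDiag : ∀ i j, i ≠ j → a i j ≤ 0
  d : ι → ℕ
  d_pos : ∀ i, 0 < d i
  d_gcd : Finset.univ.gcd d = 1
  d_symm : ∀ i j, (d i : ℤ) * a i j = d j * a j i
  posDef : (Matrix.of fun i j => (d i : ℝ) * (a i j : ℝ)).PosDef
  r : ℂ
  s : ℂ
  r_ne_zero : r ≠ 0
  s_ne_zero : s ≠ 0
  not_root_of_unity : ∀ n : ℕ, 0 < n → (r * s⁻¹) ^ n ≠ 1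

variable {ι : Type*} [Fintype ι] [LinearOrder ι]

namespace Datum

variable (Q : Datum ι)

/-- The Euler form `⟨i, j⟩` on simple roots. -/
def euler (i j : ι) : ℤ := if i < j then Q.d i * Q.a i j else if i = j then Q.d i else 0

/-- `r_i s_i⁻¹`, where `r_i = r ^ d_i` and `s_i = s ^ d_i`. -/
noncomputable def q (i : ι) : ℂ := Q.r ^ Q.d i * (Q.s ^ Q.d i)⁻¹

/-- `χ i j = r ^ ⟨i, j⟩ * s ^ (-⟨j, i⟩)`. -/
noncomputable def χ (i j : ι) : ℂ := Q.r ^ Q.euler i j * Q.s ^ (-Q.euler j i)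

/-- The exponent `1 - a_ij` of the quantum Serre relations (for `i ≠ j`). -/
def N (i j : ι) : ℕ := (1 - Q.a i j).toNat

theorem q_eq (i : ι) : Q.q i = (Q.r * Q.s⁻¹) ^ Q.d i := by
  rw [q, mul_pow, inv_pow]

theorem q_not_root (i : ι) : ∀ n, 0 < n → Q.q i ^ n ≠ 1 := fun n hn => by
  rw [q_eq, ← pow_mul]
  exact Q.not_root_of_unity _ (Nat.mul_pos (Q.d_pos i) hn)

theorem q_ne_zero (i : ι) : Q.q i ≠ 0 := by
  rw [q_eq]; exact pow_ne_zero _ (mul_ne_zero Q.r_ne_zero (inv_ne_zero Q.s_ne_zero))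

theorem χ_ne_zero (i j : ι) : Q.χ i j ≠ 0 :=
  mul_ne_zero (zpow_ne_zero _ Q.r_ne_zero) (zpow_ne_zero _ Q.s_ne_zero)

theorem χ_self (i : ι) : Q.χ i i = Q.q i := by
  simp [χ, q, euler]

theorem s_sub_r_ne_zero (i : ι) : Q.s ^ Q.d i - Q.r ^ Q.d i ≠ 0 := by
  intro h
  have h2 := Q.q_not_root i 1 one_pos
  have hs : Q.s ^ Q.d i ≠ 0 := pow_ne_zero _ Q.s_ne_zero
  rw [pow_one, q, ← sub_eq_zero.1 h, mul_inv_cancel₀ hs] at h2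
  exact h2 rfl

theorem N_pos {i j : ι} (h : i ≠ j) : 0 < Q.N i j := by
  have := Q.a_offDiag i j h
  simp only [N]; omega

theorem euler_add {i j : ι} (h : i ≠ j) : Q.euler i j + Q.euler j i = Q.d i * Q.a i j := by
  rcases lt_or_gt_of_ne h with h' | h'
  · simp [euler, h', h'.not_gt, h.symm]
  · simp [euler, h', h'.not_gt, h, Q.d_symm]

theorem χ_mul {i j : ι} (h : i ≠ j) : Q.χ i j * Q.χ j i * Q.q i ^ Q.N i j = Q.q i := by
  have h1 : Q.χ i j * Q.χ j i = Q.q i ^ Q.a i j := by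
    rw [χ, χ, mul_mul_mul_comm, ← zpow_add₀ Q.r_ne_zero, ← zpow_add₀ Q.s_ne_zero, q_eq,
      ← zpow_natCast, ← zpow_mul, mul_zpow, inv_zpow', add_comm (-Q.euler j i), ← neg_add,
      euler_add Q h]
  have h2 : ((Q.N i j : ℕ) : ℤ) = 1 - Q.a i j := by
    have := Q.a_offDiag i j h
    simp only [N]; omega
  rw [h1, ← zpow_natCast, h2, ← zpow_add₀ (Q.q_ne_zero i)]
  simp

end Datum

/-- Generators of the two Borel-type algebras: a root vector, a torus element and its inverse for
each simple root. -/
inductive Gen (ι : Type*)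
  | X (i : ι)
  | K (i : ι)
  | Kinv (i : ι)

open FreeAlgebra Gen in
/-- Defining relations of `U_{r,s}^{≥}`; here `X i, K i, Kinv i` stand for `E_i, K'_i, K'_i⁻¹`. -/
inductive RelGe (Q : Datum ι) : FreeAlgebra ℂ (Gen ι) → FreeAlgebra ℂ (Gen ι) → Prop
  | K_Kinv (i) : RelGe Q (FreeAlgebra.ι ℂ (K i) * FreeAlgebra.ι ℂ (Kinv i)) 1
  | Kinv_K (i) : RelGe Q (FreeAlgebra.ι ℂ (Kinv i) * FreeAlgebra.ι ℂ (K i)) 1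
  | K_comm (i j) : RelGe Q (FreeAlgebra.ι ℂ (K i) * FreeAlgebra.ι ℂ (K j))
      (FreeAlgebra.ι ℂ (K j) * FreeAlgebra.ι ℂ (K i))
  | K_E (i j) : RelGe Q
      (FreeAlgebra.ι ℂ (K i) * FreeAlgebra.ι ℂ (X j) * FreeAlgebra.ι ℂ (Kinv i))
      ((Q.r ^ (-Q.euler i j) * Q.s ^ Q.euler j i) • FreeAlgebra.ι ℂ (X j))
  | serre (i j) (h : i ≠ j) : RelGe Q
      (serre (Q.N i j) (Q.q i) (Q.χ j i) (FreeAlgebra.ι ℂ (X i)) (FreeAlgebra.ι ℂ (X j))) 0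

open FreeAlgebra Gen in
/-- Defining relations of `U_{r,s}^{≤}`; here `X i, K i, Kinv i` stand for `F_i, K_i, K_i⁻¹`. -/
inductive RelLe (Q : Datum ι) : FreeAlgebra ℂ (Gen ι) → FreeAlgebra ℂ (Gen ι) → Prop
  | K_Kinv (i) : RelLe Q (FreeAlgebra.ι ℂ (K i) * FreeAlgebra.ι ℂ (Kinv i)) 1
  | Kinv_K (i) : RelLe Q (FreeAlgebra.ι ℂ (Kinv i) * FreeAlgebra.ι ℂ (K i)) 1
  | K_comm (i j) : RelLe Q (FreeAlgebra.ι ℂ (K i) * FreeAlgebra.ι ℂ (K j))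
      (FreeAlgebra.ι ℂ (K j) * FreeAlgebra.ι ℂ (K i))
  | K_F (i j) : RelLe Q
      (FreeAlgebra.ι ℂ (K i) * FreeAlgebra.ι ℂ (X j) * FreeAlgebra.ι ℂ (Kinv i))
      ((Q.r ^ (-Q.euler j i) * Q.s ^ Q.euler i j) • FreeAlgebra.ι ℂ (X j))
  | serre (i j) (h : i ≠ j) : RelLe Q
      (serreOp (Q.N i j) (Q.q i) (Q.χ j i) (FreeAlgebra.ι ℂ (X i)) (FreeAlgebra.ι ℂ (X j))) 0

/-- The algebra `U_{r,s}^{≥}(𝔤)`. -/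
def UGe (Q : Datum ι) : Type _ := RingQuot (RelGe Q)

/-- The algebra `U_{r,s}^{≤}(𝔤)`. -/
def ULe (Q : Datum ι) : Type _ := RingQuot (RelLe Q)

noncomputable instance (Q : Datum ι) : Ring (UGe Q) := inferInstanceAs (Ring (RingQuot (RelGe Q)))
noncomputable instance (Q : Datum ι) : Algebra ℂ (UGe Q) :=
  inferInstanceAs (Algebra ℂ (RingQuot (RelGe Q)))
noncomputable instance (Q : Datum ι) : Ring (ULe Q) := inferInstanceAs (Ring (RingQuot (RelLe Q)))
noncomputable instance (Q : Datum ι) : Algebra ℂ (ULe Q) :=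
  inferInstanceAs (Algebra ℂ (RingQuot (RelLe Q)))

theorem Datum.χ_inv (Q : Datum ι) (i j : ι) :
    Q.r ^ (-Q.euler i j) * Q.s ^ Q.euler j i = (Q.χ i j)⁻¹ := by
  rw [Datum.χ, mul_inv, ← zpow_neg, ← zpow_neg, neg_neg]

/-- Commutation of torus elements with root vectors, in the various forms needed. -/
theorem skew_forms {R : Type*} [Ring R] [Algebra ℂ R] {x k k' : R} {c : ℂ} (hc : c ≠ 0)
    (h1 : k * k' = 1) (h2 : k' * k = 1) (h : k * x * k' = c⁻¹ • x) :
    k * x = c⁻¹ • (x * k) ∧ k' * x = c • (x * k') := by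
  have h3 : k * x = c⁻¹ • (x * k) := by
    rw [← smul_mul_assoc, ← h, mul_assoc _ k' k, h2, mul_one]
  refine ⟨h3, ?_⟩
  have : k' * (k * x) * k' = k' * (c⁻¹ • (x * k)) * k' := by rw [h3]
  rw [← mul_assoc, h2, one_mul, mul_smul_comm, smul_mul_assoc, mul_assoc, mul_assoc, h1,
    mul_one] at this
  rw [this, smul_smul, mul_inv_cancel₀ hc, one_smul]

theorem comm_inv {R : Type*} [Ring R] {k k' l : R} (h1 : k * k' = 1) (h2 : k' * k = 1)
    (h : k * l = l * k) : k' * l = l * k' := by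
  calc k' * l = k' * (l * k) * k' := by rw [mul_assoc, mul_assoc, h1, mul_one]
    _ = l * k' := by rw [← h, ← mul_assoc, h2, one_mul]

namespace UGe

variable (Q : Datum ι)

/-- The generator `E_i`. -/
noncomputable def E (i : ι) : UGe Q := RingQuot.mkAlgHom ℂ (RelGe Q) (FreeAlgebra.ι ℂ (Gen.X i))
/-- The generator `K'_i`. -/
noncomputable def K (i : ι) : UGe Q := RingQuot.mkAlgHom ℂ (RelGe Q) (FreeAlgebra.ι ℂ (Gen.K i))
/-- The generator `K'_i⁻¹`. -/
noncomputable def Kinv (i : ι) : UGe Q :=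
  RingQuot.mkAlgHom ℂ (RelGe Q) (FreeAlgebra.ι ℂ (Gen.Kinv i))

theorem K_Kinv (i : ι) : K Q i * Kinv Q i = 1 := by
  have := RingQuot.mkAlgHom_rel ℂ (RelGe.K_Kinv (Q := Q) i)
  rwa [map_mul, map_one] at this

theorem Kinv_K (i : ι) : Kinv Q i * K Q i = 1 := by
  have := RingQuot.mkAlgHom_rel ℂ (RelGe.Kinv_K (Q := Q) i)
  rwa [map_mul, map_one] at this

theorem K_comm (i j : ι) : K Q i * K Q j = K Q j * K Q i := by
  have := RingQuot.mkAlgHom_rel ℂ (RelGe.K_comm (Q := Q) i j)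
  rwa [map_mul, map_mul] at this

theorem K_E_Kinv (i j : ι) : K Q i * E Q j * Kinv Q i = (Q.χ i j)⁻¹ • E Q j := by
  have := RingQuot.mkAlgHom_rel ℂ (RelGe.K_E (Q := Q) i j)
  rwa [map_mul, map_mul, map_smul, Q.χ_inv] at this

theorem serre_E {i j : ι} (h : i ≠ j) :
    serre (Q.N i j) (Q.q i) (Q.χ j i) (E Q i) (E Q j) = 0 := by
  have := RingQuot.mkAlgHom_rel ℂ (RelGe.serre (Q := Q) i j h)
  rwa [map_serre, map_zero] at this

theorem K_E (i j : ι) : K Q i * E Q j = (Q.χ i j)⁻¹ • (E Q j * K Q i) :=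
  (skew_forms (Q.χ_ne_zero i j) (K_Kinv Q i) (Kinv_K Q i) (K_E_Kinv Q i j)).1

theorem Kinv_E (i j : ι) : Kinv Q i * E Q j = Q.χ i j • (E Q j * Kinv Q i) :=
  (skew_forms (Q.χ_ne_zero i j) (K_Kinv Q i) (Kinv_K Q i) (K_E_Kinv Q i j)).2

theorem Kinv_K_comm (i j : ι) : Kinv Q i * K Q j = K Q j * Kinv Q i :=
  comm_inv (K_Kinv Q i) (Kinv_K Q i) (K_comm Q i j)

theorem Kinv_comm (i j : ι) : Kinv Q i * Kinv Q j = Kinv Q j * Kinv Q i :=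
  comm_inv (K_Kinv Q i) (Kinv_K Q i) (Kinv_K_comm Q j i).symm

section lift

variable {R : Type*} [Ring R] [Algebra ℂ R]

/-- The families `e`, `k`, `k'` satisfy the defining relations of `U_{r,s}^{≥}`. -/
structure IsRep (e k k' : ι → R) : Prop where
  h1 : ∀ i, k i * k' i = 1
  h2 : ∀ i, k' i * k i = 1
  h3 : ∀ i j, k i * k j = k j * k i
  h4 : ∀ i j, k i * e j = (Q.χ i j)⁻¹ • (e j * k i)
  h5 : ∀ i j, i ≠ j → serre (Q.N i j) (Q.q i) (Q.χ j i) (e i) (e j) = 0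

/-- The universal property of `U_{r,s}^{≥}`. -/
noncomputable def lift (e k k' : ι → R) (h : IsRep Q e k k') : UGe Q →ₐ[ℂ] R :=
  RingQuot.liftAlgHom ℂ ⟨FreeAlgebra.lift ℂ fun g => match g with
    | .X i => e i
    | .K i => k i
    | .Kinv i => k' i, by
    intro x y hxy
    induction hxy with
    | K_Kinv i => simp [h.h1]
    | Kinv_K i => simp [h.h2]
    | K_comm i j => simp [h.h3 i j]
    | K_E i j =>
      rw [Q.χ_inv]
      simp only [map_mul, map_smul, FreeAlgebra.lift_ι_apply]
      rw [h.h4, smul_mul_assoc, mul_assoc, h.h1, mul_one]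
    | serre i j hij => simp [map_serre, h.h5 i j hij]⟩

variable {Q} {e k k' : ι → R} (h : IsRep Q e k k')

theorem lift_E (i : ι) : lift Q e k k' h (E Q i) = e i := by
  unfold lift E; erw [RingQuot.liftAlgHom_mkAlgHom_apply]; simp
theorem lift_K (i : ι) : lift Q e k k' h (K Q i) = k i := by
  unfold lift K; erw [RingQuot.liftAlgHom_mkAlgHom_apply]; simp
theorem lift_Kinv (i : ι) : lift Q e k k' h (Kinv Q i) = k' i := by
  unfold lift Kinv; erw [RingQuot.liftAlgHom_mkAlgHom_apply]; simp

end lift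

variable {Q}

theorem hom_ext {R : Type*} [Semiring R] [Algebra ℂ R] {f g : UGe Q →ₐ[ℂ] R}
    (hE : ∀ i, f (E Q i) = g (E Q i)) (hK : ∀ i, f (K Q i) = g (K Q i))
    (hK' : ∀ i, f (Kinv Q i) = g (Kinv Q i)) : f = g := by
  apply RingQuot.ringQuot_ext'
  apply FreeAlgebra.hom_ext
  funext x
  cases x with
  | X i => exact hE i
  | K i => exact hK i
  | Kinv i => exact hK' i

theorem induct {P : UGe Q → Prop} (hE : ∀ i, P (E Q i)) (hK : ∀ i, P (K Q i))
    (hK' : ∀ i, P (Kinv Q i)) (hc : ∀ c : ℂ, P (algebraMap ℂ _ c))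
    (hadd : ∀ x y, P x → P y → P (x + y)) (hmul : ∀ x y, P x → P y → P (x * y)) (x : UGe Q) :
    P x := by
  obtain ⟨y, rfl⟩ := RingQuot.mkAlgHom_surjective ℂ (RelGe Q) x
  induction y using FreeAlgebra.induction with
  | grade0 c => simpa only [AlgHom.commutes] using! hc c
  | grade1 g =>
    cases g with
    | X i => exact hE i
    | K i => exact hK i
    | Kinv i => exact hK' i
  | mul a b ha hb => rw [map_mul]; exact hmul _ _ ha hb
  | add a b ha hb => rw [map_add]; exact hadd _ _ ha hb

end UGe

namespace ULe

variable (Q : Datum ι)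

/-- The generator `F_i`. -/
noncomputable def F (i : ι) : ULe Q := RingQuot.mkAlgHom ℂ (RelLe Q) (FreeAlgebra.ι ℂ (Gen.X i))
/-- The generator `K_i`. -/
noncomputable def K (i : ι) : ULe Q := RingQuot.mkAlgHom ℂ (RelLe Q) (FreeAlgebra.ι ℂ (Gen.K i))
/-- The generator `K_i⁻¹`. -/
noncomputable def Kinv (i : ι) : ULe Q :=
  RingQuot.mkAlgHom ℂ (RelLe Q) (FreeAlgebra.ι ℂ (Gen.Kinv i))

theorem K_Kinv (i : ι) : K Q i * Kinv Q i = 1 := by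
  have := RingQuot.mkAlgHom_rel ℂ (RelLe.K_Kinv (Q := Q) i)
  rwa [map_mul, map_one] at this

theorem Kinv_K (i : ι) : Kinv Q i * K Q i = 1 := by
  have := RingQuot.mkAlgHom_rel ℂ (RelLe.Kinv_K (Q := Q) i)
  rwa [map_mul, map_one] at this

theorem K_comm (i j : ι) : K Q i * K Q j = K Q j * K Q i := by
  have := RingQuot.mkAlgHom_rel ℂ (RelLe.K_comm (Q := Q) i j)
  rwa [map_mul, map_mul] at this

theorem K_F_Kinv (i j : ι) : K Q i * F Q j * Kinv Q i = (Q.χ j i)⁻¹ • F Q j := by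
  have := RingQuot.mkAlgHom_rel ℂ (RelLe.K_F (Q := Q) i j)
  rwa [map_mul, map_mul, map_smul, Q.χ_inv] at this

theorem serre_F {i j : ι} (h : i ≠ j) :
    serreOp (Q.N i j) (Q.q i) (Q.χ j i) (F Q i) (F Q j) = 0 := by
  have := RingQuot.mkAlgHom_rel ℂ (RelLe.serre (Q := Q) i j h)
  rwa [map_serreOp, map_zero] at this

theorem K_F (i j : ι) : K Q i * F Q j = (Q.χ j i)⁻¹ • (F Q j * K Q i) :=
  (skew_forms (Q.χ_ne_zero j i) (K_Kinv Q i) (Kinv_K Q i) (K_F_Kinv Q i j)).1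

theorem Kinv_F (i j : ι) : Kinv Q i * F Q j = Q.χ j i • (F Q j * Kinv Q i) :=
  (skew_forms (Q.χ_ne_zero j i) (K_Kinv Q i) (Kinv_K Q i) (K_F_Kinv Q i j)).2

theorem Kinv_K_comm (i j : ι) : Kinv Q i * K Q j = K Q j * Kinv Q i :=
  comm_inv (K_Kinv Q i) (Kinv_K Q i) (K_comm Q i j)

theorem Kinv_comm (i j : ι) : Kinv Q i * Kinv Q j = Kinv Q j * Kinv Q i :=
  comm_inv (K_Kinv Q i) (Kinv_K Q i) (Kinv_K_comm Q j i).symm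

section lift

variable {R : Type*} [Ring R] [Algebra ℂ R]

/-- The families `f`, `k`, `k'` satisfy the defining relations of `U_{r,s}^{≤}`. -/
structure IsRep (f k k' : ι → R) : Prop where
  h1 : ∀ i, k i * k' i = 1
  h2 : ∀ i, k' i * k i = 1
  h3 : ∀ i j, k i * k j = k j * k i
  h4 : ∀ i j, k i * f j = (Q.χ j i)⁻¹ • (f j * k i)
  h5 : ∀ i j, i ≠ j → serreOp (Q.N i j) (Q.q i) (Q.χ j i) (f i) (f j) = 0

/-- The universal property of `U_{r,s}^{≤}`. -/
noncomputable def lift (f k k' : ι → R) (h : IsRep Q f k k') : ULe Q →ₐ[ℂ] R :=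
  RingQuot.liftAlgHom ℂ ⟨FreeAlgebra.lift ℂ fun g => match g with
    | .X i => f i
    | .K i => k i
    | .Kinv i => k' i, by
    intro x y hxy
    induction hxy with
    | K_Kinv i => simp [h.h1]
    | Kinv_K i => simp [h.h2]
    | K_comm i j => simp [h.h3 i j]
    | K_F i j =>
      rw [Q.χ_inv]
      simp only [map_mul, map_smul, FreeAlgebra.lift_ι_apply]
      rw [h.h4, smul_mul_assoc, mul_assoc, h.h1, mul_one]
    | serre i j hij => simp [map_serreOp, h.h5 i j hij]⟩

variable {Q} {f k k' : ι → R} (h : IsRep Q f k k')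

theorem lift_F (i : ι) : lift Q f k k' h (F Q i) = f i := by
  unfold lift F; erw [RingQuot.liftAlgHom_mkAlgHom_apply]; simp
theorem lift_K (i : ι) : lift Q f k k' h (K Q i) = k i := by
  unfold lift K; erw [RingQuot.liftAlgHom_mkAlgHom_apply]; simp
theorem lift_Kinv (i : ι) : lift Q f k k' h (Kinv Q i) = k' i := by
  unfold lift Kinv; erw [RingQuot.liftAlgHom_mkAlgHom_apply]; simp

end lift

variable {Q}

theorem hom_ext {R : Type*} [Semiring R] [Algebra ℂ R] {f g : ULe Q →ₐ[ℂ] R}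
    (hF : ∀ i, f (F Q i) = g (F Q i)) (hK : ∀ i, f (K Q i) = g (K Q i))
    (hK' : ∀ i, f (Kinv Q i) = g (Kinv Q i)) : f = g := by
  apply RingQuot.ringQuot_ext'
  apply FreeAlgebra.hom_ext
  funext x
  cases x with
  | X i => exact hF i
  | K i => exact hK i
  | Kinv i => exact hK' i

theorem induct {P : ULe Q → Prop} (hF : ∀ i, P (F Q i)) (hK : ∀ i, P (K Q i))
    (hK' : ∀ i, P (Kinv Q i)) (hc : ∀ c : ℂ, P (algebraMap ℂ _ c))
    (hadd : ∀ x y, P x → P y → P (x + y)) (hmul : ∀ x y, P x → P y → P (x * y)) (x : ULe Q) :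
    P x := by
  obtain ⟨y, rfl⟩ := RingQuot.mkAlgHom_surjective ℂ (RelLe Q) x
  induction y using FreeAlgebra.induction with
  | grade0 c => simpa only [AlgHom.commutes] using! hc c
  | grade1 g =>
    cases g with
    | X i => exact hF i
    | K i => exact hK i
    | Kinv i => exact hK' i
  | mul a b ha hb => rw [map_mul]; exact hmul _ _ ha hb
  | add a b ha hb => rw [map_add]; exact hadd _ _ ha hb

end ULe
end TwoParam

namespace TwoParam

section HopfGeneral

open Coalgebra HopfAlgebra

variable {A : Type*} [Ring A] [Bialgebra ℂ A]

/-- `∑ S(a₁) a₂ = ε(a)` is multiplicative in `a`, for `S` an anti-homomorphism. -/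
theorem antipode_left_mul (S : A →ₐ[ℂ] Aᵐᵒᵖ) {x y : A}
    (hx : ∀ z : A, LinearMap.mul' ℂ A (TensorProduct.map
      ((MulOpposite.opLinearEquiv ℂ).symm.toLinearMap ∘ₗ S.toLinearMap) (LinearMap.mulRight ℂ z)
        (comul x)) = counit (R := ℂ) x • z)
    (hy : ∀ z : A, LinearMap.mul' ℂ A (TensorProduct.map
      ((MulOpposite.opLinearEquiv ℂ).symm.toLinearMap ∘ₗ S.toLinearMap) (LinearMap.mulRight ℂ z)
        (comul y)) = counit (R := ℂ) y • z) (z : A) :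
    LinearMap.mul' ℂ A (TensorProduct.map
      ((MulOpposite.opLinearEquiv ℂ).symm.toLinearMap ∘ₗ S.toLinearMap) (LinearMap.mulRight ℂ z)
        (comul (x * y))) = counit (R := ℂ) (x * y) • z := by
  obtain ⟨Rx, Ry⟩ : Repr ℂ x (A × A) × Repr ℂ y (A × A) := ⟨ℛ ℂ x, ℛ ℂ y⟩
  have hx' := fun z => hx z
  simp only [← Rx.eq, map_sum, TensorProduct.map_tmul, LinearMap.mul'_apply,
    LinearMap.mulRight_apply, LinearMap.comp_apply, AlgHom.toLinearMap_apply,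
    LinearEquiv.coe_coe, MulOpposite.coe_opLinearEquiv_symm] at hx'
  have hy' := fun z => hy z
  simp only [← Ry.eq, map_sum, TensorProduct.map_tmul, LinearMap.mul'_apply,
    LinearMap.mulRight_apply, LinearMap.comp_apply, AlgHom.toLinearMap_apply,
    LinearEquiv.coe_coe, MulOpposite.coe_opLinearEquiv_symm] at hy'
  rw [Bialgebra.comul_mul, ← Rx.eq, ← Ry.eq, Finset.sum_mul_sum]
  simp only [map_sum, TensorProduct.map_tmul, LinearMap.mul'_apply, Algebra.TensorProduct.tmul_mul_tmul,
    LinearMap.mulRight_apply, LinearMap.comp_apply, AlgHom.toLinearMap_apply,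
    LinearEquiv.coe_coe, MulOpposite.coe_opLinearEquiv_symm, map_mul, MulOpposite.unop_mul]
  rw [Finset.sum_comm]
  have : ∀ j ∈ Ry.index, ∑ i ∈ Rx.index, MulOpposite.unop (S (Ry.left j)) *
      MulOpposite.unop (S (Rx.left i)) * (Rx.right i * Ry.right j * z) =
      counit (R := ℂ) x • (MulOpposite.unop (S (Ry.left j)) * (Ry.right j * z)) := by
    intro j _
    rw [← mul_smul_comm, ← hx', Finset.mul_sum]
    simp only [mul_assoc]
  rw [Finset.sum_congr rfl this, ← Finset.smul_sum, hy', smul_smul, Bialgebra.counit_mul]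

theorem antipode_right_mul (S : A →ₐ[ℂ] Aᵐᵒᵖ) {x y : A}
    (hx : ∀ z : A, LinearMap.mul' ℂ A (TensorProduct.map (LinearMap.mulLeft ℂ z)
      ((MulOpposite.opLinearEquiv ℂ).symm.toLinearMap ∘ₗ S.toLinearMap)
        (comul x)) = counit (R := ℂ) x • z)
    (hy : ∀ z : A, LinearMap.mul' ℂ A (TensorProduct.map (LinearMap.mulLeft ℂ z)
      ((MulOpposite.opLinearEquiv ℂ).symm.toLinearMap ∘ₗ S.toLinearMap)
        (comul y)) = counit (R := ℂ) y • z) (z : A) :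
    LinearMap.mul' ℂ A (TensorProduct.map (LinearMap.mulLeft ℂ z)
      ((MulOpposite.opLinearEquiv ℂ).symm.toLinearMap ∘ₗ S.toLinearMap)
        (comul (x * y))) = counit (R := ℂ) (x * y) • z := by
  obtain ⟨Rx, Ry⟩ : Repr ℂ x (A × A) × Repr ℂ y (A × A) := ⟨ℛ ℂ x, ℛ ℂ y⟩
  have hx' := fun z => hx z
  simp only [← Rx.eq, map_sum, TensorProduct.map_tmul, LinearMap.mul'_apply,
    LinearMap.mulLeft_apply, LinearMap.comp_apply, AlgHom.toLinearMap_apply,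
    LinearEquiv.coe_coe, MulOpposite.coe_opLinearEquiv_symm] at hx'
  have hy' := fun z => hy z
  simp only [← Ry.eq, map_sum, TensorProduct.map_tmul, LinearMap.mul'_apply,
    LinearMap.mulLeft_apply, LinearMap.comp_apply, AlgHom.toLinearMap_apply,
    LinearEquiv.coe_coe, MulOpposite.coe_opLinearEquiv_symm] at hy'
  rw [Bialgebra.comul_mul, ← Rx.eq, ← Ry.eq, Finset.sum_mul_sum]
  simp only [map_sum, TensorProduct.map_tmul, LinearMap.mul'_apply, Algebra.TensorProduct.tmul_mul_tmul,
    LinearMap.mulLeft_apply, LinearMap.comp_apply, AlgHom.toLinearMap_apply,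
    LinearEquiv.coe_coe, MulOpposite.coe_opLinearEquiv_symm, map_mul, MulOpposite.unop_mul]
  have : ∀ i ∈ Rx.index, ∑ j ∈ Ry.index, z * (Rx.left i * Ry.left j) *
      (MulOpposite.unop (S (Ry.right j)) * MulOpposite.unop (S (Rx.right i))) =
      counit (R := ℂ) y • (z * Rx.left i * MulOpposite.unop (S (Rx.right i))) := by
    intro j _
    rw [← smul_mul_assoc, ← hy', Finset.sum_mul]
    simp only [mul_assoc]
  rw [Finset.sum_congr rfl this, ← Finset.smul_sum, hx', smul_smul, Bialgebra.counit_mul, mul_comm]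

end HopfGeneral

namespace UGe

variable {ι : Type*} [Fintype ι] [LinearOrder ι] (Q : Datum ι)

theorem comul_isRep : IsRep (R := UGe Q ⊗[ℂ] UGe Q) Q (fun i => E Q i ⊗ₜ K Q i + 1 ⊗ₜ E Q i) (fun i => K Q i ⊗ₜ K Q i)
    (fun i => Kinv Q i ⊗ₜ Kinv Q i) where
  h1 :=
    (fun i => by simp [K_Kinv, Algebra.TensorProduct.one_def])
  h2 :=
    (fun i => by simp [Kinv_K, Algebra.TensorProduct.one_def])
  h3 :=
    (fun i j => by simp [K_comm Q i j])
  h4 :=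
    (fun i j => by
      simp only [mul_add, add_mul, Algebra.TensorProduct.tmul_mul_tmul, K_E, K_comm Q i j, mul_one,
        one_mul, smul_add, TensorProduct.tmul_smul, TensorProduct.smul_tmul'])
  h5 :=
    (fun i j h => by
      rw [serre_add (Q.q_not_root i) (Q.N i j) (p := (Q.χ i i)⁻¹) (p₁ := (Q.χ i j)⁻¹)
        (p₂ := (Q.χ j i)⁻¹), serre_tmul _ _ _ _ (K_comm Q i j), serre_E Q h,
        TensorProduct.zero_tmul, zero_add]
      · have := map_serre (Algebra.TensorProduct.includeRight : UGe Q →ₐ[ℂ] UGe Q ⊗[ℂ] UGe Q)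
          (q := Q.q i) (Q.N i j) (Q.χ j i) (E Q i) (E Q j)
        rw [serre_E Q h, map_zero] at this
        exact this.symm
      · simp [K_E]
      · simp [K_E]
      · simp [K_E]
      · rw [Q.χ_self]; exact mul_inv_cancel₀ (Q.q_ne_zero i)
      · exact mul_inv_cancel₀ (Q.χ_ne_zero j i)
      · intro _
        rw [eq_mul_inv_iff_mul_eq₀ (Q.χ_ne_zero i j)]
        linear_combination Q.χ_mul h
      · exact Q.N_pos h)

/-- `Δ(E_i) = E_i ⊗ K'_i + 1 ⊗ E_i`, `Δ(K'_i) = K'_i ⊗ K'_i`. -/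
noncomputable def comulHom : UGe Q →ₐ[ℂ] UGe Q ⊗[ℂ] UGe Q :=
  lift Q _ _ _ (comul_isRep Q)

theorem comulHom_E (i : ι) : comulHom Q (E Q i) = E Q i ⊗ₜ K Q i + 1 ⊗ₜ E Q i := by
  exact lift_E (comul_isRep Q) i
theorem comulHom_K (i : ι) : comulHom Q (K Q i) = K Q i ⊗ₜ K Q i := by
  exact lift_K (comul_isRep Q) i
theorem comulHom_Kinv (i : ι) : comulHom Q (Kinv Q i) = Kinv Q i ⊗ₜ Kinv Q i := by
  exact lift_Kinv (comul_isRep Q) i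

theorem counit_isRep : IsRep (R := ℂ) Q (fun _ => 0) (fun _ => 1)
    (fun _ => 1) where
  h1 :=
    (by simp)
  h2 :=
    (by simp)
  h3 :=
    (by simp)
  h4 :=
    (by simp)
  h5 :=
    (fun i j h => by simp [serre])

/-- `ε(E_i) = 0`, `ε(K'_i) = 1`. -/
noncomputable def counitHom : UGe Q →ₐ[ℂ] ℂ :=
  lift Q _ _ _ (counit_isRep Q)

theorem counitHom_E (i : ι) : counitHom Q (E Q i) = 0 := by
  exact lift_E (counit_isRep Q) i
theorem counitHom_K (i : ι) : counitHom Q (K Q i) = 1 := by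
  exact lift_K (counit_isRep Q) i
theorem counitHom_Kinv (i : ι) : counitHom Q (Kinv Q i) = 1 := by
  exact lift_Kinv (counit_isRep Q) i

noncomputable instance : Bialgebra ℂ (UGe Q) :=
  Bialgebra.ofAlgHom (comulHom Q) (counitHom Q)
    (by
      apply hom_ext <;> intro i <;>
        simp [comulHom_E, comulHom_K, comulHom_Kinv, Algebra.TensorProduct.one_def,
          TensorProduct.add_tmul, TensorProduct.tmul_add, add_assoc])
    (by
      apply hom_ext <;> intro i <;>
        simp [comulHom_E, comulHom_K, comulHom_Kinv, counitHom_E, counitHom_K, counitHom_Kinv])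
    (by
      apply hom_ext <;> intro i <;>
        simp [comulHom_E, comulHom_K, comulHom_Kinv, counitHom_E, counitHom_K, counitHom_Kinv])

@[simp] theorem comul_E (i : ι) :
    Coalgebra.comul (R := ℂ) (E Q i) = E Q i ⊗ₜ K Q i + 1 ⊗ₜ E Q i := comulHom_E Q i
@[simp] theorem comul_K (i : ι) : Coalgebra.comul (R := ℂ) (K Q i) = K Q i ⊗ₜ K Q i := comulHom_K Q i
@[simp] theorem comul_Kinv (i : ι) :
    Coalgebra.comul (R := ℂ) (Kinv Q i) = Kinv Q i ⊗ₜ Kinv Q i := comulHom_Kinv Q i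
@[simp] theorem counit_E (i : ι) : Coalgebra.counit (R := ℂ) (E Q i) = 0 := counitHom_E Q i
@[simp] theorem counit_K (i : ι) : Coalgebra.counit (R := ℂ) (K Q i) = 1 := counitHom_K Q i
@[simp] theorem counit_Kinv (i : ι) : Coalgebra.counit (R := ℂ) (Kinv Q i) = 1 := counitHom_Kinv Q i

theorem antipode_isRep : IsRep (R := (UGe Q)ᵐᵒᵖ) Q (fun i => .op (-(E Q i * Kinv Q i))) (fun i => .op (Kinv Q i))
    (fun i => .op (K Q i)) where
  h1 :=
    (fun i => by simp [← MulOpposite.op_mul, K_Kinv])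
  h2 :=
    (fun i => by simp [← MulOpposite.op_mul, Kinv_K])
  h3 :=
    (fun i j => by simp [← MulOpposite.op_mul, Kinv_comm Q i j])
  h4 :=
    (fun i j => by
      rw [← MulOpposite.op_mul, ← MulOpposite.op_mul, ← MulOpposite.op_smul]
      congr 1
      rw [mul_neg, neg_mul, ← mul_assoc, Kinv_E, smul_neg, smul_mul_assoc, smul_smul,
        inv_mul_cancel₀ (Q.χ_ne_zero i j), one_smul, mul_assoc, mul_assoc, Kinv_comm])
  h5 :=
    (fun i j h => by
      apply MulOpposite.unop_injective
      have := serreOp_eq_unop (q := Q.q i) (Q.N i j) (Q.χ j i) (-(E Q i * Kinv Q i))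
        (-(E Q j * Kinv Q j))
      rw [← this, MulOpposite.unop_op, MulOpposite.unop_zero,
        ← neg_one_smul ℂ (E Q i * Kinv Q i), ← neg_one_smul ℂ (E Q j * Kinv Q j), serreOp_smul]
      obtain ⟨C, hC⟩ := serreOp_twist (q := Q.q i) (x := Q.χ j i) (Q.N i j) (Kinv_E Q i i)
        (Kinv_E Q i j) (Kinv_E Q j i) (Kinv_comm Q i j)
        (by linear_combination (-Q.χ j i) * Q.χ_mul h) (Q.q_ne_zero i)
      rw [hC, serre_E Q h, zero_mul, smul_zero, smul_zero])

/-- The antipode as an anti-homomorphism: `S(E_i) = -E_i K'_i⁻¹`, `S(K'_i) = K'_i⁻¹`. -/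
noncomputable def antipodeHom : UGe Q →ₐ[ℂ] (UGe Q)ᵐᵒᵖ :=
  lift Q _ _ _ (antipode_isRep Q)

theorem antipodeHom_E (i : ι) : antipodeHom Q (E Q i) = .op (-(E Q i * Kinv Q i)) :=
  lift_E (antipode_isRep Q) i
theorem antipodeHom_K (i : ι) : antipodeHom Q (K Q i) = .op (Kinv Q i) :=
  lift_K (antipode_isRep Q) i
theorem antipodeHom_Kinv (i : ι) : antipodeHom Q (Kinv Q i) = .op (K Q i) :=
  lift_Kinv (antipode_isRep Q) i

noncomputable instance : HopfAlgebra ℂ (UGe Q) where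
  antipode := (MulOpposite.opLinearEquiv ℂ).symm.toLinearMap ∘ₗ (antipodeHom Q).toLinearMap
  mul_antipode_rTensor_comul := by
    ext x
    have key : ∀ z, _ := fun z => induct (P := fun x => ∀ z, LinearMap.mul' ℂ _ (TensorProduct.map
      ((MulOpposite.opLinearEquiv ℂ).symm.toLinearMap ∘ₗ (antipodeHom Q).toLinearMap)
        (LinearMap.mulRight ℂ z) (Coalgebra.comul x)) = Coalgebra.counit (R := ℂ) x • z)
      (fun i z => by simp [antipodeHom_E, antipodeHom_K, antipodeHom_Kinv, mul_assoc]; simp [← mul_assoc, Kinv_K])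
      (fun i z => by simp [antipodeHom_E, antipodeHom_K, antipodeHom_Kinv, ← mul_assoc, Kinv_K])
      (fun i z => by simp [antipodeHom_E, antipodeHom_K, antipodeHom_Kinv, ← mul_assoc, K_Kinv])
      (fun c z => by
        simp [Algebra.TensorProduct.algebraMap_apply, Algebra.smul_def])
      (fun x y hx hy z => by simp only [map_add, hx, hy, add_smul])
      (fun x y hx hy => antipode_left_mul _ hx hy) x z
    simpa [LinearMap.rTensor, Algebra.algebraMap_eq_smul_one] using key 1
  mul_antipode_lTensor_comul := by
    ext x
    have key : ∀ z, _ := fun z => induct (P := fun x => ∀ z, LinearMap.mul' ℂ _ (TensorProduct.map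
        (LinearMap.mulLeft ℂ z)
      ((MulOpposite.opLinearEquiv ℂ).symm.toLinearMap ∘ₗ (antipodeHom Q).toLinearMap)
         (Coalgebra.comul x)) = Coalgebra.counit (R := ℂ) x • z)
      (fun i z => by simp [antipodeHom_E, antipodeHom_K, antipodeHom_Kinv, mul_assoc])
      (fun i z => by simp [antipodeHom_E, antipodeHom_K, antipodeHom_Kinv, mul_assoc, K_Kinv])
      (fun i z => by simp [antipodeHom_E, antipodeHom_K, antipodeHom_Kinv, mul_assoc, Kinv_K])
      (fun c z => by
        simp [Algebra.TensorProduct.algebraMap_apply, Algebra.smul_def, Algebra.commutes])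
      (fun x y hx hy z => by simp only [map_add, hx, hy, add_smul])
      (fun x y hx hy => antipode_right_mul _ hx hy) x z
    simpa [LinearMap.lTensor, Algebra.algebraMap_eq_smul_one] using key 1

theorem antipode_E (i : ι) :
    HopfAlgebra.antipode ℂ (E Q i) = -(E Q i * Kinv Q i) := by
  exact congrArg MulOpposite.unop (lift_E (antipode_isRep Q) i)
theorem antipode_K (i : ι) : HopfAlgebra.antipode ℂ (K Q i) = Kinv Q i := by
  exact congrArg MulOpposite.unop (lift_K (antipode_isRep Q) i)
theorem antipode_Kinv (i : ι) : HopfAlgebra.antipode ℂ (Kinv Q i) = K Q i := by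
  exact congrArg MulOpposite.unop (lift_Kinv (antipode_isRep Q) i)

end UGe

namespace ULe

variable {ι : Type*} [Fintype ι] [LinearOrder ι] (Q : Datum ι)

theorem comul_isRep : IsRep (R := ULe Q ⊗[ℂ] ULe Q) Q (fun i => F Q i ⊗ₜ 1 + K Q i ⊗ₜ F Q i) (fun i => K Q i ⊗ₜ K Q i)
    (fun i => Kinv Q i ⊗ₜ Kinv Q i) where
  h1 :=
    (fun i => by simp [K_Kinv, Algebra.TensorProduct.one_def])
  h2 :=
    (fun i => by simp [Kinv_K, Algebra.TensorProduct.one_def])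
  h3 :=
    (fun i j => by simp [K_comm Q i j])
  h4 :=
    (fun i j => by
      simp only [mul_add, add_mul, Algebra.TensorProduct.tmul_mul_tmul, K_F, K_comm Q i j, mul_one,
        one_mul, smul_add, TensorProduct.tmul_smul, TensorProduct.smul_tmul'])
  h5 :=
    (fun i j h => by
      rw [serreOp_add (Q.q_not_root i) (Q.N i j) (p := (Q.χ i i)⁻¹) (p₁ := (Q.χ i j)⁻¹)
        (p₂ := (Q.χ j i)⁻¹), serreOp_tmul _ _ _ _ (K_comm Q i j), serre_F Q h,
        TensorProduct.tmul_zero, add_zero]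
      · have := map_serreOp (Algebra.TensorProduct.includeLeft : ULe Q →ₐ[ℂ] ULe Q ⊗[ℂ] ULe Q)
          (q := Q.q i) (Q.N i j) (Q.χ j i) (F Q i) (F Q j)
        rw [serre_F Q h, map_zero] at this
        exact this.symm
      · simp [K_F, TensorProduct.smul_tmul']
      · simp [K_F, TensorProduct.smul_tmul']
      · simp [K_F, TensorProduct.smul_tmul']
      · rw [Q.χ_self]; exact mul_inv_cancel₀ (Q.q_ne_zero i)
      · exact mul_inv_cancel₀ (Q.χ_ne_zero j i)
      · intro _
        rw [eq_mul_inv_iff_mul_eq₀ (Q.χ_ne_zero i j)]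
        linear_combination Q.χ_mul h
      · exact Q.N_pos h)

/-- `Δ(F_i) = F_i ⊗ 1 + K_i ⊗ F_i`, `Δ(K_i) = K_i ⊗ K_i`. -/
noncomputable def comulHom : ULe Q →ₐ[ℂ] ULe Q ⊗[ℂ] ULe Q :=
  lift Q _ _ _ (comul_isRep Q)

theorem comulHom_F (i : ι) : comulHom Q (F Q i) = F Q i ⊗ₜ 1 + K Q i ⊗ₜ F Q i := by
  exact lift_F (comul_isRep Q) i
theorem comulHom_K (i : ι) : comulHom Q (K Q i) = K Q i ⊗ₜ K Q i := by
  exact lift_K (comul_isRep Q) i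
theorem comulHom_Kinv (i : ι) : comulHom Q (Kinv Q i) = Kinv Q i ⊗ₜ Kinv Q i := by
  exact lift_Kinv (comul_isRep Q) i

theorem counit_isRep : IsRep (R := ℂ) Q (fun _ => 0) (fun _ => 1)
    (fun _ => 1) where
  h1 :=
    (by simp)
  h2 :=
    (by simp)
  h3 :=
    (by simp)
  h4 :=
    (by simp)
  h5 :=
    (fun i j h => by simp [serreOp])

/-- `ε(F_i) = 0`, `ε(K_i) = 1`. -/
noncomputable def counitHom : ULe Q →ₐ[ℂ] ℂ :=
  lift Q _ _ _ (counit_isRep Q)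

theorem counitHom_F (i : ι) : counitHom Q (F Q i) = 0 := by
  exact lift_F (counit_isRep Q) i
theorem counitHom_K (i : ι) : counitHom Q (K Q i) = 1 := by
  exact lift_K (counit_isRep Q) i
theorem counitHom_Kinv (i : ι) : counitHom Q (Kinv Q i) = 1 := by
  exact lift_Kinv (counit_isRep Q) i

noncomputable instance : Bialgebra ℂ (ULe Q) :=
  Bialgebra.ofAlgHom (comulHom Q) (counitHom Q)
    (by
      apply hom_ext <;> intro i <;>
        simp [comulHom_F, comulHom_K, comulHom_Kinv, Algebra.TensorProduct.one_def,
          TensorProduct.add_tmul, TensorProduct.tmul_add, add_assoc])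
    (by
      apply hom_ext <;> intro i <;>
        simp [comulHom_F, comulHom_K, comulHom_Kinv, counitHom_F, counitHom_K, counitHom_Kinv])
    (by
      apply hom_ext <;> intro i <;>
        simp [comulHom_F, comulHom_K, comulHom_Kinv, counitHom_F, counitHom_K, counitHom_Kinv])

@[simp] theorem comul_F (i : ι) :
    Coalgebra.comul (R := ℂ) (F Q i) = F Q i ⊗ₜ 1 + K Q i ⊗ₜ F Q i := comulHom_F Q i
@[simp] theorem comul_K (i : ι) : Coalgebra.comul (R := ℂ) (K Q i) = K Q i ⊗ₜ K Q i := comulHom_K Q i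
@[simp] theorem comul_Kinv (i : ι) :
    Coalgebra.comul (R := ℂ) (Kinv Q i) = Kinv Q i ⊗ₜ Kinv Q i := comulHom_Kinv Q i
@[simp] theorem counit_F (i : ι) : Coalgebra.counit (R := ℂ) (F Q i) = 0 := counitHom_F Q i
@[simp] theorem counit_K (i : ι) : Coalgebra.counit (R := ℂ) (K Q i) = 1 := counitHom_K Q i
@[simp] theorem counit_Kinv (i : ι) : Coalgebra.counit (R := ℂ) (Kinv Q i) = 1 := counitHom_Kinv Q i

theorem antipode_isRep : IsRep (R := (ULe Q)ᵐᵒᵖ) Q (fun i => .op (-(Kinv Q i * F Q i))) (fun i => .op (Kinv Q i))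
    (fun i => .op (K Q i)) where
  h1 :=
    (fun i => by simp [← MulOpposite.op_mul, K_Kinv])
  h2 :=
    (fun i => by simp [← MulOpposite.op_mul, Kinv_K])
  h3 :=
    (fun i j => by simp [← MulOpposite.op_mul, Kinv_comm Q i j])
  h4 :=
    (fun i j => by
      rw [← MulOpposite.op_mul, ← MulOpposite.op_mul, ← MulOpposite.op_smul]
      congr 1
      rw [mul_neg, neg_mul, ← mul_assoc, Kinv_comm Q i j, mul_assoc _ (Kinv Q i) (F Q j),
        Kinv_F Q i j, smul_neg, mul_smul_comm, smul_smul,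
        inv_mul_cancel₀ (Q.χ_ne_zero j i), one_smul, mul_assoc])
  h5 :=
    (fun i j h => by
      apply MulOpposite.unop_injective
      have := serre_op_eq_serreOp (q := Q.q i) (Q.N i j) (Q.χ j i) (-(Kinv Q i * F Q i))
        (-(Kinv Q j * F Q j))
      rw [← this, MulOpposite.unop_op, MulOpposite.unop_zero, Kinv_F, Kinv_F, ← neg_smul,
        ← neg_smul, serre_smul]
      obtain ⟨C, hC⟩ := serre_twist (q := Q.q i) (x := Q.χ j i) (Q.N i j) (Kinv_F Q i i)
        (Kinv_F Q i j) (Kinv_F Q j i) (Kinv_comm Q i j)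
        (by linear_combination (-Q.χ j i) * Q.χ_mul h) (Q.q_ne_zero i)
      rw [hC, serre_F Q h, zero_mul, smul_zero, smul_zero])

/-- The antipode as an anti-homomorphism: `S(F_i) = -K_i⁻¹ F_i`, `S(K_i) = K_i⁻¹`. -/
noncomputable def antipodeHom : ULe Q →ₐ[ℂ] (ULe Q)ᵐᵒᵖ :=
  lift Q _ _ _ (antipode_isRep Q)

theorem antipodeHom_F (i : ι) : antipodeHom Q (F Q i) = .op (-(Kinv Q i * F Q i)) :=
  lift_F (antipode_isRep Q) i
theorem antipodeHom_K (i : ι) : antipodeHom Q (K Q i) = .op (Kinv Q i) :=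
  lift_K (antipode_isRep Q) i
theorem antipodeHom_Kinv (i : ι) : antipodeHom Q (Kinv Q i) = .op (K Q i) :=
  lift_Kinv (antipode_isRep Q) i

noncomputable instance : HopfAlgebra ℂ (ULe Q) where
  antipode := (MulOpposite.opLinearEquiv ℂ).symm.toLinearMap ∘ₗ (antipodeHom Q).toLinearMap
  mul_antipode_rTensor_comul := by
    ext x
    have key : ∀ z, _ := fun z => induct (P := fun x => ∀ z, LinearMap.mul' ℂ _ (TensorProduct.map
      ((MulOpposite.opLinearEquiv ℂ).symm.toLinearMap ∘ₗ (antipodeHom Q).toLinearMap)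
        (LinearMap.mulRight ℂ z) (Coalgebra.comul x)) = Coalgebra.counit (R := ℂ) x • z)
      (fun i z => by simp [antipodeHom_F, antipodeHom_K, antipodeHom_Kinv, mul_assoc])
      (fun i z => by simp [antipodeHom_F, antipodeHom_K, antipodeHom_Kinv, ← mul_assoc, Kinv_K])
      (fun i z => by simp [antipodeHom_F, antipodeHom_K, antipodeHom_Kinv, ← mul_assoc, K_Kinv])
      (fun c z => by
        simp [Algebra.TensorProduct.algebraMap_apply, Algebra.smul_def])
      (fun x y hx hy z => by simp only [map_add, hx, hy, add_smul])
      (fun x y hx hy => antipode_left_mul _ hx hy) x z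
    simpa [LinearMap.rTensor, Algebra.algebraMap_eq_smul_one] using key 1
  mul_antipode_lTensor_comul := by
    ext x
    have key : ∀ z, _ := fun z => induct (P := fun x => ∀ z, LinearMap.mul' ℂ _ (TensorProduct.map
        (LinearMap.mulLeft ℂ z)
      ((MulOpposite.opLinearEquiv ℂ).symm.toLinearMap ∘ₗ (antipodeHom Q).toLinearMap)
         (Coalgebra.comul x)) = Coalgebra.counit (R := ℂ) x • z)
      (fun i z => by simp [antipodeHom_F, antipodeHom_K, antipodeHom_Kinv, mul_assoc]; simp [← mul_assoc, K_Kinv])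
      (fun i z => by simp [antipodeHom_F, antipodeHom_K, antipodeHom_Kinv, mul_assoc, K_Kinv])
      (fun i z => by simp [antipodeHom_F, antipodeHom_K, antipodeHom_Kinv, mul_assoc, Kinv_K])
      (fun c z => by
        simp [Algebra.TensorProduct.algebraMap_apply, Algebra.smul_def, Algebra.commutes])
      (fun x y hx hy z => by simp only [map_add, hx, hy, add_smul])
      (fun x y hx hy => antipode_right_mul _ hx hy) x z
    simpa [LinearMap.lTensor, Algebra.algebraMap_eq_smul_one] using key 1

theorem antipode_F (i : ι) :
    HopfAlgebra.antipode ℂ (F Q i) = -(Kinv Q i * F Q i) := by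
  exact congrArg MulOpposite.unop (lift_F (antipode_isRep Q) i)
theorem antipode_K (i : ι) : HopfAlgebra.antipode ℂ (K Q i) = Kinv Q i := by
  exact congrArg MulOpposite.unop (lift_K (antipode_isRep Q) i)
theorem antipode_Kinv (i : ι) : HopfAlgebra.antipode ℂ (Kinv Q i) = K Q i := by
  exact congrArg MulOpposite.unop (lift_Kinv (antipode_isRep Q) i)

end ULe
end TwoParam

namespace TwoParam

/-! ### Skew Hopf pairings -/

/-- A skew Hopf pairing between two Hopf algebras with invertible antipodes. -/
structure SkewHopfPairing (A B : Type*) [Ring A] [HopfAlgebra ℂ A] [Ring B] [HopfAlgebra ℂ B] where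
  /-- The bilinear form. -/
  form : A →ₗ[ℂ] B →ₗ[ℂ] ℂ
  bijective_left : Function.Bijective (HopfAlgebra.antipode ℂ : A →ₗ[ℂ] A)
  bijective_right : Function.Bijective (HopfAlgebra.antipode ℂ : B →ₗ[ℂ] B)
  /-- `φ(a, b b') = ∑ φ(a₁, b) φ(a₂, b')` -/
  form_mul_right : ∀ a b b', form a (b * b') =
    LinearMap.mul' ℂ ℂ (TensorProduct.map (form.flip b) (form.flip b') (Coalgebra.comul a))
  /-- `φ(a a', b) = ∑ φ(a', b₁) φ(a, b₂)` -/
  form_mul_left : ∀ a a' b, form (a * a') b =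
    LinearMap.mul' ℂ ℂ (TensorProduct.map (form a') (form a) (Coalgebra.comul b))
  form_one_right : ∀ a, form a 1 = Coalgebra.counit a
  form_one_left : ∀ b, form 1 b = Coalgebra.counit b

section Dual

open WithConv

variable {A : Type*} [Ring A] [Bialgebra ℂ A]

variable (A) in
/-- The dual of the multiplication, a homomorphism of convolution algebras. -/
noncomputable def mulDual : WithConv (A →ₗ[ℂ] ℂ) →ₐ[ℂ] WithConv (A ⊗[ℂ] A →ₗ[ℂ] ℂ) :=
  AlgHom.ofLinearMap
    { toFun := fun f => toConv (f.ofConv ∘ₗ LinearMap.mul' ℂ A)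
      map_add' := fun f g => rfl
      map_smul' := fun c f => rfl }
    (by
      apply WithConv.ext
      apply TensorProduct.ext'
      intro a b
      change (1 : WithConv (A →ₗ[ℂ] ℂ)) (a * b) = (1 : WithConv (A ⊗[ℂ] A →ₗ[ℂ] ℂ)) (a ⊗ₜ b)
      simp [mul_comm])
    (fun f g => by
      have := LinearMap.convMul_comp_coalgHom_distrib f g (Bialgebra.mulCoalgHom ℂ A)
      exact congrArg toConv this)

theorem mulDual_apply (f : WithConv (A →ₗ[ℂ] ℂ)) (a b : A) :
    mulDual A f (a ⊗ₜ b) = f (a * b) := rfl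

/-- The functional `a ⊗ a' ↦ g a * f a'`. -/
noncomputable def box (f g : WithConv (A →ₗ[ℂ] ℂ)) : WithConv (A ⊗[ℂ] A →ₗ[ℂ] ℂ) :=
  toConv (LinearMap.mul' ℂ ℂ ∘ₗ TensorProduct.map g.ofConv f.ofConv)

theorem box_apply (f g : WithConv (A →ₗ[ℂ] ℂ)) (a b : A) : box f g (a ⊗ₜ b) = g a * f b := rfl

theorem box_mul (f g h k : WithConv (A →ₗ[ℂ] ℂ)) :
    box f g * box h k = box (f * h) (g * k) := by
  have h1 := TensorProduct.map_convMul_map (f := g) (g := f) (h := k) (k := h)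
  have h2 := LinearMap.algHom_comp_convMul_distrib (Algebra.TensorProduct.lmul' ℂ (S := ℂ))
    (toConv (TensorProduct.map g.ofConv f.ofConv)) (toConv (TensorProduct.map k.ofConv h.ofConv))
  rw [h1] at h2
  exact congrArg toConv h2.symm

/-- `f ⊗ g ↦ box f g` as a homomorphism of algebras. -/
noncomputable def boxHom :
    WithConv (A →ₗ[ℂ] ℂ) ⊗[ℂ] WithConv (A →ₗ[ℂ] ℂ) →ₐ[ℂ] WithConv (A ⊗[ℂ] A →ₗ[ℂ] ℂ) :=
  Algebra.TensorProduct.algHomOfLinearMapTensorProduct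
    (TensorProduct.lift (LinearMap.mk₂ ℂ box
      (fun f f' g => by
        apply WithConv.ext; apply TensorProduct.ext'; intro a b
        exact mul_add _ _ _)
      (fun c f g => by
        apply WithConv.ext; apply TensorProduct.ext'; intro a b
        exact mul_left_comm (g a) c (f b))
      (fun f g g' => by
        apply WithConv.ext; apply TensorProduct.ext'; intro a b
        exact add_mul _ _ _)
      (fun c f g => by
        apply WithConv.ext; apply TensorProduct.ext'; intro a b
        exact mul_assoc c (g a) (f b))))
    (fun f h g k => by simp only [TensorProduct.lift.tmul, LinearMap.mk₂_apply, box_mul])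
    (by
      simp only [TensorProduct.lift.tmul, LinearMap.mk₂_apply]
      apply WithConv.ext; apply TensorProduct.ext'; intro a b
      change (1 : WithConv (A →ₗ[ℂ] ℂ)) a * (1 : WithConv (A →ₗ[ℂ] ℂ)) b = _
      simp [mul_comm])

theorem boxHom_tmul (f g : WithConv (A →ₗ[ℂ] ℂ)) : boxHom (f ⊗ₜ g) = box f g := rfl

/-- `f ↦ box f 1`. -/
noncomputable def boxInl : WithConv (A →ₗ[ℂ] ℂ) →ₐ[ℂ] WithConv (A ⊗[ℂ] A →ₗ[ℂ] ℂ) :=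
  boxHom.comp Algebra.TensorProduct.includeLeft

/-- `g ↦ box 1 g`. -/
noncomputable def boxInr : WithConv (A →ₗ[ℂ] ℂ) →ₐ[ℂ] WithConv (A ⊗[ℂ] A →ₗ[ℂ] ℂ) :=
  boxHom.comp Algebra.TensorProduct.includeRight

theorem boxInl_comm (f g : WithConv (A →ₗ[ℂ] ℂ)) : boxInl f * boxInr g = boxInr g * boxInl f :=
  (box_mul f 1 1 g).trans (by
    rw [mul_one, one_mul]
    exact ((box_mul 1 g f 1).trans (by rw [mul_one, one_mul])).symm)

theorem boxHom_skew (f g k : WithConv (A →ₗ[ℂ] ℂ)) :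
    boxHom (f ⊗ₜ 1 + k ⊗ₜ g) = boxInl f + boxInl k * boxInr g := by
  rw [map_add]
  refine congrArg (boxInl f + ·) ?_
  rw [boxHom_tmul]
  exact ((box_mul k 1 1 g).trans (by rw [mul_one, one_mul])).symm

variable (A) in
/-- Evaluation at `1`. -/
noncomputable def evOne : WithConv (A →ₗ[ℂ] ℂ) →ₐ[ℂ] ℂ :=
  AlgHom.ofLinearMap
    { toFun := fun f => f 1
      map_add' := fun f g => rfl
      map_smul' := fun c f => rfl }
    (by change (1 : WithConv (A →ₗ[ℂ] ℂ)) 1 = 1; simp)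
    (fun f g => by
      change (f * g) 1 = f 1 * g 1
      simp [Algebra.TensorProduct.one_def])

theorem evOne_apply (f : WithConv (A →ₗ[ℂ] ℂ)) : evOne A f = f 1 := rfl

/-- An algebra homomorphism to `ℂ`, as an element of the dual. -/
def char (f : A →ₐ[ℂ] ℂ) : WithConv (A →ₗ[ℂ] ℂ) := toConv f.toLinearMap

theorem char_apply (f : A →ₐ[ℂ] ℂ) (a : A) : char f a = f a := rfl

theorem char_mul (f g : A →ₐ[ℂ] ℂ) :
    char f * char g = char (toConv f * toConv g : WithConv (A →ₐ[ℂ] ℂ)).ofConv :=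
  (AlgHom.toLinearMap_convMul (toConv f) (toConv g)).symm

theorem mulDual_char (f : A →ₐ[ℂ] ℂ) : mulDual A (char f) = boxHom (char f ⊗ₜ char f) := by
  rw [boxHom_tmul]
  apply WithConv.ext; apply TensorProduct.ext'; intro a b
  exact (map_mul f a b)

end Dual

namespace UGe

open WithConv

variable {ι : Type*} [Fintype ι] [LinearOrder ι] (Q : Datum ι)

theorem chi_isRep (c : ι → ℂ) (hc : ∀ i, c i ≠ 0) :
    IsRep (R := ℂ) Q (fun _ => 0) c (fun i => (c i)⁻¹) where
  h1 i := mul_inv_cancel₀ (hc i)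
  h2 i := inv_mul_cancel₀ (hc i)
  h3 i j := mul_comm _ _
  h4 i j := by simp
  h5 i j h := by simp [serre]

/-- The character `a ↦ φ(a, K_j)`. -/
noncomputable def chiHom (j : ι) : UGe Q →ₐ[ℂ] ℂ :=
  lift Q _ _ _ (chi_isRep Q (fun i => Q.χ i j) (fun i => Q.χ_ne_zero i j))

/-- The character `a ↦ φ(a, K_j⁻¹)`. -/
noncomputable def chiInvHom (j : ι) : UGe Q →ₐ[ℂ] ℂ :=
  lift Q _ _ _ (chi_isRep Q (fun i => (Q.χ i j)⁻¹) (fun i => inv_ne_zero (Q.χ_ne_zero i j)))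

@[simp] theorem chiHom_E (j i : ι) : chiHom Q j (E Q i) = 0 := lift_E _ i
@[simp] theorem chiHom_K (j i : ι) : chiHom Q j (K Q i) = Q.χ i j := lift_K _ i
@[simp] theorem chiHom_Kinv (j i : ι) : chiHom Q j (Kinv Q i) = (Q.χ i j)⁻¹ := lift_Kinv _ i
@[simp] theorem chiInvHom_E (j i : ι) : chiInvHom Q j (E Q i) = 0 := lift_E _ i
@[simp] theorem chiInvHom_K (j i : ι) : chiInvHom Q j (K Q i) = (Q.χ i j)⁻¹ := lift_K _ i
@[simp] theorem chiInvHom_Kinv (j i : ι) : chiInvHom Q j (Kinv Q i) = Q.χ i j :=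
  (lift_Kinv _ i).trans (inv_inv _)

/-- Serre expressions in elements with zero products vanish. -/
theorem serre_of_mul_eq_zero {R : Type*} [Ring R] [Algebra ℂ R] {N : ℕ} (hN : 0 < N) (q x : ℂ)
    {X Y : R} (h0 : X * Y = 0) (h1 : Y * X = 0) : serre N q x X Y = 0 := by
  refine Finset.sum_eq_zero fun k hk => ?_
  have : X ^ (N - k) * Y * X ^ k = 0 := by
    rcases Nat.eq_zero_or_pos k with rfl | hk
    · obtain ⟨m, rfl⟩ : ∃ m, N = m + 1 := ⟨N - 1, by omega⟩
      simp [pow_succ, mul_assoc, h0]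
    · obtain ⟨m, rfl⟩ : ∃ m, k = m + 1 := ⟨k - 1, by omega⟩
      rw [pow_succ', mul_assoc, ← mul_assoc Y, h1, zero_mul, mul_zero]
  rw [this, smul_zero]

theorem serreOp_of_mul_eq_zero {R : Type*} [Ring R] [Algebra ℂ R] {N : ℕ} (hN : 0 < N) (q x : ℂ)
    {X Y : R} (h0 : X * Y = 0) (h1 : Y * X = 0) : serreOp N q x X Y = 0 := by
  refine Finset.sum_eq_zero fun k hk => ?_
  have : X ^ k * Y * X ^ (N - k) = 0 := by
    rcases Nat.eq_zero_or_pos k with rfl | hk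
    · obtain ⟨m, rfl⟩ : ∃ m, N = m + 1 := ⟨N - 1, by omega⟩
      rw [pow_zero, one_mul, Nat.sub_zero, pow_succ', ← mul_assoc, h1, zero_mul]
    · obtain ⟨m, rfl⟩ : ∃ m, k = m + 1 := ⟨k - 1, by omega⟩
      rw [pow_succ, mul_assoc (_ ^ m), h0, mul_zero, zero_mul]
  rw [this, smul_zero]

theorem upper_mul (c d : ℂ) : !![0, c; 0, 0] * !![0, d; 0, 0] = (0 : Matrix (Fin 2) (Fin 2) ℂ) := by
  ext i j; fin_cases i <;> fin_cases j <;> simp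

theorem xi_isRep (j : ι) : IsRep (R := Matrix (Fin 2) (Fin 2) ℂ) Q
    (fun i => !![0, if i = j then (Q.s ^ Q.d j - Q.r ^ Q.d j)⁻¹ else 0; 0, 0])
    (fun i => !![1, 0; 0, Q.χ i j]) (fun i => !![1, 0; 0, (Q.χ i j)⁻¹]) where
  h1 i := by
    ext a b; fin_cases a <;> fin_cases b <;> simp [Q.χ_ne_zero]
  h2 i := by
    ext a b; fin_cases a <;> fin_cases b <;> simp [Q.χ_ne_zero]
  h3 i k := by
    ext a b; fin_cases a <;> fin_cases b <;> simp [mul_comm]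
  h4 i l := by
    by_cases h : l = j
    · subst h
      ext a b; fin_cases a <;> fin_cases b <;> simp
      rw [mul_left_comm, inv_mul_cancel₀ (Q.χ_ne_zero i l), mul_one]
    · ext a b; fin_cases a <;> fin_cases b <;> simp [h]
  h5 i l h := serre_of_mul_eq_zero (Q.N_pos h) _ _ (upper_mul _ _) (upper_mul _ _)

/-- The representation `a ↦ (ε(a), φ(a, F_j); 0, φ(a, K_j))`. -/
noncomputable def xiHom (j : ι) : UGe Q →ₐ[ℂ] Matrix (Fin 2) (Fin 2) ℂ :=
  lift Q _ _ _ (xi_isRep Q j)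

theorem xiHom_E (j i : ι) : xiHom Q j (E Q i) =
    !![0, if i = j then (Q.s ^ Q.d j - Q.r ^ Q.d j)⁻¹ else 0; 0, 0] := lift_E _ i
theorem xiHom_K (j i : ι) : xiHom Q j (K Q i) = !![1, 0; 0, Q.χ i j] := lift_K _ i
theorem xiHom_Kinv (j i : ι) : xiHom Q j (Kinv Q i) = !![1, 0; 0, (Q.χ i j)⁻¹] := lift_Kinv _ i

theorem xiHom_shape (j : ι) (a : UGe Q) :
    xiHom Q j a 0 0 = Coalgebra.counit (R := ℂ) a ∧ xiHom Q j a 1 0 = 0 ∧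
      xiHom Q j a 1 1 = chiHom Q j a := by
  induction a using induct with
  | hE i => simp [xiHom_E]
  | hK i => simp [xiHom_K]
  | hK' i => simp [xiHom_Kinv]
  | hc c => simp [Matrix.algebraMap_matrix_apply]
  | hadd x y hx hy => simp [hx, hy]
  | hmul x y hx hy => simp [Matrix.mul_apply, hx, hy]

/-- The functional `a ↦ φ(a, F_j)`. -/
noncomputable def xi (j : ι) : WithConv (UGe Q →ₗ[ℂ] ℂ) :=
  toConv (LinearMap.proj 1 ∘ₗ LinearMap.proj (φ := fun _ => Fin 2 → ℂ) 0 ∘ₗ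
    (xiHom Q j).toLinearMap)

theorem xi_apply (j : ι) (a : UGe Q) : xi Q j a = xiHom Q j a 0 1 := rfl

@[simp] theorem xi_E (j i : ι) :
    xi Q j (E Q i) = if i = j then (Q.s ^ Q.d j - Q.r ^ Q.d j)⁻¹ else 0 := by
  simp [xi_apply, xiHom_E]
@[simp] theorem xi_K (j i : ι) : xi Q j (K Q i) = 0 := by simp [xi_apply, xiHom_K]
@[simp] theorem xi_Kinv (j i : ι) : xi Q j (Kinv Q i) = 0 := by simp [xi_apply, xiHom_Kinv]
@[simp] theorem xi_one (j : ι) : xi Q j 1 = 0 := by simp [xi_apply]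

theorem mulDual_xi (j : ι) : mulDual (UGe Q) (xi Q j) =
    boxHom (xi Q j ⊗ₜ 1 + char (chiHom Q j) ⊗ₜ xi Q j) := by
  rw [map_add, boxHom_tmul, boxHom_tmul]
  apply WithConv.ext; apply TensorProduct.ext'; intro a b
  change xi Q j (a * b) = (1 : WithConv (UGe Q →ₗ[ℂ] ℂ)) a * xi Q j b + xi Q j a * chiHom Q j b
  rw [xi_apply, map_mul, Matrix.mul_apply]
  simp [xi_apply, xiHom_shape]

/-- A skew-primitive functional that vanishes on the generators is zero. -/
theorem skew_zero {g u v : WithConv (UGe Q →ₗ[ℂ] ℂ)}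
    (hg : mulDual _ g = boxHom (g ⊗ₜ v + u ⊗ₜ g)) (hu : u 1 = 1) (hv : v 1 = 1)
    (hE : ∀ i, g (E Q i) = 0) (hK : ∀ i, g (K Q i) = 0) (hK' : ∀ i, g (Kinv Q i) = 0) : g = 0 := by
  have hm : ∀ a b, g (a * b) = v a * g b + g a * u b := fun a b => by
    rw [← mulDual_apply, hg, map_add, boxHom_tmul, boxHom_tmul]
    rfl
  have h1 : g 1 = 0 := by
    have := hm 1 1
    rw [mul_one, hu, hv] at this
    linear_combination -this
  apply WithConv.ext; ext a
  change g a = 0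
  induction a using induct with
  | hE i => exact hE i
  | hK i => exact hK i
  | hK' i => exact hK' i
  | hc c =>
    rw [Algebra.algebraMap_eq_smul_one]
    exact (map_smul g.ofConv c 1).trans (by change c • g 1 = 0; rw [h1, smul_zero])
  | hadd x y hx hy =>
    exact (map_add g.ofConv x y).trans (by change g x + g y = 0; rw [hx, hy, add_zero])
  | hmul x y hx hy => rw [hm, hx, hy, mul_zero, zero_mul, add_zero]

/-- Evaluation of functionals on the coalgebra spanned by `1, E_l, K'_l`. -/
noncomputable def evE (l : ι) : WithConv (UGe Q →ₗ[ℂ] ℂ) →ₐ[ℂ] Matrix (Fin 2) (Fin 2) ℂ :=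
  AlgHom.ofLinearMap
    { toFun := fun f => !![f 1, f (E Q l); 0, f (K Q l)]
      map_add' := fun f g => by
        ext a b; fin_cases a <;> fin_cases b <;> simp
      map_smul' := fun c f => by
        ext a b; fin_cases a <;> fin_cases b <;> simp }
    (by ext a b; fin_cases a <;> fin_cases b <;> simp)
    (fun f g => by
      ext a b; fin_cases a <;> fin_cases b <;> simp [Algebra.TensorProduct.one_def, add_comm])

theorem evE_apply (l : ι) (f : WithConv (UGe Q →ₗ[ℂ] ℂ)) :
    evE Q l f = !![f 1, f (E Q l); 0, f (K Q l)] := rfl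

/-- Evaluation of functionals at `K'_l⁻¹`. -/
noncomputable def evKinv (l : ι) : WithConv (UGe Q →ₗ[ℂ] ℂ) →ₐ[ℂ] ℂ :=
  AlgHom.ofLinearMap
    { toFun := fun f => f (Kinv Q l)
      map_add' := fun f g => rfl
      map_smul' := fun c f => rfl }
    (by change (1 : WithConv (UGe Q →ₗ[ℂ] ℂ)) (Kinv Q l) = 1; simp)
    (fun f g => by
      change (f * g) (Kinv Q l) = f (Kinv Q l) * g (Kinv Q l)
      simp)

theorem evKinv_apply (l : ι) (f : WithConv (UGe Q →ₗ[ℂ] ℂ)) : evKinv Q l f = f (Kinv Q l) := rfl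

theorem char_ext {f g : UGe Q →ₐ[ℂ] ℂ} (hE : ∀ i, f (E Q i) = g (E Q i))
    (hK : ∀ i, f (K Q i) = g (K Q i)) (hK' : ∀ i, f (Kinv Q i) = g (Kinv Q i)) :
    char f = char g := by rw [hom_ext hE hK hK']

end UGe
end TwoParam

namespace TwoParam

namespace UGe

open WithConv

variable {ι : Type*} [Fintype ι] [LinearOrder ι] (Q : Datum ι)

theorem skew_comm_tmul {R : Type*} [Ring R] [Algebra ℂ R] (c : ℂ) {k l x : R}
    (h : l * k = k * l) :
    (k ⊗ₜ[ℂ] k) * (x ⊗ₜ 1 + l ⊗ₜ x) - c • ((x ⊗ₜ[ℂ] 1 + l ⊗ₜ x) * (k ⊗ₜ k)) =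
      (k * x - c • (x * k)) ⊗ₜ k + (k * l) ⊗ₜ (k * x - c • (x * k)) := by
  simp only [mul_add, add_mul, Algebra.TensorProduct.tmul_mul_tmul, mul_one, one_mul, smul_add,
    TensorProduct.sub_tmul, TensorProduct.tmul_sub, TensorProduct.smul_tmul',
    TensorProduct.tmul_smul, h]
  abel

theorem chi_mul_inv (j : ι) : char (chiHom Q j) * char (chiInvHom Q j) = 1 := by
  rw [char_mul]
  refine (char_ext Q (g := Bialgebra.counitAlgHom ℂ (UGe Q)) ?_ ?_ ?_).trans rfl <;> intro i
  · change (toConv _ * toConv _ : WithConv (UGe Q →ₐ[ℂ] ℂ)) _ = _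
    rw [AlgHom.convMul_apply]; simp
  · change (toConv _ * toConv _ : WithConv (UGe Q →ₐ[ℂ] ℂ)) _ = _
    rw [AlgHom.convMul_apply]; simp [Q.χ_ne_zero]
  · change (toConv _ * toConv _ : WithConv (UGe Q →ₐ[ℂ] ℂ)) _ = _
    rw [AlgHom.convMul_apply]; simp [Q.χ_ne_zero]

theorem chi_inv_mul (j : ι) : char (chiInvHom Q j) * char (chiHom Q j) = 1 := by
  rw [char_mul]
  refine (char_ext Q (g := Bialgebra.counitAlgHom ℂ (UGe Q)) ?_ ?_ ?_).trans rfl <;> intro i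
  · change (toConv _ * toConv _ : WithConv (UGe Q →ₐ[ℂ] ℂ)) _ = _
    rw [AlgHom.convMul_apply]; simp
  · change (toConv _ * toConv _ : WithConv (UGe Q →ₐ[ℂ] ℂ)) _ = _
    rw [AlgHom.convMul_apply]; simp [Q.χ_ne_zero]
  · change (toConv _ * toConv _ : WithConv (UGe Q →ₐ[ℂ] ℂ)) _ = _
    rw [AlgHom.convMul_apply]; simp [Q.χ_ne_zero]

theorem chi_comm (i j : ι) :
    char (chiHom Q i) * char (chiHom Q j) = char (chiHom Q j) * char (chiHom Q i) := by
  rw [char_mul, char_mul]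
  refine char_ext Q ?_ ?_ ?_ <;> intro l
  · change (toConv _ * toConv _ : WithConv (UGe Q →ₐ[ℂ] ℂ)) _ =
      (toConv _ * toConv _ : WithConv (UGe Q →ₐ[ℂ] ℂ)) _
    rw [AlgHom.convMul_apply, AlgHom.convMul_apply]; simp
  · change (toConv _ * toConv _ : WithConv (UGe Q →ₐ[ℂ] ℂ)) _ =
      (toConv _ * toConv _ : WithConv (UGe Q →ₐ[ℂ] ℂ)) _
    rw [AlgHom.convMul_apply, AlgHom.convMul_apply]; simp [mul_comm]
  · change (toConv _ * toConv _ : WithConv (UGe Q →ₐ[ℂ] ℂ)) _ =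
      (toConv _ * toConv _ : WithConv (UGe Q →ₐ[ℂ] ℂ)) _
    rw [AlgHom.convMul_apply, AlgHom.convMul_apply]; simp [mul_comm]

theorem chi_xi (i j : ι) : char (chiHom Q i) * xi Q j =
    (Q.χ j i)⁻¹ • (xi Q j * char (chiHom Q i)) := by
  rw [← sub_eq_zero]
  refine skew_zero Q (u := char (chiHom Q i) * char (chiHom Q j)) (v := char (chiHom Q i))
    ?_ ?_ ?_ ?_ ?_ ?_
  · rw [map_sub, map_smul, map_mul, map_mul, mulDual_xi, mulDual_char, ← map_mul, ← map_mul,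
      ← map_smul, ← map_sub]
    congr 1
    exact skew_comm_tmul _ (chi_comm Q j i)
  · change evOne (UGe Q) (char (chiHom Q i) * char (chiHom Q j)) = 1
    rw [map_mul, evOne_apply, evOne_apply, char_apply, char_apply, map_one, map_one, mul_one]
  · rw [char_apply, map_one]
  · intro l
    have h : evE Q l (char (chiHom Q i) * xi Q j - (Q.χ j i)⁻¹ • (xi Q j * char (chiHom Q i))) 0 1
      = 0 := by
      rw [map_sub, map_smul, map_mul, map_mul, evE_apply, evE_apply]
      simp [char_apply]
      by_cases h : l = j
      · subst h
        simp
        rw [mul_left_comm, inv_mul_cancel₀ (Q.χ_ne_zero l i), mul_one, sub_self]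
      · simp [h]
    simpa [evE_apply] using h
  · intro l
    have h : evE Q l (char (chiHom Q i) * xi Q j - (Q.χ j i)⁻¹ • (xi Q j * char (chiHom Q i))) 1 1
      = 0 := by
      rw [map_sub, map_smul, map_mul, map_mul, evE_apply, evE_apply]
      simp [char_apply]
    simpa [evE_apply] using h
  · intro l
    have h : evKinv Q l (char (chiHom Q i) * xi Q j - (Q.χ j i)⁻¹ • (xi Q j * char (chiHom Q i)))
      = 0 := by
      rw [map_sub, map_smul, map_mul, map_mul, evKinv_apply, evKinv_apply]
      simp
    exact h

theorem serreOp_skew {R : Type*} [Ring R] [Algebra ℂ R] {i j : ι} (h : i ≠ j) {k l x y : R}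
    (hkl : k * l = l * k) (hkx : k * x = (Q.χ i i)⁻¹ • (x * k))
    (hky : k * y = (Q.χ j i)⁻¹ • (y * k)) (hlx : l * x = (Q.χ i j)⁻¹ • (x * l)) :
    serreOp (Q.N i j) (Q.q i) (Q.χ j i) (x ⊗ₜ[ℂ] (1 : R) + k ⊗ₜ[ℂ] x)
      (y ⊗ₜ[ℂ] (1 : R) + l ⊗ₜ[ℂ] y) =
    serreOp (Q.N i j) (Q.q i) (Q.χ j i) x y ⊗ₜ[ℂ] (1 : R) +
      (k ^ Q.N i j * l) ⊗ₜ[ℂ] serreOp (Q.N i j) (Q.q i) (Q.χ j i) x y := by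
  rw [serreOp_add (Q.q_not_root i) (Q.N i j) (p := (Q.χ i i)⁻¹) (p₁ := (Q.χ i j)⁻¹)
    (p₂ := (Q.χ j i)⁻¹), serreOp_tmul _ _ _ _ hkl]
  · congr 1
    exact (map_serreOp (Algebra.TensorProduct.includeLeft : R →ₐ[ℂ] R ⊗[ℂ] R)
      (Q.N i j) (Q.χ j i) x y).symm
  · simp [hkx, TensorProduct.smul_tmul']
  · simp [hlx, TensorProduct.smul_tmul']
  · simp [hky, TensorProduct.smul_tmul']
  · rw [Q.χ_self]; exact mul_inv_cancel₀ (Q.q_ne_zero i)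
  · exact mul_inv_cancel₀ (Q.χ_ne_zero j i)
  · intro _
    rw [eq_mul_inv_iff_mul_eq₀ (Q.χ_ne_zero i j)]
    linear_combination Q.χ_mul h
  · exact Q.N_pos h

theorem serreOp_skew_map {R S : Type*} [Ring R] [Algebra ℂ R] [Ring S] [Algebra ℂ S]
    (f g : R →ₐ[ℂ] S) (hfg : ∀ x y, f x * g y = g y * f x) {i j : ι} (h : i ≠ j) {k l x y : R}
    (hkl : k * l = l * k) (hkx : k * x = (Q.χ i i)⁻¹ • (x * k))
    (hky : k * y = (Q.χ j i)⁻¹ • (y * k)) (hlx : l * x = (Q.χ i j)⁻¹ • (x * l)) :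
    serreOp (Q.N i j) (Q.q i) (Q.χ j i) (f x + f k * g x) (f y + f l * g y) =
      f (serreOp (Q.N i j) (Q.q i) (Q.χ j i) x y) +
        f (k ^ Q.N i j * l) * g (serreOp (Q.N i j) (Q.q i) (Q.χ j i) x y) := by
  have := congrArg (Algebra.TensorProduct.lift f g hfg) (serreOp_skew Q h hkl hkx hky hlx)
  have hl : ∀ a b : R, Algebra.TensorProduct.lift f g hfg (a ⊗ₜ b) = f a * g b :=
    fun a b => Algebra.TensorProduct.lift_tmul f g hfg a b
  rw [map_serreOp] at this
  simpa only [map_add, hl, map_one, mul_one] using this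

theorem serre_xi {i j : ι} (h : i ≠ j) :
    serreOp (Q.N i j) (Q.q i) (Q.χ j i) (xi Q i) (xi Q j) = 0 := by
  have hm : ∀ l, mulDual (UGe Q) (xi Q l) =
      boxInl (xi Q l) + boxInl (char (chiHom Q l)) * boxInr (xi Q l) := fun l =>
    (mulDual_xi Q l).trans (boxHom_skew _ _ _)
  have key := serreOp_skew_map Q boxInl boxInr boxInl_comm h (chi_comm Q i j) (chi_xi Q i i)
      (chi_xi Q i j) (chi_xi Q j i)
  rw [← hm, ← hm, ← map_serreOp, ← boxHom_skew] at key
  refine skew_zero Q (u := char (chiHom Q i) ^ Q.N i j * char (chiHom Q j)) (v := 1)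
    key ?_ ?_ ?_ ?_ ?_
  · change evOne (UGe Q) (char (chiHom Q i) ^ Q.N i j * char (chiHom Q j)) = 1
    rw [map_mul, map_pow, evOne_apply, evOne_apply, char_apply, char_apply, map_one, map_one]
    simp
  · simp
  · intro l
    have h : evE Q l (serreOp (Q.N i j) (Q.q i) (Q.χ j i) (xi Q i) (xi Q j)) 0 1 = 0 := by
      rw [map_serreOp, evE_apply, evE_apply]
      simp only [xi_one, xi_K]
      rw [serreOp_of_mul_eq_zero (Q.N_pos h) _ _ (upper_mul _ _) (upper_mul _ _)]
      rfl
    simpa [evE_apply] using h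
  · intro l
    have h : evE Q l (serreOp (Q.N i j) (Q.q i) (Q.χ j i) (xi Q i) (xi Q j)) 1 1 = 0 := by
      rw [map_serreOp, evE_apply, evE_apply]
      simp only [xi_one, xi_K]
      rw [serreOp_of_mul_eq_zero (Q.N_pos h) _ _ (upper_mul _ _) (upper_mul _ _)]
      rfl
    simpa [evE_apply] using h
  · intro l
    have h : evKinv Q l (serreOp (Q.N i j) (Q.q i) (Q.χ j i) (xi Q i) (xi Q j)) = 0 := by
      rw [map_serreOp, evKinv_apply, evKinv_apply, xi_Kinv, xi_Kinv]
      exact serreOp_of_mul_eq_zero (Q.N_pos h) _ _ (mul_zero _) (mul_zero _)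
    exact h

theorem psi_isRep : ULe.IsRep Q (xi Q) (fun j => char (chiHom Q j))
    (fun j => char (chiInvHom Q j)) where
  h1 := chi_mul_inv Q
  h2 := chi_inv_mul Q
  h3 := chi_comm Q
  h4 := chi_xi Q
  h5 _ _ h := serre_xi Q h

/-- The skew Hopf pairing, as an algebra homomorphism from `U_{r,s}^{≤}` to the convolution algebra
of linear forms on `U_{r,s}^{≥}`. -/
noncomputable def psi : ULe Q →ₐ[ℂ] WithConv (UGe Q →ₗ[ℂ] ℂ) := ULe.lift Q _ _ _ (psi_isRep Q)

@[simp] theorem psi_F (j : ι) : psi Q (ULe.F Q j) = xi Q j := ULe.lift_F (psi_isRep Q) j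
@[simp] theorem psi_K (j : ι) : psi Q (ULe.K Q j) = char (chiHom Q j) :=
  ULe.lift_K (psi_isRep Q) j
@[simp] theorem psi_Kinv (j : ι) : psi Q (ULe.Kinv Q j) = char (chiInvHom Q j) :=
  ULe.lift_Kinv (psi_isRep Q) j

theorem mulDual_psi : (mulDual (UGe Q)).comp (psi Q) = (boxHom.comp
    (Algebra.TensorProduct.map (psi Q) (psi Q))).comp (Bialgebra.comulAlgHom ℂ (ULe Q)) := by
  apply ULe.hom_ext <;> intro j <;> simp only [AlgHom.comp_apply, Bialgebra.comulAlgHom_apply]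
  · rw [ULe.comul_F, psi_F, mulDual_xi]; simp
  · rw [ULe.comul_K, psi_K, mulDual_char]; simp
  · rw [ULe.comul_Kinv, psi_Kinv, mulDual_char]; simp

/-- `S² (E_i) = χ_ii⁻¹ E_i`, and the inverse of `S²`. -/
theorem scale_isRep (c : ι → ℂ) : IsRep Q (fun i => c i • E Q i) (K Q) (Kinv Q) where
  h1 := K_Kinv Q
  h2 := Kinv_K Q
  h3 := K_comm Q
  h4 i j := by rw [mul_smul_comm, K_E, smul_mul_assoc, smul_comm]
  h5 i j h := by rw [serre_smul, serre_E Q h, smul_zero]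

theorem antipode_bijective :
    Function.Bijective (HopfAlgebra.antipode ℂ : UGe Q →ₗ[ℂ] UGe Q) := by
  let S2 : UGe Q →ₐ[ℂ] UGe Q := AlgHom.ofLinearMap
    (HopfAlgebra.antipode ℂ ∘ₗ HopfAlgebra.antipode ℂ) (by simp)
    (fun x y => by simp [HopfAlgebra.antipode_mul_antidistrib])
  have hS2 : ∀ x, S2 x = HopfAlgebra.antipode ℂ (HopfAlgebra.antipode ℂ x) := fun x => rfl
  let T : UGe Q →ₐ[ℂ] UGe Q := lift Q _ _ _ (scale_isRep Q fun i => Q.χ i i)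
  have hTE : ∀ i, T (E Q i) = Q.χ i i • E Q i := lift_E _
  have hTK : ∀ i, T (K Q i) = K Q i := lift_K _
  have hTKinv : ∀ i, T (Kinv Q i) = Kinv Q i := lift_Kinv _
  have hE : ∀ i, S2 (E Q i) = (Q.χ i i)⁻¹ • E Q i := fun i => by
    rw [hS2, antipode_E, map_neg, HopfAlgebra.antipode_mul_antidistrib, antipode_E, antipode_Kinv,
      mul_neg, neg_neg, ← mul_assoc, K_E_Kinv]
  have hK : ∀ i, S2 (K Q i) = K Q i := fun i => by rw [hS2, antipode_K, antipode_Kinv]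
  have hKinv : ∀ i, S2 (Kinv Q i) = Kinv Q i := fun i => by rw [hS2, antipode_Kinv, antipode_K]
  have h1 : S2.comp T = AlgHom.id ℂ _ := by
    apply hom_ext <;> intro i <;> simp [hTE, hTK, hTKinv, hE, hK, hKinv, Q.χ_ne_zero]
  have h2 : T.comp S2 = AlgHom.id ℂ _ := by
    apply hom_ext <;> intro i <;> simp [hTE, hTK, hTKinv, hE, hK, hKinv, Q.χ_ne_zero]
  constructor
  · intro x y hxy
    have := congrArg T (congrArg (HopfAlgebra.antipode ℂ) hxy)
    rw [← hS2, ← hS2] at this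
    exact (DFunLike.congr_fun h2 x).symm.trans (this.trans (DFunLike.congr_fun h2 y))
  · intro x
    exact ⟨HopfAlgebra.antipode ℂ (T x), (hS2 _).symm.trans (DFunLike.congr_fun h1 x)⟩

end UGe

namespace ULe

variable {ι : Type*} [Fintype ι] [LinearOrder ι] (Q : Datum ι)

theorem scale_isRep (c : ι → ℂ) : IsRep Q (fun i => c i • F Q i) (K Q) (Kinv Q) where
  h1 := K_Kinv Q
  h2 := Kinv_K Q
  h3 := K_comm Q
  h4 i j := by rw [mul_smul_comm, K_F, smul_mul_assoc, smul_comm]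
  h5 i j h := by rw [serreOp_smul, serre_F Q h, smul_zero]

theorem antipode_bijective :
    Function.Bijective (HopfAlgebra.antipode ℂ : ULe Q →ₗ[ℂ] ULe Q) := by
  let S2 : ULe Q →ₐ[ℂ] ULe Q := AlgHom.ofLinearMap
    (HopfAlgebra.antipode ℂ ∘ₗ HopfAlgebra.antipode ℂ) (by simp)
    (fun x y => by simp [HopfAlgebra.antipode_mul_antidistrib])
  have hS2 : ∀ x, S2 x = HopfAlgebra.antipode ℂ (HopfAlgebra.antipode ℂ x) := fun x => rfl
  let T : ULe Q →ₐ[ℂ] ULe Q := lift Q _ _ _ (scale_isRep Q fun i => (Q.χ i i)⁻¹)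
  have hTF : ∀ i, T (F Q i) = (Q.χ i i)⁻¹ • F Q i := lift_F _
  have hTK : ∀ i, T (K Q i) = K Q i := lift_K _
  have hTKinv : ∀ i, T (Kinv Q i) = Kinv Q i := lift_Kinv _
  have hF : ∀ i, S2 (F Q i) = Q.χ i i • F Q i := fun i => by
    rw [hS2, antipode_F, map_neg, HopfAlgebra.antipode_mul_antidistrib, antipode_F, antipode_Kinv,
      neg_mul, neg_neg, Kinv_F, smul_mul_assoc, mul_assoc, Kinv_K, mul_one]
  have hK : ∀ i, S2 (K Q i) = K Q i := fun i => by rw [hS2, antipode_K, antipode_Kinv]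
  have hKinv : ∀ i, S2 (Kinv Q i) = Kinv Q i := fun i => by rw [hS2, antipode_Kinv, antipode_K]
  have h1 : S2.comp T = AlgHom.id ℂ _ := by
    apply hom_ext <;> intro i <;> simp [hTF, hTK, hTKinv, hF, hK, hKinv, Q.χ_ne_zero]
  have h2 : T.comp S2 = AlgHom.id ℂ _ := by
    apply hom_ext <;> intro i <;> simp [hTF, hTK, hTKinv, hF, hK, hKinv, Q.χ_ne_zero]
  constructor
  · intro x y hxy
    have := congrArg T (congrArg (HopfAlgebra.antipode ℂ) hxy)
    rw [← hS2, ← hS2] at this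
    exact (DFunLike.congr_fun h2 x).symm.trans (this.trans (DFunLike.congr_fun h2 y))
  · intro x
    exact ⟨HopfAlgebra.antipode ℂ (T x), (hS2 _).symm.trans (DFunLike.congr_fun h1 x)⟩

end ULe

section Pairing

open WithConv

variable {ι : Type*} [Fintype ι] [LinearOrder ι] (Q : Datum ι)

/-- The bilinear form `φ`. -/
noncomputable def phiForm : UGe Q →ₗ[ℂ] ULe Q →ₗ[ℂ] ℂ :=
  LinearMap.flip
    { toFun := fun b => (UGe.psi Q b).ofConv
      map_add' := fun b b' => congrArg ofConv (map_add (UGe.psi Q) b b')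
      map_smul' := fun c b => congrArg ofConv (map_smul (UGe.psi Q) c b) }

theorem phiForm_apply (a : UGe Q) (b : ULe Q) : phiForm Q a b = UGe.psi Q b a := rfl

theorem phiForm_one_left (b : ULe Q) : phiForm Q 1 b = Coalgebra.counit b := by
  have : (evOne (UGe Q)).comp (UGe.psi Q) = Bialgebra.counitAlgHom ℂ (ULe Q) := by
    apply ULe.hom_ext <;> intro i <;> simp [evOne_apply, char_apply]
  exact DFunLike.congr_fun this b

/-- The skew Hopf pairing `φ` between `U_{r,s}^{≥}` and `U_{r,s}^{≤}`. -/
noncomputable def phi : SkewHopfPairing (UGe Q) (ULe Q) where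
  form := phiForm Q
  bijective_left := UGe.antipode_bijective Q
  bijective_right := ULe.antipode_bijective Q
  form_mul_right a b b' := by
    rw [phiForm_apply, map_mul]
    rfl
  form_mul_left a a' b := by
    rw [phiForm_apply, ← mulDual_apply]
    have := DFunLike.congr_fun (UGe.mulDual_psi Q) b
    simp only [AlgHom.comp_apply, Bialgebra.comulAlgHom_apply] at this
    rw [this]
    generalize Coalgebra.comul (R := ℂ) b = z
    change _ = LinearMap.mul' ℂ ℂ (TensorProduct.map (phiForm Q a') (phiForm Q a) z)
    induction z with
    | zero => simp only [map_zero]; rfl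
    | tmul u v => exact mul_comm _ _
    | add u v hu hv =>
      rw [map_add, map_add, map_add, map_add, ← hu, ← hv]
      rfl
  form_one_right a := by
    rw [phiForm_apply, map_one]
    rfl
  form_one_left := phiForm_one_left Q

/-- The values of `φ` on generators, which determine it. -/
theorem phi_E_F (i j : ι) : (phi Q).form (UGe.E Q i) (ULe.F Q j) =
    if i = j then (Q.s ^ Q.d j - Q.r ^ Q.d j)⁻¹ else 0 := by
  change UGe.psi Q _ _ = _
  simp
theorem phi_K_K (i j : ι) : (phi Q).form (UGe.K Q i) (ULe.K Q j) =
    Q.r ^ Q.euler i j * Q.s ^ (-Q.euler j i) := by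
  change UGe.psi Q _ _ = _
  simp [char_apply, Datum.χ]
theorem phi_E_K (i j : ι) : (phi Q).form (UGe.E Q i) (ULe.K Q j) = 0 := by
  change UGe.psi Q _ _ = _
  simp [char_apply]
theorem phi_K_F (i j : ι) : (phi Q).form (UGe.K Q i) (ULe.F Q j) = 0 := by
  change UGe.psi Q _ _ = _
  simp

end Pairing
end TwoParam

namespace TwoParam

/-! ### Tensor product algebras with a twisted multiplication -/

section Twist

variable {V W : Type*} [Ring V] [Algebra ℂ V] [Ring W] [Algebra ℂ W]

/-- `(m ⊗ m) ∘ (id ⊗ τ ⊗ id)` as a bilinear multiplication on `V ⊗ W`, for a linear map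
`τ : W ⊗ V → V ⊗ W` (in curried form). -/
noncomputable def twistMul (τ : W →ₗ[ℂ] V →ₗ[ℂ] V ⊗[ℂ] W) :
    V ⊗[ℂ] W →ₗ[ℂ] V ⊗[ℂ] W →ₗ[ℂ] V ⊗[ℂ] W :=
  TensorProduct.curry
    (TensorProduct.map (LinearMap.mul' ℂ V) (LinearMap.mul' ℂ W) ∘ₗ
      (TensorProduct.assoc ℂ V V (W ⊗[ℂ] W)).symm.toLinearMap ∘ₗ
      TensorProduct.map LinearMap.id
        ((TensorProduct.assoc ℂ V W W).toLinearMap ∘ₗ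
          TensorProduct.map (TensorProduct.lift τ) LinearMap.id ∘ₗ
          (TensorProduct.assoc ℂ W V W).symm.toLinearMap) ∘ₗ
      (TensorProduct.assoc ℂ V W (V ⊗[ℂ] W)).toLinearMap)

theorem twistMul_tmul (τ : W →ₗ[ℂ] V →ₗ[ℂ] V ⊗[ℂ] W) (v v' : V) (w w' : W) :
    twistMul τ (v ⊗ₜ w) (v' ⊗ₜ w') =
      TensorProduct.map (LinearMap.mulLeft ℂ v) (LinearMap.mulRight ℂ w') (τ w v') := by
  simp only [twistMul, TensorProduct.curry_apply, LinearMap.comp_apply, LinearEquiv.coe_coe,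
    TensorProduct.assoc_tmul, TensorProduct.map_tmul, TensorProduct.assoc_symm_tmul,
    TensorProduct.lift.tmul, LinearMap.id_apply]
  generalize τ w v' = t
  induction t with
  | zero => simp
  | tmul x y => simp
  | add x y hx hy => simp only [TensorProduct.add_tmul, map_add, TensorProduct.tmul_add, hx, hy]

theorem twistMul_left (τ : W →ₗ[ℂ] V →ₗ[ℂ] V ⊗[ℂ] W) (v : V) (x y : V ⊗[ℂ] W) :
    twistMul τ (TensorProduct.map (LinearMap.mulLeft ℂ v) LinearMap.id x) y =
      TensorProduct.map (LinearMap.mulLeft ℂ v) LinearMap.id (twistMul τ x y) := by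
  induction x with
  | zero => simp
  | add x x' hx hx' => simp only [map_add, LinearMap.add_apply, hx, hx']
  | tmul a b =>
    induction y with
    | zero => simp
    | add y y' hy hy' => simp only [map_add, hy, hy']
    | tmul c d =>
      rw [TensorProduct.map_tmul, twistMul_tmul, twistMul_tmul]
      simp only [LinearMap.id_apply]
      generalize τ b c = t
      induction t with
      | zero => simp
      | add t t' ht ht' => simp only [map_add, ht, ht']
      | tmul e f => simp [mul_assoc]

theorem twistMul_right (τ : W →ₗ[ℂ] V →ₗ[ℂ] V ⊗[ℂ] W) (w : W) (x y : V ⊗[ℂ] W) :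
    twistMul τ x (TensorProduct.map LinearMap.id (LinearMap.mulRight ℂ w) y) =
      TensorProduct.map LinearMap.id (LinearMap.mulRight ℂ w) (twistMul τ x y) := by
  induction x with
  | zero => simp
  | add x x' hx hx' => simp only [map_add, LinearMap.add_apply, hx, hx']
  | tmul a b =>
    induction y with
    | zero => simp
    | add y y' hy hy' => simp only [map_add, hy, hy']
    | tmul c d =>
      rw [TensorProduct.map_tmul, twistMul_tmul, twistMul_tmul]
      simp only [LinearMap.id_apply]
      generalize τ b c = t
      induction t with
      | zero => simp
      | add t t' ht ht' => simp only [map_add, ht, ht']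
      | tmul e f => simp [mul_assoc]

end Twist

/-- An exchange map `τ : W ⊗ V → V ⊗ W` that is compatible with the multiplications and the units
of two algebras `V` and `W`, so that `twistMul τ` is an associative multiplication on `V ⊗ W` with
unit `1 ⊗ 1`. -/
structure Twist (V W : Type*) [Ring V] [Algebra ℂ V] [Ring W] [Algebra ℂ W] where
  /-- The exchange map. -/
  τ : W →ₗ[ℂ] V →ₗ[ℂ] V ⊗[ℂ] W
  one_left : ∀ v, τ 1 v = v ⊗ₜ 1
  one_right : ∀ w, τ w 1 = 1 ⊗ₜ w
  mul_left : ∀ w w' v, τ (w * w') v = twistMul τ (1 ⊗ₜ w) (τ w' v)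
  mul_right : ∀ w v v', τ w (v * v') = twistMul τ (τ w v) (v' ⊗ₜ 1)

section TwistedTensor

variable {V W : Type*} [Ring V] [Algebra ℂ V] [Ring W] [Algebra ℂ W]

/-- The vector space `V ⊗ W` with the multiplication `(m ⊗ m) ∘ (id ⊗ τ ⊗ id)`. -/
def TwistedTensor (_T : Twist V W) : Type _ := V ⊗[ℂ] W

namespace TwistedTensor

variable (T : Twist V W)

noncomputable instance : AddCommGroup (TwistedTensor T) :=
  inferInstanceAs (AddCommGroup (V ⊗[ℂ] W))
noncomputable instance : Module ℂ (TwistedTensor T) := inferInstanceAs (Module ℂ (V ⊗[ℂ] W))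

/-- The identity map, to and from the plain tensor product. -/
noncomputable def equiv : V ⊗[ℂ] W ≃ₗ[ℂ] TwistedTensor T := LinearEquiv.refl ℂ _

/-- The pure tensor `v ⊗ w`. -/
noncomputable def mk (v : V) (w : W) : TwistedTensor T := equiv T (v ⊗ₜ w)

theorem twistMul_comp_left (w' : W) (v'' : V) (t : V ⊗[ℂ] W) :
    twistMul T.τ (TensorProduct.map LinearMap.id (LinearMap.mulRight ℂ w') t) (v'' ⊗ₜ 1) =
      twistMul T.τ t (T.τ w' v'') := by
  induction t with
  | zero => simp
  | add x x' hx hx' => simp only [map_add, LinearMap.add_apply, hx, hx']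
  | tmul a b =>
    have : (a ⊗ₜ[ℂ] b) = TensorProduct.map (LinearMap.mulLeft ℂ a) LinearMap.id (1 ⊗ₜ[ℂ] b) := by
      simp
    rw [TensorProduct.map_tmul, twistMul_tmul, LinearMap.mulRight_apply, T.mul_left, this,
      twistMul_left, LinearMap.mulRight_one]
    rfl

theorem twistMul_comp_right (w : W) (v' : V) (t : V ⊗[ℂ] W) :
    twistMul T.τ (1 ⊗ₜ w) (TensorProduct.map (LinearMap.mulLeft ℂ v') LinearMap.id t) =
      twistMul T.τ (T.τ w v') t := by
  induction t with
  | zero => simp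
  | add x x' hx hx' => simp only [map_add, hx, hx']
  | tmul a b =>
    have : (a ⊗ₜ[ℂ] b) = TensorProduct.map LinearMap.id (LinearMap.mulRight ℂ b) (a ⊗ₜ[ℂ] 1) := by
      simp
    rw [TensorProduct.map_tmul, twistMul_tmul, LinearMap.mulLeft_apply, T.mul_right, this,
      twistMul_right, LinearMap.mulLeft_one]
    rfl

theorem twistMul_assoc (x y z : V ⊗[ℂ] W) :
    twistMul T.τ (twistMul T.τ x y) z = twistMul T.τ x (twistMul T.τ y z) := by
  induction x with
  | zero => simp
  | add x x' hx hx' => simp only [map_add, LinearMap.add_apply, hx, hx']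
  | tmul v w =>
  induction y with
  | zero => simp
  | add y y' hy hy' => simp only [map_add, LinearMap.add_apply, hy, hy']
  | tmul v' w' =>
  induction z with
  | zero => simp
  | add z z' hz hz' => simp only [map_add, hz, hz']
  | tmul v'' w'' =>
  have e1 : (v ⊗ₜ[ℂ] w) = TensorProduct.map (LinearMap.mulLeft ℂ v) LinearMap.id (1 ⊗ₜ[ℂ] w) := by
    simp
  have e2 : (v'' ⊗ₜ[ℂ] w'') =
      TensorProduct.map LinearMap.id (LinearMap.mulRight ℂ w'') (v'' ⊗ₜ[ℂ] 1) := by simp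
  have h1 : twistMul T.τ ((1 : V) ⊗ₜ[ℂ] w) (v' ⊗ₜ[ℂ] w') =
      TensorProduct.map LinearMap.id (LinearMap.mulRight ℂ w') (T.τ w v') := by
    rw [twistMul_tmul, LinearMap.mulLeft_one]
  have h2 : twistMul T.τ (v' ⊗ₜ[ℂ] w') (v'' ⊗ₜ[ℂ] (1 : W)) =
      TensorProduct.map (LinearMap.mulLeft ℂ v') LinearMap.id (T.τ w' v'') := by
    rw [twistMul_tmul, LinearMap.mulRight_one]
  rw [e1, e2, twistMul_left, twistMul_right, twistMul_right, twistMul_right, twistMul_left,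
    twistMul_left, h1, h2, twistMul_comp_left, twistMul_comp_right]

theorem one_twistMul (x : V ⊗[ℂ] W) : twistMul T.τ (1 ⊗ₜ 1) x = x := by
  induction x with
  | zero => simp
  | add x x' hx hx' => simp only [map_add, hx, hx']
  | tmul v w => simp [twistMul_tmul, T.one_left]

theorem twistMul_one (x : V ⊗[ℂ] W) : twistMul T.τ x (1 ⊗ₜ 1) = x := by
  induction x with
  | zero => simp
  | add x x' hx hx' => simp only [map_add, LinearMap.add_apply, hx, hx']
  | tmul v w => simp [twistMul_tmul, T.one_right]

noncomputable instance : Ring (TwistedTensor T) where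
  mul x y := equiv T (twistMul T.τ ((equiv T).symm x) ((equiv T).symm y))
  one := mk T 1 1
  mul_assoc x y z := twistMul_assoc T x y z
  one_mul x := one_twistMul T x
  mul_one x := twistMul_one T x
  left_distrib x y z := map_add (twistMul T.τ x) y z
  right_distrib x y z := LinearMap.map_add₂ (twistMul T.τ) x y z
  zero_mul x := LinearMap.map_zero₂ (twistMul T.τ) x
  mul_zero x := map_zero (twistMul T.τ x)
  zsmul := zsmulRec
  neg_add_cancel := neg_add_cancel

theorem mul_def (x y : TwistedTensor T) :
    x * y = equiv T (twistMul T.τ ((equiv T).symm x) ((equiv T).symm y)) := rfl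
theorem one_def : (1 : TwistedTensor T) = mk T 1 1 := rfl

noncomputable instance : Algebra ℂ (TwistedTensor T) :=
  Algebra.ofModule
    (fun c x y => LinearMap.map_smul₂ (twistMul T.τ) c x y)
    (fun c x y => map_smul (twistMul T.τ x) c y)

theorem mk_mul_mk (v v' : V) (w w' : W) : mk T v w * mk T v' w' =
    equiv T (TensorProduct.map (LinearMap.mulLeft ℂ v) (LinearMap.mulRight ℂ w') (T.τ w v')) :=
  congrArg (equiv T) (twistMul_tmul T.τ v v' w w')

/-- `v ↦ v ⊗ 1`. -/
noncomputable def inl : V →ₐ[ℂ] TwistedTensor T :=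
  AlgHom.ofLinearMap ((equiv T).toLinearMap ∘ₗ (TensorProduct.mk ℂ V W).flip 1) rfl
    (fun v v' => by
      change mk T (v * v') 1 = mk T v 1 * mk T v' 1
      rw [mk_mul_mk, T.one_left]
      simp [mk])

/-- `w ↦ 1 ⊗ w`. -/
noncomputable def inr : W →ₐ[ℂ] TwistedTensor T :=
  AlgHom.ofLinearMap ((equiv T).toLinearMap ∘ₗ TensorProduct.mk ℂ V W 1) rfl
    (fun w w' => by
      change mk T 1 (w * w') = mk T 1 w * mk T 1 w'
      rw [mk_mul_mk, T.one_right]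
      simp [mk])

theorem inl_apply (v : V) : inl T v = mk T v 1 := rfl
theorem inr_apply (w : W) : inr T w = mk T 1 w := rfl

theorem inl_mul_inr (v : V) (w : W) : inl T v * inr T w = mk T v w := by
  rw [inl_apply, inr_apply, mk_mul_mk, T.one_left]
  simp [mk]

end TwistedTensor

end TwistedTensor
end TwoParam

namespace TwoParam

section Slice

open Coalgebra

variable {C : Type*} [AddCommGroup C] [Module ℂ C] [Coalgebra ℂ C]

/-- `y ↦ ∑ f(y₁) y₂`. -/
noncomputable def sliceL (f : C →ₗ[ℂ] ℂ) : C →ₗ[ℂ] C :=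
  (TensorProduct.lid ℂ C).toLinearMap ∘ₗ LinearMap.rTensor C f ∘ₗ comul

/-- `y ↦ ∑ f(y₂) y₁`. -/
noncomputable def sliceR (f : C →ₗ[ℂ] ℂ) : C →ₗ[ℂ] C :=
  (TensorProduct.rid ℂ C).toLinearMap ∘ₗ LinearMap.lTensor C f ∘ₗ comul

theorem sliceL_repr (f : C →ₗ[ℂ] ℂ) (y : C) (R : Repr ℂ y (C × C)) :
    sliceL f y = ∑ i ∈ R.index, f (R.left i) • R.right i := by
  rw [sliceL, LinearMap.comp_apply, LinearMap.comp_apply, ← R.eq]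
  simp

theorem sliceR_repr (f : C →ₗ[ℂ] ℂ) (y : C) (R : Repr ℂ y (C × C)) :
    sliceR f y = ∑ i ∈ R.index, f (R.right i) • R.left i := by
  rw [sliceR, LinearMap.comp_apply, LinearMap.comp_apply, ← R.eq]
  simp

theorem conv_repr (f g : C →ₗ[ℂ] ℂ) (y : C) (R : Repr ℂ y (C × C)) :
    (LinearMap.mul' ℂ ℂ ∘ₗ TensorProduct.map f g ∘ₗ comul) y =
      ∑ i ∈ R.index, f (R.left i) * g (R.right i) := by
  rw [LinearMap.comp_apply, LinearMap.comp_apply, ← R.eq]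
  simp

theorem sliceL_sliceL (f g : C →ₗ[ℂ] ℂ) (y : C) : sliceL f (sliceL g y) =
    sliceL (LinearMap.mul' ℂ ℂ ∘ₗ TensorProduct.map g f ∘ₗ comul) y := by
  have h := congrArg ((TensorProduct.lid ℂ C).toLinearMap ∘ₗ TensorProduct.map g
    ((TensorProduct.lid ℂ C).toLinearMap ∘ₗ TensorProduct.map f LinearMap.id))
      (sum_tmul_tmul_eq (ℛ ℂ y) (fun i => ℛ ℂ ((ℛ ℂ y).left i)) (fun i => ℛ ℂ ((ℛ ℂ y).right i)))
  simp only [map_sum, LinearMap.comp_apply, TensorProduct.map_tmul, LinearEquiv.coe_coe,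
    TensorProduct.lid_tmul, LinearMap.id_apply, smul_smul] at h
  rw [sliceL_repr _ y (ℛ ℂ y), sliceL_repr _ y (ℛ ℂ y), map_sum]
  simp only [fun i => conv_repr g f _ (ℛ ℂ ((ℛ ℂ y).left i)), map_smul,
    fun i => sliceL_repr f _ (ℛ ℂ ((ℛ ℂ y).right i)), Finset.smul_sum, Finset.sum_smul, smul_smul]
  exact h.symm

theorem sliceR_sliceR (f g : C →ₗ[ℂ] ℂ) (y : C) : sliceR f (sliceR g y) =
    sliceR (LinearMap.mul' ℂ ℂ ∘ₗ TensorProduct.map f g ∘ₗ comul) y := by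
  have h := congrArg ((TensorProduct.rid ℂ C).toLinearMap ∘ₗ TensorProduct.map LinearMap.id
    (LinearMap.mul' ℂ ℂ ∘ₗ TensorProduct.map f g))
      (sum_tmul_tmul_eq (ℛ ℂ y) (fun i => ℛ ℂ ((ℛ ℂ y).left i)) (fun i => ℛ ℂ ((ℛ ℂ y).right i)))
  simp only [map_sum, LinearMap.comp_apply, TensorProduct.map_tmul, LinearEquiv.coe_coe,
    TensorProduct.rid_tmul, LinearMap.id_apply, LinearMap.mul'_apply] at h
  rw [sliceR_repr _ y (ℛ ℂ y), sliceR_repr _ y (ℛ ℂ y), map_sum]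
  simp only [fun i => conv_repr f g _ (ℛ ℂ ((ℛ ℂ y).right i)), map_smul,
    fun i => sliceR_repr f _ (ℛ ℂ ((ℛ ℂ y).left i)), Finset.smul_sum, Finset.sum_smul, smul_smul]
  rw [← h]
  simp only [mul_comm]

theorem sliceL_sliceR (f g : C →ₗ[ℂ] ℂ) (y : C) :
    sliceL f (sliceR g y) = sliceR g (sliceL f y) := by
  have h := congrArg ((TensorProduct.lid ℂ C).toLinearMap ∘ₗ TensorProduct.map f
    ((TensorProduct.rid ℂ C).toLinearMap ∘ₗ TensorProduct.map LinearMap.id g))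
      (sum_tmul_tmul_eq (ℛ ℂ y) (fun i => ℛ ℂ ((ℛ ℂ y).left i)) (fun i => ℛ ℂ ((ℛ ℂ y).right i)))
  simp only [map_sum, LinearMap.comp_apply, TensorProduct.map_tmul, LinearEquiv.coe_coe,
    TensorProduct.rid_tmul, TensorProduct.lid_tmul, LinearMap.id_apply, smul_smul] at h
  rw [sliceL_repr _ y (ℛ ℂ y), sliceR_repr _ y (ℛ ℂ y), map_sum, map_sum]
  simp only [fun i => sliceR_repr g _ (ℛ ℂ ((ℛ ℂ y).right i)), map_smul,
    fun i => sliceL_repr f _ (ℛ ℂ ((ℛ ℂ y).left i)), Finset.smul_sum, smul_smul]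
  rw [← h]
  simp only [mul_comm]

end Slice

namespace SkewHopfPairing

open Coalgebra

variable {A B : Type*} [Ring A] [HopfAlgebra ℂ A] [Ring B] [HopfAlgebra ℂ B]
variable (φ : SkewHopfPairing A B)

/-- The action `a · y = ∑ φ(a, y₁) y₂` of `A` on `B`. -/
noncomputable def hit : A →ₗ[ℂ] B →ₗ[ℂ] B :=
  (LinearMap.llcomp ℂ B (B ⊗[ℂ] B) B).flip comul ∘ₗ
    (LinearMap.llcomp ℂ (B ⊗[ℂ] B) (ℂ ⊗[ℂ] B) B (TensorProduct.lid ℂ B).toLinearMap) ∘ₗ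
    LinearMap.rTensorHom B ∘ₗ φ.form

theorem hit_apply (a : A) (y : B) :
    φ.hit a y = TensorProduct.lid ℂ B (LinearMap.rTensor B (φ.form a) (comul y)) := rfl

/-- The inverse of the antipode of `A`. -/
noncomputable def antipodeInv : A →ₗ[ℂ] A :=
  (LinearEquiv.ofBijective _ φ.bijective_left).symm.toLinearMap

/-- The map `b ↦ (a ↦ ∑ φ(S⁻¹(a₁), b) a₂)`. -/
noncomputable def hitL : B →ₗ[ℂ] A →ₗ[ℂ] A :=
  (LinearMap.llcomp ℂ A (A ⊗[ℂ] A) A).flip comul ∘ₗ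
    (LinearMap.llcomp ℂ (A ⊗[ℂ] A) (ℂ ⊗[ℂ] A) A (TensorProduct.lid ℂ A).toLinearMap) ∘ₗ
    LinearMap.rTensorHom A ∘ₗ (φ.form ∘ₗ φ.antipodeInv).flip

theorem hitL_apply (b : B) (a : A) : φ.hitL b a = TensorProduct.lid ℂ A
    (LinearMap.rTensor A ((φ.form ∘ₗ φ.antipodeInv).flip b) (comul a)) := rfl

/-- The map `b ↦ (a ↦ ∑ φ(a₂, b) a₁)`. -/
noncomputable def hitR : B →ₗ[ℂ] A →ₗ[ℂ] A :=
  (LinearMap.llcomp ℂ A (A ⊗[ℂ] A) A).flip comul ∘ₗ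
    (LinearMap.llcomp ℂ (A ⊗[ℂ] A) (A ⊗[ℂ] ℂ) A (TensorProduct.rid ℂ A).toLinearMap) ∘ₗ
    LinearMap.lTensorHom A ∘ₗ φ.form.flip

theorem hitR_apply (b : B) (a : A) : φ.hitR b a = TensorProduct.rid ℂ A
    (LinearMap.lTensor A (φ.form.flip b) (comul a)) := rfl

theorem antipode_antipodeInv (a : A) : HopfAlgebra.antipode ℂ (φ.antipodeInv a) = a :=
  (LinearEquiv.ofBijective _ φ.bijective_left).apply_symm_apply a

theorem antipodeInv_antipode (a : A) : φ.antipodeInv (HopfAlgebra.antipode ℂ a) = a :=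
  (LinearEquiv.ofBijective _ φ.bijective_left).symm_apply_apply a

theorem antipodeInv_mul (a b : A) :
    φ.antipodeInv (a * b) = φ.antipodeInv b * φ.antipodeInv a := by
  apply φ.bijective_left.1
  rw [antipode_antipodeInv, HopfAlgebra.antipode_mul_antidistrib, antipode_antipodeInv,
    antipode_antipodeInv]

theorem antipodeInv_one : φ.antipodeInv 1 = 1 := by
  apply φ.bijective_left.1
  rw [antipode_antipodeInv, HopfAlgebra.antipode_one]

/-- A bilinear form as an element of the convolution algebra dual to `A ⊗ B`. -/
noncomputable def bil (f : A →ₗ[ℂ] B →ₗ[ℂ] ℂ) : WithConv (A ⊗[ℂ] B →ₗ[ℂ] ℂ) :=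
  WithConv.toConv (TensorProduct.lift f)

theorem bil_mul (f g : A →ₗ[ℂ] B →ₗ[ℂ] ℂ) (a : A) (b : B) (Ra : Repr ℂ a (A × A))
    (Rb : Repr ℂ b (B × B)) : (bil f * bil g) (a ⊗ₜ b) = ∑ i ∈ Ra.index, ∑ j ∈ Rb.index,
      f (Ra.left i) (Rb.left j) * g (Ra.right i) (Rb.right j) := by
  rw [LinearMap.convMul_apply]
  simp only [TensorProduct.comul_tmul, ← Ra.eq, ← Rb.eq, TensorProduct.sum_tmul,
    TensorProduct.tmul_sum, map_sum, TensorProduct.AlgebraTensorModule.tensorTensorTensorComm_tmul,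
    TensorProduct.map_tmul, LinearMap.mul'_apply, bil, TensorProduct.lift.tmul]
  first | rfl | rw [Finset.sum_comm]

theorem form_mul_right_repr (a : A) (b b' : B) (Ra : Repr ℂ a (A × A)) :
    φ.form a (b * b') = ∑ i ∈ Ra.index, φ.form (Ra.left i) b * φ.form (Ra.right i) b' := by
  rw [φ.form_mul_right, ← Ra.eq]
  simp

theorem form_mul_left_repr (a a' : A) (b : B) (Rb : Repr ℂ b (B × B)) :
    φ.form (a * a') b = ∑ i ∈ Rb.index, φ.form a' (Rb.left i) * φ.form a (Rb.right i) := by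
  rw [φ.form_mul_left, ← Rb.eq]
  simp

theorem sum_antipodeInv (a : A) (Ra : Repr ℂ a (A × A)) :
    ∑ i ∈ Ra.index, φ.antipodeInv (Ra.right i) * Ra.left i = counit (R := ℂ) a • (1 : A) := by
  apply φ.bijective_left.1
  simp only [map_sum, HopfAlgebra.antipode_mul_antidistrib, antipode_antipodeInv, map_smul,
    HopfAlgebra.antipode_one]
  exact HopfAlgebra.sum_antipode_mul_eq_smul Ra

/-- `φ(S⁻¹(a), b) = φ(a, S(b))`. -/
theorem form_antipodeInv (a : A) (b : B) :
    φ.form (φ.antipodeInv a) b = φ.form a (HopfAlgebra.antipode ℂ b) := by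
  have h1 : bil (φ.form.compl₂ (HopfAlgebra.antipode ℂ)) * bil φ.form = 1 := by
    apply WithConv.ext
    apply TensorProduct.ext'
    intro a b
    refine (bil_mul _ _ a b (ℛ ℂ a) (ℛ ℂ b)).trans ?_
    rw [Finset.sum_comm]
    simp only [LinearMap.compl₂_apply, ← form_mul_right_repr]
    rw [← map_sum, HopfAlgebra.sum_antipode_mul_eq_smul, map_smul, φ.form_one_right]
    rfl
  have h2 : bil φ.form * bil (φ.form ∘ₗ φ.antipodeInv) = 1 := by
    apply WithConv.ext
    apply TensorProduct.ext'
    intro a b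
    refine (bil_mul _ _ a b (ℛ ℂ a) (ℛ ℂ b)).trans ?_
    simp only [LinearMap.comp_apply, ← form_mul_left_repr]
    rw [← LinearMap.sum_apply, ← map_sum, sum_antipodeInv, map_smul, LinearMap.smul_apply,
      φ.form_one_left]
    exact mul_comm _ _
  have := left_inv_eq_right_inv h1 h2
  exact (congrArg (fun f : WithConv (A ⊗[ℂ] B →ₗ[ℂ] ℂ) => f (a ⊗ₜ b)) this).symm

theorem hit_repr (a : A) (y : B) (R : Repr ℂ y (B × B)) :
    φ.hit a y = ∑ i ∈ R.index, φ.form a (R.left i) • R.right i := by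
  rw [hit_apply, ← R.eq]
  simp

theorem hitL_repr (b : B) (a : A) (R : Repr ℂ a (A × A)) :
    φ.hitL b a = ∑ i ∈ R.index, φ.form (φ.antipodeInv (R.left i)) b • R.right i := by
  rw [hitL_apply, ← R.eq]
  simp

theorem hitR_repr (b : B) (a : A) (R : Repr ℂ a (A × A)) :
    φ.hitR b a = ∑ i ∈ R.index, φ.form (R.right i) b • R.left i := by
  rw [hitR_apply, ← R.eq]
  simp

theorem hit_one_left (y : B) : φ.hit 1 y = y := by
  rw [φ.hit_repr 1 y (ℛ ℂ y)]
  simp only [form_one_left]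
  exact sum_counit_smul (ℛ ℂ y)

theorem hit_one_right (a : A) : φ.hit a 1 = counit (R := ℂ) a • (1 : B) := by
  rw [hit_apply, Bialgebra.comul_one, Algebra.TensorProduct.one_def]
  simp [form_one_right]

theorem hitL_one_left (a : A) : φ.hitL 1 a = a := by
  rw [φ.hitL_repr 1 a (ℛ ℂ a)]
  simp only [form_antipodeInv]
  simp only [HopfAlgebra.antipode_one, form_one_right]
  exact sum_counit_smul (ℛ ℂ a)

theorem hitL_one_right (b : B) : φ.hitL b 1 = counit (R := ℂ) b • (1 : A) := by
  rw [hitL_apply, Bialgebra.comul_one, Algebra.TensorProduct.one_def]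
  simp [form_one_left, antipodeInv_one]

theorem hitR_one_left (a : A) : φ.hitR 1 a = a := by
  have := congrArg (TensorProduct.rid ℂ A) (lTensor_counit_comul (R := ℂ) a)
  rw [hitR_apply]
  have h : φ.form.flip 1 = counit := by ext; simp [form_one_right]
  rw [h, this]
  simp

theorem hitR_one_right (b : B) : φ.hitR b 1 = counit (R := ℂ) b • (1 : A) := by
  rw [hitR_apply, Bialgebra.comul_one, Algebra.TensorProduct.one_def]
  simp [form_one_left]

/-- `∑ φ(x, b₁) b₂` is multiplicative with respect to the coproduct of `x`. -/
theorem hit_mul (a : A) (y y' : B) : φ.hit a (y * y') = LinearMap.mul' ℂ B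
    (TensorProduct.map (φ.hit.flip y) (φ.hit.flip y') (comul a)) := by
  rw [hit_apply, Bialgebra.comul_mul]
  simp only [← (ℛ ℂ y).eq, ← (ℛ ℂ y').eq, ← (ℛ ℂ a).eq, map_sum, Finset.sum_mul_sum,
    TensorProduct.map_tmul, LinearMap.flip_apply, LinearMap.mul'_apply,
    Algebra.TensorProduct.tmul_mul_tmul, LinearMap.rTensor_tmul, TensorProduct.lid_tmul,
    φ.form_mul_right_repr a _ _ (ℛ ℂ a), φ.hit_repr _ y (ℛ ℂ y), φ.hit_repr _ y' (ℛ ℂ y'),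
    smul_mul_smul_comm, Finset.sum_smul]
  rw [Finset.sum_comm_cycle]

theorem hitL_mul (b : B) (a a' : A) : φ.hitL b (a * a') = LinearMap.mul' ℂ A
    (TensorProduct.map (φ.hitL.flip a) (φ.hitL.flip a') (comul b)) := by
  rw [hitL_apply, Bialgebra.comul_mul]
  simp only [← (ℛ ℂ a).eq, ← (ℛ ℂ a').eq, ← (ℛ ℂ b).eq, map_sum, Finset.sum_mul_sum,
    TensorProduct.map_tmul, LinearMap.flip_apply, LinearMap.mul'_apply, LinearMap.comp_apply,
    Algebra.TensorProduct.tmul_mul_tmul, LinearMap.rTensor_tmul, TensorProduct.lid_tmul,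
    antipodeInv_mul,
    φ.form_mul_left_repr _ _ b (ℛ ℂ b), φ.hitL_repr _ a (ℛ ℂ a), φ.hitL_repr _ a' (ℛ ℂ a'),
    smul_mul_smul_comm, Finset.sum_smul]
  rw [Finset.sum_comm_cycle]

theorem hitR_mul (b : B) (a a' : A) : φ.hitR b (a * a') = LinearMap.mul' ℂ A
    (TensorProduct.map (φ.hitR.flip a) (φ.hitR.flip a')
      (TensorProduct.comm ℂ B B (comul b))) := by
  rw [hitR_apply, Bialgebra.comul_mul]
  simp only [← (ℛ ℂ a).eq, ← (ℛ ℂ a').eq, ← (ℛ ℂ b).eq, map_sum, Finset.sum_mul_sum,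
    TensorProduct.map_tmul, LinearMap.flip_apply, LinearMap.mul'_apply, TensorProduct.comm_tmul,
    Algebra.TensorProduct.tmul_mul_tmul, LinearMap.lTensor_tmul, TensorProduct.rid_tmul,
    φ.form_mul_left_repr _ _ b (ℛ ℂ b), φ.hitR_repr _ a (ℛ ℂ a), φ.hitR_repr _ a' (ℛ ℂ a'),
    smul_mul_smul_comm, Finset.sum_smul]
  rw [Finset.sum_comm_cycle]
  simp only [mul_comm]

theorem hit_hit (a a' : A) (y : B) : φ.hit (a * a') y = φ.hit a (φ.hit a' y) := by
  have h : φ.form (a * a') =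
      LinearMap.mul' ℂ ℂ ∘ₗ TensorProduct.map (φ.form a') (φ.form a) ∘ₗ comul :=
    LinearMap.ext (φ.form_mul_left a a')
  refine Eq.trans ?_ (sliceL_sliceL (φ.form a) (φ.form a') y).symm
  rw [← h]
  rfl

theorem hitL_hitL (b b' : B) (a : A) : φ.hitL (b * b') a = φ.hitL b (φ.hitL b' a) := by
  have h : (φ.form ∘ₗ φ.antipodeInv).flip (b * b') = LinearMap.mul' ℂ ℂ ∘ₗ TensorProduct.map
      ((φ.form ∘ₗ φ.antipodeInv).flip b') ((φ.form ∘ₗ φ.antipodeInv).flip b) ∘ₗ comul := by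
    ext x
    rw [conv_repr _ _ x (ℛ ℂ x)]
    simp only [LinearMap.flip_apply, LinearMap.comp_apply, form_antipodeInv,
      HopfAlgebra.antipode_mul_antidistrib, φ.form_mul_right_repr x _ _ (ℛ ℂ x)]
  refine Eq.trans ?_ (sliceL_sliceL _ _ a).symm
  rw [← h]
  rfl

theorem hitR_hitR (b b' : B) (a : A) : φ.hitR (b * b') a = φ.hitR b (φ.hitR b' a) := by
  have h : φ.form.flip (b * b') =
      LinearMap.mul' ℂ ℂ ∘ₗ TensorProduct.map (φ.form.flip b) (φ.form.flip b') ∘ₗ comul :=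
    LinearMap.ext fun x => φ.form_mul_right x b b'
  refine Eq.trans ?_ (sliceR_sliceR _ _ a).symm
  rw [← h]
  rfl

theorem hitL_hitR (b b' : B) (a : A) : φ.hitL b (φ.hitR b' a) = φ.hitR b' (φ.hitL b a) :=
  sliceL_sliceR _ _ a

end SkewHopfPairing
end TwoParam

namespace TwoParam

namespace SkewHopfPairing

open Coalgebra

variable {A B : Type*} [Ring A] [HopfAlgebra ℂ A] [Ring B] [HopfAlgebra ℂ B]
variable (φ : SkewHopfPairing A B)

section Exchange

variable {V W : Type*} [Ring V] [Algebra ℂ V] [Ring W] [Bialgebra ℂ W]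

/-- For an action of `W` on `V`, the exchange map `w ⊗ v ↦ ∑ (w₁ · v) ⊗ w₂`. -/
noncomputable def actExchange (act : W →ₗ[ℂ] V →ₗ[ℂ] V) : W →ₗ[ℂ] V →ₗ[ℂ] V ⊗[ℂ] W :=
  LinearMap.flip ((LinearMap.llcomp ℂ W (W ⊗[ℂ] W) (V ⊗[ℂ] W)).flip comul ∘ₗ
    LinearMap.rTensorHom W ∘ₗ act.flip)

theorem actExchange_apply (act : W →ₗ[ℂ] V →ₗ[ℂ] V) (w : W) (v : V) :
    actExchange act w v = LinearMap.rTensor W (act.flip v) (comul w) := rfl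

/-- For an action of `W` on `V`, the exchange map `w ⊗ v ↦ ∑ (w₂ · v) ⊗ w₁`. -/
noncomputable def actExchangeOp (act : W →ₗ[ℂ] V →ₗ[ℂ] V) : W →ₗ[ℂ] V →ₗ[ℂ] V ⊗[ℂ] W :=
  LinearMap.flip ((LinearMap.llcomp ℂ W (W ⊗[ℂ] W) (V ⊗[ℂ] W)).flip
      ((TensorProduct.comm ℂ W W).toLinearMap ∘ₗ comul) ∘ₗ
    LinearMap.rTensorHom W ∘ₗ act.flip)

theorem actExchange_repr (act : W →ₗ[ℂ] V →ₗ[ℂ] V) (w : W) (v : V) (R : Repr ℂ w (W × W)) :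
    actExchange act w v = ∑ i ∈ R.index, act (R.left i) v ⊗ₜ R.right i := by
  rw [actExchange_apply, ← R.eq]
  simp

theorem actExchangeOp_repr (act : W →ₗ[ℂ] V →ₗ[ℂ] V) (w : W) (v : V) (R : Repr ℂ w (W × W)) :
    actExchangeOp act w v = ∑ i ∈ R.index, act (R.right i) v ⊗ₜ R.left i := by
  change LinearMap.rTensor W (act.flip v) (TensorProduct.comm ℂ W W (comul w)) = _
  rw [← R.eq]
  simp

/-- The exchange map of a module algebra. -/
noncomputable def actTwist (act : W →ₗ[ℂ] V →ₗ[ℂ] V) (h1 : ∀ v, act 1 v = v)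
    (h2 : ∀ w w' v, act (w * w') v = act w (act w' v))
    (h3 : ∀ w, act w 1 = counit (R := ℂ) w • (1 : V))
    (h4 : ∀ w v v', act w (v * v') =
      LinearMap.mul' ℂ V (TensorProduct.map (act.flip v) (act.flip v') (comul w))) : Twist V W where
  τ := actExchange act
  one_left v := by
    rw [actExchange_apply, Bialgebra.comul_one, Algebra.TensorProduct.one_def]
    simp [h1]
  one_right w := by
    rw [actExchange_repr _ _ _ (ℛ ℂ w)]
    simp only [h3, TensorProduct.smul_tmul, ← TensorProduct.tmul_sum]
    rw [sum_counit_smul (ℛ ℂ w)]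
  mul_left w w' v := by
    rw [actExchange_apply, Bialgebra.comul_mul, actExchange_repr _ w' v (ℛ ℂ w')]
    simp only [map_sum, twistMul_tmul, actExchange_repr _ w _ (ℛ ℂ w), TensorProduct.map_tmul]
    nth_rw 1 [← (ℛ ℂ w).eq, ← (ℛ ℂ w').eq]
    simp only [Finset.sum_mul_sum, map_sum, Algebra.TensorProduct.tmul_mul_tmul,
      LinearMap.rTensor_tmul, LinearMap.flip_apply, h2, LinearMap.mulLeft_apply, one_mul,
      LinearMap.mulRight_apply]
    exact Finset.sum_comm
  mul_right w v v' := by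
    have h := congrArg (TensorProduct.map (act.flip v)
        (LinearMap.rTensor W (act.flip v')))
      (sum_tmul_tmul_eq (ℛ ℂ w) (fun i => ℛ ℂ ((ℛ ℂ w).left i)) (fun i => ℛ ℂ ((ℛ ℂ w).right i)))
    have h := congrArg (LinearMap.rTensor W (LinearMap.mul' ℂ V))
      (congrArg (TensorProduct.assoc ℂ V V W).symm h)
    simp only [map_sum, TensorProduct.map_tmul, LinearMap.rTensor_tmul, LinearMap.flip_apply,
      TensorProduct.assoc_symm_tmul, LinearMap.mul'_apply] at h
    rw [actExchange_repr _ _ _ (ℛ ℂ w), actExchange_repr _ _ _ (ℛ ℂ w)]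
    simp only [map_sum, LinearMap.sum_apply, twistMul_tmul, h4,
      fun i => actExchange_repr act _ v' (ℛ ℂ ((ℛ ℂ w).right i)), TensorProduct.map_tmul,
      LinearMap.mulLeft_apply, LinearMap.mulRight_apply, mul_one]
    rw [← h]
    refine Finset.sum_congr rfl fun i _ => ?_
    rw [← (ℛ ℂ ((ℛ ℂ w).left i)).eq]
    simp [TensorProduct.sum_tmul]

/-- The exchange map of a module algebra over the co-opposite bialgebra. -/
noncomputable def actTwistOp (act : W →ₗ[ℂ] V →ₗ[ℂ] V) (h1 : ∀ v, act 1 v = v)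
    (h2 : ∀ w w' v, act (w * w') v = act w (act w' v))
    (h3 : ∀ w, act w 1 = counit (R := ℂ) w • (1 : V))
    (h4 : ∀ w v v', act w (v * v') = LinearMap.mul' ℂ V (TensorProduct.map (act.flip v)
      (act.flip v') (TensorProduct.comm ℂ W W (comul w)))) : Twist V W where
  τ := actExchangeOp act
  one_left v := by
    change LinearMap.rTensor W (act.flip v) (TensorProduct.comm ℂ W W (comul 1)) = _
    rw [Bialgebra.comul_one, Algebra.TensorProduct.one_def]
    simp [h1]
  one_right w := by
    rw [actExchangeOp_repr _ _ _ (ℛ ℂ w)]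
    simp only [h3, TensorProduct.smul_tmul, ← TensorProduct.tmul_sum]
    have h := congrArg (TensorProduct.rid ℂ W) (sum_tmul_counit_eq (ℛ ℂ w))
    simp only [map_sum, TensorProduct.rid_tmul, one_smul] at h
    rw [h]
  mul_left w w' v := by
    change LinearMap.rTensor W (act.flip v) (TensorProduct.comm ℂ W W (comul (w * w'))) = _
    rw [Bialgebra.comul_mul, actExchangeOp_repr _ w' v (ℛ ℂ w')]
    simp only [map_sum, twistMul_tmul, actExchangeOp_repr _ w _ (ℛ ℂ w), TensorProduct.map_tmul]
    nth_rw 1 [← (ℛ ℂ w).eq, ← (ℛ ℂ w').eq]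
    simp only [Finset.sum_mul_sum, map_sum, Algebra.TensorProduct.tmul_mul_tmul,
      TensorProduct.comm_tmul,
      LinearMap.rTensor_tmul, LinearMap.flip_apply, h2, LinearMap.mulLeft_apply, one_mul,
      LinearMap.mulRight_apply]
    exact Finset.sum_comm
  mul_right w v v' := by
    have h := congrArg (TensorProduct.map (LinearMap.id (R := ℂ) (M := W))
        (TensorProduct.map (act.flip v') (act.flip v)))
      (sum_tmul_tmul_eq (ℛ ℂ w) (fun i => ℛ ℂ ((ℛ ℂ w).left i)) (fun i => ℛ ℂ ((ℛ ℂ w).right i)))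
    have h := congrArg (LinearMap.rTensor W (LinearMap.mul' ℂ V ∘ₗ
      (TensorProduct.comm ℂ V V).toLinearMap)) (congrArg (TensorProduct.comm ℂ W (V ⊗[ℂ] V)) h)
    simp only [map_sum, TensorProduct.map_tmul, LinearMap.rTensor_tmul, LinearMap.flip_apply,
      TensorProduct.comm_tmul, LinearMap.comp_apply, LinearEquiv.coe_coe,
      LinearMap.id_apply, LinearMap.mul'_apply] at h
    rw [actExchangeOp_repr _ _ _ (ℛ ℂ w), actExchangeOp_repr _ _ _ (ℛ ℂ w)]
    simp only [map_sum, LinearMap.sum_apply, twistMul_tmul, h4,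
      fun i => actExchangeOp_repr act _ v' (ℛ ℂ ((ℛ ℂ w).left i)), TensorProduct.map_tmul,
      LinearMap.mulLeft_apply, LinearMap.mulRight_apply, mul_one]
    rw [h]
    refine Finset.sum_congr rfl fun i _ => ?_
    rw [← (ℛ ℂ ((ℛ ℂ w).right i)).eq]
    simp [TensorProduct.sum_tmul]

end Exchange

/-- The exchange map `a ⊗ b ↦ ∑ φ(a₁, b₁) b₂ ⊗ a₂` of the Heisenberg double. -/
noncomputable def heisTwist : Twist B A :=
  actTwist φ.hit φ.hit_one_left φ.hit_hit φ.hit_one_right φ.hit_mul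

/-- The Heisenberg double `H_φ(A, B)`: the vector space `B ⊗ A` with the multiplication
`(b ♯ a)(b' ♯ a') = ∑ φ(a₁, b'₁) b b'₂ ♯ a₂ a'`. -/
abbrev HeisenbergDouble : Type _ := TwistedTensor φ.heisTwist

theorem heis_mul (b b' : B) (a a' : A) (Ra : Repr ℂ a (A × A)) (Rb : Repr ℂ b' (B × B)) :
    TwistedTensor.mk φ.heisTwist b a * TwistedTensor.mk φ.heisTwist b' a' =
      ∑ i ∈ Ra.index, ∑ j ∈ Rb.index, φ.form (Ra.left i) (Rb.left j) •
        TwistedTensor.mk φ.heisTwist (b * Rb.right j) (Ra.right i * a') := by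
  rw [TwistedTensor.mk_mul_mk]
  change TwistedTensor.equiv _ (TensorProduct.map _ _ (actExchange φ.hit a b')) = _
  rw [actExchange_repr _ _ _ Ra]
  simp only [φ.hit_repr _ b' Rb, map_sum, TensorProduct.sum_tmul, TensorProduct.map_tmul,
    LinearMap.mulLeft_apply, LinearMap.mulRight_apply, ← TensorProduct.smul_tmul', map_smul]
  rfl

/-- `b ⊗ a ↦ ∑ φ(S⁻¹(a₁), b₁) a₂ ⊗ b₂` -/
noncomputable def twistL : Twist A B :=
  actTwist φ.hitL φ.hitL_one_left φ.hitL_hitL φ.hitL_one_right φ.hitL_mul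

/-- `b ⊗ a ↦ ∑ φ(a₂, b₂) a₁ ⊗ b₁` -/
noncomputable def twistR : Twist A B :=
  actTwistOp φ.hitR φ.hitR_one_left φ.hitR_hitR φ.hitR_one_right φ.hitR_mul

/-- `b ⊗ a ↦ ∑ φ(S⁻¹(a₁), b₁) φ(a₃, b₃) a₂ ⊗ b₂` -/
noncomputable def doubleExchange : B →ₗ[ℂ] A →ₗ[ℂ] A ⊗[ℂ] B :=
  φ.twistR.τ.compr₂ (TensorProduct.lift φ.twistL.τ.flip)

theorem doubleExchange_repr (b : B) (a : A) (R : Repr ℂ b (B × B)) :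
    φ.doubleExchange b a = ∑ i ∈ R.index, φ.twistL.τ (R.left i) (φ.hitR (R.right i) a) := by
  change TensorProduct.lift φ.twistL.τ.flip (actExchangeOp φ.hitR b a) = _
  rw [actExchangeOp_repr _ _ _ R]
  simp

theorem doubleExchange_left (w w' : B) (u : A) :
    TensorProduct.lift φ.twistL.τ.flip (TensorProduct.map LinearMap.id (LinearMap.mulRight ℂ w')
      (φ.twistR.τ w u)) = twistMul φ.doubleExchange (1 ⊗ₜ w) (φ.twistL.τ w' u) := by
  have hR : φ.twistR.τ w u = ∑ i ∈ (ℛ ℂ w).index, φ.hitR ((ℛ ℂ w).right i) u ⊗ₜ (ℛ ℂ w).left i :=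
    actExchangeOp_repr _ _ _ (ℛ ℂ w)
  have hL : ∀ u, φ.twistL.τ w' u =
      ∑ j ∈ (ℛ ℂ w').index, φ.hitL ((ℛ ℂ w').left j) u ⊗ₜ (ℛ ℂ w').right j := fun u =>
    actExchange_repr _ _ _ (ℛ ℂ w')
  rw [hR]
  simp only [map_sum, TensorProduct.map_tmul, LinearMap.id_apply, LinearMap.mulRight_apply,
    TensorProduct.lift.tmul, LinearMap.flip_apply, φ.twistL.mul_left, hL, twistMul_tmul,
    φ.doubleExchange_repr w _ (ℛ ℂ w), hitL_hitR]
  exact Finset.sum_comm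

theorem doubleExchange_right (w : B) (v v' : A) :
    TensorProduct.lift φ.twistL.τ.flip (TensorProduct.map (LinearMap.mulLeft ℂ v) LinearMap.id
      (φ.twistR.τ w v')) = twistMul φ.doubleExchange (φ.twistL.τ w v) (v' ⊗ₜ 1) := by
  have hR : φ.twistR.τ w v' = ∑ i ∈ (ℛ ℂ w).index, φ.hitR ((ℛ ℂ w).right i) v' ⊗ₜ (ℛ ℂ w).left i :=
    actExchangeOp_repr _ _ _ (ℛ ℂ w)
  have hL : ∀ w, φ.twistL.τ w v =
      ∑ j ∈ (ℛ ℂ w).index, φ.hitL ((ℛ ℂ w).left j) v ⊗ₜ (ℛ ℂ w).right j := fun w =>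
    actExchange_repr _ _ _ (ℛ ℂ w)
  have h := congrArg (TensorProduct.lift
      ((LinearMap.rTensorHom B ∘ₗ LinearMap.mul ℂ A ∘ₗ φ.hitL.flip v).compl₂
        (TensorProduct.lift (φ.twistL.τ.compl₂ (φ.hitR.flip v')))))
    (sum_tmul_tmul_eq (ℛ ℂ w) (fun i => ℛ ℂ ((ℛ ℂ w).left i)) (fun i => ℛ ℂ ((ℛ ℂ w).right i)))
  simp only [map_sum, TensorProduct.lift.tmul, LinearMap.compl₂_apply, LinearMap.comp_apply,
    LinearMap.flip_apply] at h
  rw [hR]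
  simp only [map_sum, TensorProduct.map_tmul, LinearMap.id_apply, LinearMap.mulLeft_apply,
    TensorProduct.lift.tmul, LinearMap.flip_apply, φ.twistL.mul_right, hL, LinearMap.sum_apply,
    twistMul_tmul, LinearMap.mulRight_one,
    fun i => φ.doubleExchange_repr _ v' (ℛ ℂ ((ℛ ℂ w).right i))]
  exact h

/-- The exchange map `b ⊗ a ↦ ∑ φ(S⁻¹(a₁), b₁) φ(a₃, b₃) a₂ ⊗ b₂` of the quantum double. -/
noncomputable def doubleTwist : Twist A B where
  τ := φ.doubleExchange
  one_left a := by
    change TensorProduct.lift φ.twistL.τ.flip (φ.twistR.τ 1 a) = _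
    rw [φ.twistR.one_left, TensorProduct.lift.tmul, LinearMap.flip_apply, φ.twistL.one_left]
  one_right b := by
    change TensorProduct.lift φ.twistL.τ.flip (φ.twistR.τ b 1) = _
    rw [φ.twistR.one_right, TensorProduct.lift.tmul, LinearMap.flip_apply, φ.twistL.one_right]
  mul_left w w' v := by
    change TensorProduct.lift φ.twistL.τ.flip (φ.twistR.τ (w * w') v) =
      twistMul φ.doubleExchange (1 ⊗ₜ w) (TensorProduct.lift φ.twistL.τ.flip (φ.twistR.τ w' v))
    rw [φ.twistR.mul_left]
    generalize φ.twistR.τ w' v = t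
    induction t with
    | zero => simp
    | add x y hx hy => simp only [map_add, hx, hy]
    | tmul u w'' =>
      rw [twistMul_tmul, LinearMap.mulLeft_one, TensorProduct.lift.tmul, LinearMap.flip_apply,
        ← φ.doubleExchange_left]
  mul_right w v v' := by
    change TensorProduct.lift φ.twistL.τ.flip (φ.twistR.τ w (v * v')) =
      twistMul φ.doubleExchange (TensorProduct.lift φ.twistL.τ.flip (φ.twistR.τ w v)) (v' ⊗ₜ 1)
    rw [φ.twistR.mul_right]
    generalize φ.twistR.τ w v = t
    induction t with
    | zero => simp
    | add x y hx hy => simp only [map_add, LinearMap.add_apply, hx, hy]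
    | tmul u w'' =>
      rw [twistMul_tmul, LinearMap.mulRight_one, TensorProduct.lift.tmul, LinearMap.flip_apply,
        ← φ.doubleExchange_right]

/-- The quantum double `D_φ(A, B)`: the vector space `A ⊗ B` with the multiplication
`(a ⊗ b)(a' ⊗ b') = ∑ φ(S⁻¹(a'₁), b₁) φ(a'₃, b₃) a a'₂ ⊗ b₂ b'`. -/
abbrev QuantumDouble : Type _ := TwistedTensor φ.doubleTwist

theorem double_mul (a a' : A) (b b' : B) (Ra : Repr ℂ a' (A × A)) (Rb : Repr ℂ b (B × B))
    (Ra' : ∀ k, Repr ℂ (Ra.left k) (A × A)) (Rb' : ∀ i, Repr ℂ (Rb.left i) (B × B)) :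
    TwistedTensor.mk φ.doubleTwist a b * TwistedTensor.mk φ.doubleTwist a' b' =
      ∑ i ∈ Rb.index, ∑ j ∈ (Rb' i).index, ∑ k ∈ Ra.index, ∑ l ∈ (Ra' k).index,
        (φ.form (φ.antipodeInv ((Ra' k).left l)) ((Rb' i).left j) *
          φ.form (Ra.right k) (Rb.right i)) •
        TwistedTensor.mk φ.doubleTwist (a * (Ra' k).right l) ((Rb' i).right j * b') := by
  have hL : ∀ i u, φ.twistL.τ (Rb.left i) u =
      ∑ j ∈ (Rb' i).index, φ.hitL ((Rb' i).left j) u ⊗ₜ (Rb' i).right j := fun i u =>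
    actExchange_repr _ _ _ (Rb' i)
  rw [TwistedTensor.mk_mul_mk]
  change TwistedTensor.equiv _ (TensorProduct.map _ _ (φ.doubleExchange b a')) = _
  rw [doubleExchange_repr _ _ _ Rb]
  simp only [hL, φ.hitR_repr _ a' Ra, map_sum, map_smul, TensorProduct.sum_tmul,
    TensorProduct.map_tmul, fun b k => φ.hitL_repr b _ (Ra' k), Finset.smul_sum, smul_smul,
    LinearMap.mulLeft_apply, LinearMap.mulRight_apply, ← TensorProduct.smul_tmul']
  refine Finset.sum_congr rfl fun i _ => Finset.sum_congr rfl fun j _ =>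
    Finset.sum_congr rfl fun k _ => Finset.sum_congr rfl fun l _ => ?_
  rw [mul_comm]
  rfl

end SkewHopfPairing
end TwoParam

namespace TwoParam

open Coalgebra

/-- The left adjoint action `c · y = ∑ c₁ y S(c₂)` of a Hopf algebra on itself. -/
noncomputable def adjointAction (C : Type*) [Ring C] [HopfAlgebra ℂ C] : C →ₗ[ℂ] C →ₗ[ℂ] C :=
  LinearMap.mk₂ ℂ
    (fun c y => LinearMap.mul' ℂ C (TensorProduct.map ((LinearMap.mul ℂ C).flip y)
      (HopfAlgebra.antipode ℂ) (comul c)))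
    (fun c c' y => by simp only [map_add])
    (fun t c y => by simp only [map_smul])
    (fun c y y' => by simp only [map_add, TensorProduct.map_add_left, LinearMap.add_apply])
    (fun t c y => by simp only [map_smul, TensorProduct.map_smul_left, LinearMap.smul_apply])

theorem adjointAction_repr {C : Type*} [Ring C] [HopfAlgebra ℂ C] (c y : C)
    (R : Repr ℂ c (C × C)) : adjointAction C c y =
      ∑ i ∈ R.index, R.left i * y * HopfAlgebra.antipode ℂ (R.right i) := by
  rw [adjointAction, LinearMap.mk₂_apply, ← R.eq]
  simp

theorem adjointAction_one_left {C : Type*} [Ring C] [HopfAlgebra ℂ C] (y : C) :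
    adjointAction C 1 y = y := by
  rw [adjointAction, LinearMap.mk₂_apply, Bialgebra.comul_one, Algebra.TensorProduct.one_def]
  simp

theorem adjointAction_one_right {C : Type*} [Ring C] [HopfAlgebra ℂ C] (c : C) :
    adjointAction C c 1 = counit (R := ℂ) c • (1 : C) := by
  rw [adjointAction_repr c 1 (ℛ ℂ c)]
  simp only [mul_one]
  exact HopfAlgebra.sum_mul_antipode_eq_smul _

/-- The braiding `v ⊗ w ↦ ∑ v₍₋₁₎ · w ⊗ v₍₀₎` determined by a coaction of `H` on `V` and an action
of `H` on `W`. -/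
noncomputable def braiding {H V W : Type*} [AddCommGroup H] [Module ℂ H] [AddCommGroup V]
    [Module ℂ V] [AddCommGroup W] [Module ℂ W] (coact : V →ₗ[ℂ] H ⊗[ℂ] V)
    (act : H →ₗ[ℂ] W →ₗ[ℂ] W) : V →ₗ[ℂ] W →ₗ[ℂ] W ⊗[ℂ] V :=
  LinearMap.mk₂ ℂ (fun v w => LinearMap.rTensor V (act.flip w) (coact v))
    (fun v v' w => by simp only [map_add])
    (fun t v w => by simp only [map_smul])
    (fun v w w' => by simp only [map_add, LinearMap.rTensor_add, LinearMap.add_apply])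
    (fun t v w => by simp only [map_smul, LinearMap.rTensor_smul, LinearMap.smul_apply])

namespace SkewHopfPairing

variable {A B : Type*} [Ring A] [HopfAlgebra ℂ A] [Ring B] [HopfAlgebra ℂ B]
variable (φ : SkewHopfPairing A B)

/-- As a coalgebra, the quantum double is the tensor product of the coalgebras `A` and `B`. -/
noncomputable instance : Coalgebra ℂ φ.QuantumDouble := inferInstanceAs (Coalgebra ℂ (A ⊗[ℂ] B))

/-- The action `b · x = ∑ φ(x₁, S(b)) x₂` of `B` on `A`. -/
noncomputable def hitS : B →ₗ[ℂ] A →ₗ[ℂ] A :=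
  LinearMap.mk₂ ℂ
    (fun b x => TensorProduct.lid ℂ A
      (LinearMap.rTensor A (φ.form.flip (HopfAlgebra.antipode ℂ b)) (comul x)))
    (fun b b' x => by simp only [map_add, LinearMap.rTensor_add, LinearMap.add_apply])
    (fun t b x => by simp only [map_smul, LinearMap.rTensor_smul, LinearMap.smul_apply])
    (fun b x x' => by simp only [map_add])
    (fun t b x => by simp only [map_smul])

theorem hitS_one (x : A) : φ.hitS 1 x = x := by
  refine Eq.trans ?_ (φ.hitL_one_left x)
  have h : φ.form.flip (HopfAlgebra.antipode ℂ 1) = (φ.form ∘ₗ φ.antipodeInv).flip 1 := by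
    ext y
    exact (φ.form_antipodeInv y 1).symm
  rw [hitL_apply, hitS, LinearMap.mk₂_apply, h]

/-- The Schrödinger representation of the quantum double on `A`:
`(a ⊗ 1) · x = ∑ a₁ x S(a₂)` and `(1 ⊗ b) · x = ∑ φ(x₁, S(b)) x₂`. -/
noncomputable def schrodingerA : φ.QuantumDouble →ₗ[ℂ] A →ₗ[ℂ] A :=
  TensorProduct.lift ((LinearMap.llcomp ℂ A A A ∘ₗ adjointAction A).compl₂ φ.hitS) ∘ₗ
    (TwistedTensor.equiv φ.doubleTwist).symm.toLinearMap

theorem schrodingerA_mk (a x : A) (b : B) :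
    φ.schrodingerA (TwistedTensor.mk _ a b) x = adjointAction A a (φ.hitS b x) := rfl

/-- The Schrödinger representation of the quantum double on `B`:
`(a ⊗ 1) · y = ∑ φ(a, y₁) y₂` and `(1 ⊗ b) · y = ∑ b₁ y S(b₂)`. -/
noncomputable def schrodingerB : φ.QuantumDouble →ₗ[ℂ] B →ₗ[ℂ] B :=
  TensorProduct.lift ((LinearMap.llcomp ℂ B B B ∘ₗ φ.hit).compl₂ (adjointAction B)) ∘ₗ
    (TwistedTensor.equiv φ.doubleTwist).symm.toLinearMap

theorem schrodingerB_mk (a : A) (b y : B) :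
    φ.schrodingerB (TwistedTensor.mk _ a b) y = φ.hit a (adjointAction B b y) := rfl

/-- The diagonal action `d · (b ♯ a) = ∑ d₁ · b ♯ d₂ · a` of the quantum double on the Heisenberg
double. -/
noncomputable def heisAction : φ.QuantumDouble →ₗ[ℂ] φ.HeisenbergDouble →ₗ[ℂ] φ.HeisenbergDouble :=
  ((TwistedTensor.equiv φ.heisTwist).arrowCongr (TwistedTensor.equiv φ.heisTwist)).toLinearMap ∘ₗ
    TensorProduct.homTensorHomMap (RingHom.id ℂ) B A B A ∘ₗ
    TensorProduct.map φ.schrodingerB φ.schrodingerA ∘ₗ comul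

theorem heisAction_mk (d : φ.QuantumDouble) (b : B) (a : A)
    (R : Repr ℂ d (φ.QuantumDouble × φ.QuantumDouble)) :
    φ.heisAction d (TwistedTensor.mk _ b a) = ∑ i ∈ R.index,
      TwistedTensor.mk _ (φ.schrodingerB (R.left i) b) (φ.schrodingerA (R.right i) a) := by
  rw [heisAction, LinearMap.comp_apply, LinearMap.comp_apply, LinearMap.comp_apply, ← R.eq]
  simp [TwistedTensor.mk]

/-- The coaction `b ♯ a ↦ ∑ (1 ⊗ b₁)(a₁ ⊗ 1) ⊗ (b₂ ♯ a₂)` of the quantum double on the Heisenberg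
double. -/
noncomputable def heisCoaction : φ.HeisenbergDouble →ₗ[ℂ] φ.QuantumDouble ⊗[ℂ] φ.HeisenbergDouble :=
  TensorProduct.map
      (LinearMap.mul' ℂ φ.QuantumDouble ∘ₗ
        TensorProduct.map (TwistedTensor.inr φ.doubleTwist).toLinearMap
          (TwistedTensor.inl φ.doubleTwist).toLinearMap)
      (TwistedTensor.equiv φ.heisTwist).toLinearMap ∘ₗ
    (TensorProduct.tensorTensorTensorComm ℂ B B A A).toLinearMap ∘ₗ
    TensorProduct.map comul comul ∘ₗ (TwistedTensor.equiv φ.heisTwist).symm.toLinearMap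

theorem heisCoaction_mk (b : B) (a : A) (Rb : Repr ℂ b (B × B)) (Ra : Repr ℂ a (A × A)) :
    φ.heisCoaction (TwistedTensor.mk _ b a) = ∑ i ∈ Rb.index, ∑ j ∈ Ra.index,
      (TwistedTensor.mk φ.doubleTwist 1 (Rb.left i) * TwistedTensor.mk φ.doubleTwist (Ra.left j) 1)
        ⊗ₜ TwistedTensor.mk φ.heisTwist (Rb.right i) (Ra.right j) := by
  change TensorProduct.map _ _ (TensorProduct.tensorTensorTensorComm ℂ B B A A
    (comul b ⊗ₜ comul a)) = _
  rw [← Rb.eq, ← Ra.eq]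
  simp only [TensorProduct.sum_tmul, TensorProduct.tmul_sum, map_sum,
    TensorProduct.tensorTensorTensorComm_tmul, TensorProduct.map_tmul, LinearMap.comp_apply,
    LinearMap.mul'_apply]
  first | rfl | (rw [Finset.sum_comm]; rfl)

/-- The braiding of the Heisenberg double with itself. -/
noncomputable def heisBraiding : φ.HeisenbergDouble →ₗ[ℂ] φ.HeisenbergDouble →ₗ[ℂ]
    φ.HeisenbergDouble ⊗[ℂ] φ.HeisenbergDouble :=
  braiding φ.heisCoaction φ.heisAction

theorem heisAction_inl (a : A) (b : B) :
    φ.heisAction (TwistedTensor.mk _ a 1) (TwistedTensor.inl _ b) =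
      TwistedTensor.inl _ (φ.hit a b) := by
  have h : comul (R := ℂ) (TwistedTensor.mk φ.doubleTwist a 1) = ∑ i ∈ (ℛ ℂ a).index,
      TwistedTensor.mk φ.doubleTwist ((ℛ ℂ a).left i) 1 ⊗ₜ[ℂ]
        TwistedTensor.mk φ.doubleTwist ((ℛ ℂ a).right i) 1 := by
    change comul (R := ℂ) (a ⊗ₜ[ℂ] (1 : B)) = _
    rw [TensorProduct.comul_tmul, ← (ℛ ℂ a).eq, Bialgebra.comul_one, Algebra.TensorProduct.one_def,
      TensorProduct.sum_tmul, map_sum]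
    rfl
  rw [heisAction, LinearMap.comp_apply, LinearMap.comp_apply, LinearMap.comp_apply, h]
  have e : ∀ i, (φ.schrodingerA (TwistedTensor.mk φ.doubleTwist ((ℛ ℂ a).right i) 1)) 1 =
    counit (R := ℂ) ((ℛ ℂ a).right i) • (1 : A) := fun i => by
      rw [schrodingerA_mk, hitS_one, adjointAction_one_right]
  have e' : ∀ i, (φ.schrodingerB (TwistedTensor.mk φ.doubleTwist ((ℛ ℂ a).left i) 1)) b =
    φ.hit ((ℛ ℂ a).left i) b := fun i => by
      rw [schrodingerB_mk, adjointAction_one_left]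
  simp only [map_sum, LinearMap.sum_apply, TensorProduct.map_tmul]
  have e2 : ∀ i, ((TwistedTensor.equiv φ.heisTwist).arrowCongr
      (TwistedTensor.equiv φ.heisTwist)).toLinearMap
      (TensorProduct.homTensorHomMap (RingHom.id ℂ) B A B A
      (φ.schrodingerB (TwistedTensor.mk φ.doubleTwist ((ℛ ℂ a).left i) 1) ⊗ₜ
        φ.schrodingerA (TwistedTensor.mk φ.doubleTwist ((ℛ ℂ a).right i) 1)))
        (TwistedTensor.inl φ.heisTwist b) = TwistedTensor.inl φ.heisTwist
          (counit (R := ℂ) ((ℛ ℂ a).right i) • φ.hit ((ℛ ℂ a).left i) b) := fun i => by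
    change TwistedTensor.equiv φ.heisTwist (_ ⊗ₜ _) = _
    rw [e, e', ← TensorProduct.smul_tmul]
    rfl
  simp only [e2]
  rw [← map_sum]
  congr 1
  have := congrArg (φ.hit.flip b) (congrArg (TensorProduct.rid ℂ A) (sum_tmul_counit_eq (ℛ ℂ a)))
  simpa only [map_sum, TensorProduct.rid_tmul, map_smul, one_smul, LinearMap.flip_apply] using this

theorem heisBraiding_inr_inl (a : A) (b : B) :
    φ.heisBraiding (TwistedTensor.inr _ a) (TwistedTensor.inl _ b) =
      TensorProduct.map (TwistedTensor.inl φ.heisTwist).toLinearMap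
        (TwistedTensor.inr φ.heisTwist).toLinearMap (φ.heisTwist.τ a b) := by
  have h : φ.heisCoaction (TwistedTensor.inr _ a) = ∑ j ∈ (ℛ ℂ a).index,
      TwistedTensor.mk φ.doubleTwist ((ℛ ℂ a).left j) 1
        ⊗ₜ TwistedTensor.inr φ.heisTwist ((ℛ ℂ a).right j) := by
    change TensorProduct.map _ _ (TensorProduct.tensorTensorTensorComm ℂ B B A A
      (comul (1 : B) ⊗ₜ comul a)) = _
    rw [Bialgebra.comul_one, ← (ℛ ℂ a).eq, Algebra.TensorProduct.one_def]
    simp only [TensorProduct.tmul_sum, map_sum, TensorProduct.tensorTensorTensorComm_tmul,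
      TensorProduct.map_tmul, LinearMap.comp_apply, LinearMap.mul'_apply,
      AlgHom.toLinearMap_apply, map_one, one_mul]
    rfl
  change LinearMap.rTensor _ (φ.heisAction.flip _) (φ.heisCoaction _) = _
  rw [h]
  change _ = TensorProduct.map _ _ (actExchange φ.hit a b)
  rw [actExchange_repr _ _ _ (ℛ ℂ a)]
  simp only [map_sum, LinearMap.rTensor_tmul, LinearMap.flip_apply, heisAction_inl,
    TensorProduct.map_tmul, AlgHom.toLinearMap_apply]

end SkewHopfPairing
end TwoParam

namespace TwoParam

open Coalgebra

variable {ι : Type*} [Fintype ι] [LinearOrder ι]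

/-- A twist restricts along injective algebra homomorphisms. -/
noncomputable def Twist.ofInjective {V W V' W' : Type*} [Ring V] [Algebra ℂ V] [Ring W]
    [Algebra ℂ W] [Ring V'] [Algebra ℂ V'] [Ring W'] [Algebra ℂ W'] (T : Twist V W)
    (i : V' →ₐ[ℂ] V) (j : W' →ₐ[ℂ] W)
    (hij : Function.Injective (TensorProduct.map i.toLinearMap j.toLinearMap))
    (τ' : W' →ₗ[ℂ] V' →ₗ[ℂ] V' ⊗[ℂ] W')
    (h : ∀ w v, TensorProduct.map i.toLinearMap j.toLinearMap (τ' w v) = T.τ (j w) (i v)) :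
    Twist V' W' := by
  have hm : ∀ x y, TensorProduct.map i.toLinearMap j.toLinearMap (twistMul τ' x y) =
      twistMul T.τ (TensorProduct.map i.toLinearMap j.toLinearMap x)
        (TensorProduct.map i.toLinearMap j.toLinearMap y) := by
    intro x y
    induction x with
    | zero => simp
    | add x x' hx hx' => simp only [map_add, LinearMap.add_apply, hx, hx']
    | tmul a b =>
      induction y with
      | zero => simp
      | add y y' hy hy' => simp only [map_add, hy, hy']
      | tmul c d =>
        simp only [TensorProduct.map_tmul, twistMul_tmul, AlgHom.toLinearMap_apply, ← h]
        generalize τ' b c = t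
        induction t with
        | zero => simp
        | add t t' ht ht' => simp only [map_add, ht, ht']
        | tmul e f => simp
  exact
  { τ := τ'
    one_left := fun v => hij (by rw [h, map_one, T.one_left]; simp)
    one_right := fun w => hij (by rw [h, map_one, T.one_right]; simp)
    mul_left := fun w w' v => hij (by rw [h, map_mul, T.mul_left, hm, h]; simp)
    mul_right := fun w v v' => hij (by rw [h, map_mul, T.mul_right, hm, h]; simp) }

namespace TwistedTensor

variable {V W : Type*} [Ring V] [Algebra ℂ V] [Ring W] [Algebra ℂ W] (T : Twist V W)

theorem inl_injective [Nontrivial W] : Function.Injective (inl T) := fun _ _ h =>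
  Algebra.TensorProduct.includeLeft_injective (R := ℂ) (S := ℂ) (algebraMap ℂ W).injective h

theorem inr_injective [Nontrivial V] : Function.Injective (inr T) := fun _ _ h =>
  Algebra.TensorProduct.includeRight_injective (R := ℂ) (algebraMap ℂ V).injective h

end TwistedTensor

instance (Q : Datum ι) : Nontrivial (UGe Q) :=
  (Bialgebra.counitAlgHom ℂ (UGe Q)).toRingHom.domain_nontrivial
instance (Q : Datum ι) : Nontrivial (ULe Q) :=
  (Bialgebra.counitAlgHom ℂ (ULe Q)).toRingHom.domain_nontrivial

variable (Q : Datum ι)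

/-- The two-parameter quantum group `U_{r,s}(𝔤) = D_φ(U_{r,s}^{≥}, U_{r,s}^{≤})`. -/
abbrev Urs : Type _ := (phi Q).QuantumDouble

/-- The two-parameter Kashiwara algebra `B_{r,s}(𝔤) = H_φ(U_{r,s}^{≥}, U_{r,s}^{≤})`. -/
abbrev Brs : Type _ := (phi Q).HeisenbergDouble

/-- The generator `e'_i = (s_i - r_i) ω'_i⁻¹ e_i` of `B_{r,s}`. -/
noncomputable def ePrime (i : ι) : Brs Q :=
  (Q.s ^ Q.d i - Q.r ^ Q.d i) •
    TwistedTensor.mk (phi Q).heisTwist 1 (UGe.Kinv Q i * UGe.E Q i)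

/-- The generator `f_i` of `B_{r,s}`. -/
noncomputable def fGen (i : ι) : Brs Q := TwistedTensor.mk (phi Q).heisTwist (ULe.F Q i) 1

/-- The subalgebra `B_{r,s}^+` generated by the `e'_i`. -/
noncomputable def BPlus : Subalgebra ℂ (Brs Q) := Algebra.adjoin ℂ (Set.range (ePrime Q))

/-- The subalgebra `B_{r,s}^-` generated by the `f_i`. -/
noncomputable def BMinus : Subalgebra ℂ (Brs Q) := Algebra.adjoin ℂ (Set.range (fGen Q))

/-- The two-parameter quantized Weyl algebra `W_{r,s}(𝔤)`, generated by the `e'_i` and `f_i`. -/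
noncomputable def Wrs : Subalgebra ℂ (Brs Q) :=
  Algebra.adjoin ℂ (Set.range (ePrime Q) ∪ Set.range (fGen Q))

/-- The preimage of `B_{r,s}^+` in `U_{r,s}^{≥}`. -/
noncomputable def APlus : Subalgebra ℂ (UGe Q) :=
  Algebra.adjoin ℂ (Set.range fun i =>
    (Q.s ^ Q.d i - Q.r ^ Q.d i) • (UGe.Kinv Q i * UGe.E Q i))

/-- The preimage of `B_{r,s}^-` in `U_{r,s}^{≤}`. -/
noncomputable def AMinus : Subalgebra ℂ (ULe Q) := Algebra.adjoin ℂ (Set.range (ULe.F Q))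

theorem BPlus_eq : BPlus Q = (APlus Q).map (TwistedTensor.inr (phi Q).heisTwist) := by
  have h : (TwistedTensor.inr (phi Q).heisTwist) ∘ (fun i =>
      (Q.s ^ Q.d i - Q.r ^ Q.d i) • (UGe.Kinv Q i * UGe.E Q i)) = ePrime Q :=
    funext fun i => map_smul (TwistedTensor.inr (phi Q).heisTwist) _ _
  rw [APlus, AlgHom.map_adjoin, ← Set.range_comp, h]
  rfl

theorem BMinus_eq : BMinus Q = (AMinus Q).map (TwistedTensor.inl (phi Q).heisTwist) := by
  rw [AMinus, AlgHom.map_adjoin, ← Set.range_comp]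
  rfl

theorem comul_APlus (a : UGe Q) (ha : a ∈ APlus Q) : comul (R := ℂ) a ∈
    (Algebra.TensorProduct.map (AlgHom.id ℂ (UGe Q)) (APlus Q).val).range := by
  suffices h : APlus Q ≤ (Algebra.TensorProduct.map (AlgHom.id ℂ (UGe Q)) (APlus Q).val).range.comap
    (Bialgebra.comulAlgHom ℂ (UGe Q)) from h ha
  refine Algebra.adjoin_le ?_
  rintro _ ⟨i, rfl⟩
  refine ⟨((Q.s ^ Q.d i - Q.r ^ Q.d i) • (UGe.Kinv Q i * UGe.E Q i)) ⊗ₜ 1 +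
    UGe.Kinv Q i ⊗ₜ ⟨_, Algebra.subset_adjoin ⟨i, rfl⟩⟩, ?_⟩
  simp only [RingHom.coe_coe, AlgHom.toRingHom_eq_coe, map_add, Algebra.TensorProduct.map_tmul,
    AlgHom.coe_id, id, map_one, Subalgebra.coe_val, map_smul, map_mul,
    Bialgebra.comulAlgHom_apply, UGe.comul_E, UGe.comul_Kinv, mul_add,
    Algebra.TensorProduct.tmul_mul_tmul, UGe.Kinv_K, mul_one, smul_add, TensorProduct.tmul_smul,
    TensorProduct.smul_tmul']

theorem comul_AMinus (b : ULe Q) (hb : b ∈ AMinus Q) : comul (R := ℂ) b ∈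
    (Algebra.TensorProduct.map (AlgHom.id ℂ (ULe Q)) (AMinus Q).val).range := by
  suffices h : AMinus Q ≤
    (Algebra.TensorProduct.map (AlgHom.id ℂ (ULe Q)) (AMinus Q).val).range.comap
    (Bialgebra.comulAlgHom ℂ (ULe Q)) from h hb
  refine Algebra.adjoin_le ?_
  rintro _ ⟨i, rfl⟩
  refine ⟨ULe.F Q i ⊗ₜ 1 + ULe.K Q i ⊗ₜ ⟨_, Algebra.subset_adjoin ⟨i, rfl⟩⟩, ?_⟩
  simp

theorem hit_mem (a : UGe Q) (b : ULe Q) (hb : b ∈ AMinus Q) : (phi Q).hit a b ∈ AMinus Q := by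
  obtain ⟨z, hz⟩ := comul_AMinus Q b hb
  rw [SkewHopfPairing.hit_apply, ← hz]
  clear hz
  induction z with
  | zero => simp
  | add x y hx hy =>
    simp only [map_add]
    exact add_mem hx hy
  | tmul x y =>
    change TensorProduct.lid ℂ _ (LinearMap.rTensor _ _ (x ⊗ₜ (y : ULe Q))) ∈ _
    rw [LinearMap.rTensor_tmul, TensorProduct.lid_tmul]
    exact Subalgebra.smul_mem _ y.2 _

/-- The inclusion `B_{r,s}^- ⊗ B_{r,s}^+ ⊂ B_{r,s} ⊗ B_{r,s}`. -/
noncomputable def inclTensor : BMinus Q ⊗[ℂ] BPlus Q →ₗ[ℂ] Brs Q ⊗[ℂ] Brs Q :=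
  TensorProduct.map (BMinus Q).val.toLinearMap (BPlus Q).val.toLinearMap

theorem inclTensor_injective : Function.Injective (inclTensor Q) :=
  TensorProduct.map_injective_of_flat_flat _ _ Subtype.val_injective Subtype.val_injective

theorem exists_inr (e : BPlus Q) :
    ∃ a ∈ APlus Q, TwistedTensor.inr (phi Q).heisTwist a = (e : Brs Q) := by
  obtain ⟨a, ha, h⟩ := (BPlus_eq Q).le e.2
  exact ⟨a, ha, h⟩

theorem exists_inl (f : BMinus Q) :
    ∃ b ∈ AMinus Q, TwistedTensor.inl (phi Q).heisTwist b = (f : Brs Q) := by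
  obtain ⟨b, hb, h⟩ := (BMinus_eq Q).le f.2
  exact ⟨b, hb, h⟩

/-- The braiding of `B_{r,s}` maps `B_{r,s}^+ ⊗ B_{r,s}^-` to `B_{r,s}^- ⊗ B_{r,s}^+`. -/
theorem heisBraiding_mem (e : BPlus Q) (f : BMinus Q) :
    (phi Q).heisBraiding (e : Brs Q) (f : Brs Q) ∈ LinearMap.range (inclTensor Q) := by
  obtain ⟨a, ha, hae⟩ := exists_inr Q e
  obtain ⟨b, hb, hbf⟩ := exists_inl Q f
  rw [← hae, ← hbf, SkewHopfPairing.heisBraiding_inr_inl]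
  change TensorProduct.map _ _ (LinearMap.rTensor _ ((phi Q).hit.flip b) (comul a)) ∈ _
  obtain ⟨z, hz⟩ := comul_APlus Q a ha
  rw [← hz]
  clear hz
  induction z with
  | zero => simp
  | add x y hx hy =>
    simp only [map_add]
    exact add_mem hx hy
  | tmul x y =>
    refine ⟨⟨TwistedTensor.inl _ ((phi Q).hit x b), ?_⟩ ⊗ₜ
      ⟨TwistedTensor.inr _ (y : UGe Q), ?_⟩, rfl⟩
    · rw [BMinus_eq]
      exact ⟨_, hit_mem Q x b hb, rfl⟩
    · rw [BPlus_eq]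
      exact ⟨_, y.2, rfl⟩

/-- The restriction `σ : B_{r,s}^+ ⊗ B_{r,s}^- → B_{r,s}^- ⊗ B_{r,s}^+` of the braiding of
`B_{r,s}`. -/
noncomputable def sigma : BPlus Q →ₗ[ℂ] BMinus Q →ₗ[ℂ] BMinus Q ⊗[ℂ] BPlus Q :=
  LinearMap.mk₂ ℂ
    (fun e f => (LinearEquiv.ofInjective (inclTensor Q) (inclTensor_injective Q)).symm
      ⟨(phi Q).heisBraiding (e : Brs Q) (f : Brs Q), heisBraiding_mem Q e f⟩)
    (fun e e' f => by
      rw [← map_add]; congr 1; apply Subtype.ext; simp)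
    (fun c e f => by
      rw [← map_smul]; congr 1; apply Subtype.ext; simp)
    (fun e f f' => by
      rw [← map_add]; congr 1; apply Subtype.ext; simp)
    (fun c e f => by
      rw [← map_smul]; congr 1; apply Subtype.ext; simp)

theorem inclTensor_sigma (e : BPlus Q) (f : BMinus Q) :
    inclTensor Q (sigma Q e f) = (phi Q).heisBraiding (e : Brs Q) (f : Brs Q) :=
  congrArg Subtype.val
    ((LinearEquiv.ofInjective (inclTensor Q) (inclTensor_injective Q)).apply_symm_apply _)

/-- The projection of `B_{r,s}^-` to `U_{r,s}^{≤}`. -/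
noncomputable def projMinus : BMinus Q →ₐ[ℂ] ULe Q :=
  (AlgEquiv.ofInjective _ (TwistedTensor.inl_injective (phi Q).heisTwist)).symm.toAlgHom.comp
    (Subalgebra.inclusion (by
      rw [BMinus_eq, ← Algebra.map_top]
      exact Subalgebra.map_mono le_top))

theorem inl_projMinus (f : BMinus Q) : TwistedTensor.inl (phi Q).heisTwist (projMinus Q f) = f :=
  congrArg Subtype.val ((AlgEquiv.ofInjective _
    (TwistedTensor.inl_injective (phi Q).heisTwist)).apply_symm_apply _)

/-- The projection of `B_{r,s}^+` to `U_{r,s}^{≥}`. -/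
noncomputable def projPlus : BPlus Q →ₐ[ℂ] UGe Q :=
  (AlgEquiv.ofInjective _ (TwistedTensor.inr_injective (phi Q).heisTwist)).symm.toAlgHom.comp
    (Subalgebra.inclusion (by
      rw [BPlus_eq, ← Algebra.map_top]
      exact Subalgebra.map_mono le_top))

theorem inr_projPlus (e : BPlus Q) : TwistedTensor.inr (phi Q).heisTwist (projPlus Q e) = e :=
  congrArg Subtype.val ((AlgEquiv.ofInjective _
    (TwistedTensor.inr_injective (phi Q).heisTwist)).apply_symm_apply _)

theorem projMinus_injective : Function.Injective (projMinus Q) := fun x y h =>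
  Subtype.ext (by rw [← inl_projMinus, h, inl_projMinus])

theorem projPlus_injective : Function.Injective (projPlus Q) := fun x y h =>
  Subtype.ext (by rw [← inr_projPlus, h, inr_projPlus])

/-- The map `σ` is compatible with multiplications and units. -/
noncomputable def sigmaTwist : Twist (BMinus Q) (BPlus Q) :=
  Twist.ofInjective (phi Q).heisTwist (projMinus Q) (projPlus Q)
    (TensorProduct.map_injective_of_flat_flat _ _ (projMinus_injective Q) (projPlus_injective Q))
    (sigma Q)
    (fun e f => by
      have hinj : Function.Injective (TensorProduct.map
          (TwistedTensor.inl (phi Q).heisTwist).toLinearMap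
          (TwistedTensor.inr (phi Q).heisTwist).toLinearMap) :=
        TensorProduct.map_injective_of_flat_flat _ _ (TwistedTensor.inl_injective _)
          (TwistedTensor.inr_injective _)
      apply hinj
      rw [← SkewHopfPairing.heisBraiding_inr_inl, inl_projMinus, inr_projPlus, ← inclTensor_sigma]
      generalize sigma Q e f = t
      induction t with
      | zero => simp
      | add x y hx hy => simp only [map_add, hx, hy]
      | tmul x y =>
        simp only [TensorProduct.map_tmul, AlgHom.toLinearMap_apply, inl_projMinus, inr_projPlus]
        rfl)

theorem sigmaTwist_τ : (sigmaTwist Q).τ = sigma Q := rfl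

/-- The braided tensor product algebra `B_{r,s}^- ⊗̲ B_{r,s}^+`: the vector space
`B_{r,s}^- ⊗ B_{r,s}^+` with the multiplication `(m ⊗ m) ∘ (id ⊗ σ ⊗ id)`. -/
abbrev BraidedTensor : Type _ := TwistedTensor (sigmaTwist Q)

end TwoParam

/-!
Multiplication in `B_{r,s}` gives a linear map `B_{r,s}^- ⊗ B_{r,s}^+ → B_{r,s}`, `f ⊗ e ↦ f e`.

It is multiplicative because the multiplication of the Heisenberg double is itself a twisted tensor
product: for `e` in the `U^{≥}` factor and `f` in the `U^{≤}` factor, the product `e f` is the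
image of the braiding `σ(e ⊗ f)` under multiplication (`TwoParam.mul_eq_mul_sigma`). By the
universal property of twisted tensor products (`TwoParam.TwistedTensor.lift`), this exchange rule
is all that is needed.

It is injective because `B_{r,s}^-` and `B_{r,s}^+` embed in the two tensor factors of
`B_{r,s} = U^{≤} ⊗ U^{≥}`, where `f e` is the pure tensor `f ⊗ e`; over a field the tensor product
of two injections is injective (`TwoParam.TwistedTensor.lift_injective`). Its image is
a subalgebra that contains all `e'_i` and `f_i` and lies in the algebra they generate, so it is
`W_{r,s}(𝔤)`.
-/

namespace TwoParam

namespace TwistedTensor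

variable {V W R : Type*} [Ring V] [Algebra ℂ V] [Ring W] [Algebra ℂ W] [Ring R] [Algebra ℂ R]

/-- The universal property of a twisted tensor product: algebra maps `i : V → R` and `j : W → R`
whose images satisfy the exchange rule of `T` extend to `v ⊗ w ↦ i v * j w`. -/
noncomputable def lift (T : Twist V W) (i : V →ₐ[ℂ] R) (j : W →ₐ[ℂ] R)
    (h : ∀ w v, j w * i v =
      LinearMap.mul' ℂ R (TensorProduct.map i.toLinearMap j.toLinearMap (T.τ w v))) :
    TwistedTensor T →ₐ[ℂ] R :=
  AlgHom.ofLinearMap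
    (LinearMap.mul' ℂ R ∘ₗ TensorProduct.map i.toLinearMap j.toLinearMap ∘ₗ
      (equiv T).symm.toLinearMap)
    (by simp [one_def, mk])
    (fun x y => by
      rw [mul_def]
      simp only [LinearMap.comp_apply, LinearEquiv.coe_coe, LinearEquiv.symm_apply_apply]
      generalize (equiv T).symm x = x
      generalize (equiv T).symm y = y
      induction x with
      | zero => simp
      | add x x' hx hx' => simp only [map_add, LinearMap.add_apply, hx, hx', add_mul]
      | tmul v w =>
        induction y with
        | zero => simp
        | add y y' hy hy' => simp only [map_add, hy, hy', mul_add]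
        | tmul v' w' =>
          have hr : LinearMap.mul' ℂ R (TensorProduct.map i.toLinearMap j.toLinearMap (v ⊗ₜ w)) *
              LinearMap.mul' ℂ R (TensorProduct.map i.toLinearMap j.toLinearMap (v' ⊗ₜ w')) =
              i v * (j w * i v') * j w' := by
            simp [mul_assoc]
          rw [hr, h, twistMul_tmul]
          generalize T.τ w v' = t
          induction t with
          | zero => simp
          | add t t' ht ht' => simp only [map_add, ht, ht', mul_add, add_mul]
          | tmul a b => simp [mul_assoc])

theorem lift_mk (T : Twist V W) (i : V →ₐ[ℂ] R) (j : W →ₐ[ℂ] R)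
    (h : ∀ w v, j w * i v =
      LinearMap.mul' ℂ R (TensorProduct.map i.toLinearMap j.toLinearMap (T.τ w v)))
    (v : V) (w : W) : lift T i j h (mk T v w) = i v * j w := by
  change LinearMap.mul' ℂ R (TensorProduct.map i.toLinearMap j.toLinearMap (v ⊗ₜ w)) = _
  simp

theorem induction_on {T : Twist V W} {p : TwistedTensor T → Prop} (x : TwistedTensor T)
    (zero : p 0) (mk : ∀ v w, p (mk T v w)) (add : ∀ x y, p x → p y → p (x + y)) : p x :=
  TensorProduct.induction_on (motive := fun t => p (equiv T t)) ((equiv T).symm x) zero mk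
    fun _ _ hx hy => add _ _ hx hy

/-- Algebra maps `p : V → V'` and `q : W → W'` that are injective and respect the exchange rules
induce an injective map of twisted tensor products, since on underlying vector spaces it is
`p ⊗ q`. -/
theorem lift_injective {V' W' : Type*} [Ring V'] [Algebra ℂ V'] [Ring W'] [Algebra ℂ W']
    (T : Twist V W) (T' : Twist V' W') {p : V →ₐ[ℂ] V'} {q : W →ₐ[ℂ] W'}
    (hp : Function.Injective p) (hq : Function.Injective q)
    {i : V →ₐ[ℂ] TwistedTensor T'} {j : W →ₐ[ℂ] TwistedTensor T'}
    (h : ∀ w v, j w * i v =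
      LinearMap.mul' ℂ _ (TensorProduct.map i.toLinearMap j.toLinearMap (T.τ w v)))
    (hi : ∀ v, i v = inl T' (p v)) (hj : ∀ w, j w = inr T' (q w)) :
    Function.Injective (lift T i j h) := by
  have key : ∀ t, lift T i j h (equiv T t) =
      equiv T' (TensorProduct.map p.toLinearMap q.toLinearMap t) := by
    intro t
    induction t with
    | zero => simp
    | add x y hx hy => simp only [map_add, hx, hy]
    | tmul v w =>
      refine (lift_mk T i j h v w).trans ?_
      rw [hi, hj, inl_mul_inr]
      rfl
  refine (equiv T).surjective.forall₂.2 fun x y hxy => ?_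
  rw [key, key] at hxy
  rw [TensorProduct.map_injective_of_flat_flat p.toLinearMap q.toLinearMap hp hq
    ((equiv T').injective hxy)]

theorem inr_mul_inl (T : Twist V W) (w : W) (v : V) :
    inr T w * inl T v = LinearMap.mul' ℂ _
      (TensorProduct.map (inl T).toLinearMap (inr T).toLinearMap (T.τ w v)) := by
  rw [inr_apply, inl_apply, mk_mul_mk, LinearMap.mulLeft_one, LinearMap.mulRight_one]
  change equiv T (TensorProduct.map LinearMap.id LinearMap.id (T.τ w v)) = _
  rw [TensorProduct.map_id, LinearMap.id_apply]
  generalize T.τ w v = t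
  induction t with
  | zero => simp
  | add x y hx hy => simp only [map_add, hx, hy]
  | tmul a b => simp [inl_mul_inr, mk]

end TwistedTensor

variable {ι : Type*} [Fintype ι] [LinearOrder ι] (Q : Datum ι)

/-- In `B_{r,s}` the product `e f` is obtained by multiplying out the braiding `σ(e ⊗ f)`. -/
theorem mul_eq_mul_sigma (e : BPlus Q) (f : BMinus Q) :
    (BPlus Q).val e * (BMinus Q).val f = LinearMap.mul' ℂ (Brs Q)
      (TensorProduct.map (BMinus Q).val.toLinearMap (BPlus Q).val.toLinearMap
        ((sigmaTwist Q).τ e f)) := by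
  have h := inclTensor_sigma Q e f
  rw [inclTensor] at h
  rw [sigmaTwist_τ, h]
  obtain ⟨a, -, ha⟩ := exists_inr Q e
  obtain ⟨b, -, hb⟩ := exists_inl Q f
  rw [Subalgebra.coe_val, Subalgebra.coe_val, ← ha, ← hb, SkewHopfPairing.heisBraiding_inr_inl]
  exact TwistedTensor.inr_mul_inl _ a b

/-- The multiplication map `f ⊗ e ↦ f e` from the braided tensor product to `B_{r,s}`. -/
noncomputable def braidedMul : BraidedTensor Q →ₐ[ℂ] Brs Q :=
  TwistedTensor.lift (sigmaTwist Q) (BMinus Q).val (BPlus Q).val (mul_eq_mul_sigma Q)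

theorem braidedMul_mk (f : BMinus Q) (e : BPlus Q) :
    braidedMul Q (TwistedTensor.mk (sigmaTwist Q) f e) = (f : Brs Q) * (e : Brs Q) :=
  TwistedTensor.lift_mk _ _ _ _ f e

theorem braidedMul_injective : Function.Injective (braidedMul Q) :=
  TwistedTensor.lift_injective (sigmaTwist Q) (phi Q).heisTwist (projMinus_injective Q)
    (projPlus_injective Q) _ (fun f => (inl_projMinus Q f).symm) (fun e => (inr_projPlus Q e).symm)

theorem range_braidedMul : (braidedMul Q).range = Wrs Q := by
  apply le_antisymm
  · rintro _ ⟨x, rfl⟩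
    change braidedMul Q x ∈ Wrs Q
    induction x using TwistedTensor.induction_on with
    | zero => simp
    | add x y hx hy =>
      rw [map_add]
      exact add_mem hx hy
    | mk f e =>
      rw [braidedMul_mk]
      exact mul_mem (Algebra.adjoin_mono Set.subset_union_right f.2)
        (Algebra.adjoin_mono Set.subset_union_left e.2)
  · refine Algebra.adjoin_le ?_
    rintro _ (⟨i, rfl⟩ | ⟨i, rfl⟩)
    · refine ⟨TwistedTensor.mk _ 1 ⟨ePrime Q i, Algebra.subset_adjoin ⟨i, rfl⟩⟩, ?_⟩
      exact (braidedMul_mk Q _ _).trans (one_mul _)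
    · refine ⟨TwistedTensor.mk _ ⟨fGen Q i, Algebra.subset_adjoin ⟨i, rfl⟩⟩ 1, ?_⟩
      exact (braidedMul_mk Q _ _).trans (mul_one _)

end TwoParam

theorem proposition4p1 {ι : Type*} [Fintype ι] [LinearOrder ι] (Q : TwoParam.Datum ι) :
    ∃ Φ : TwoParam.BraidedTensor Q ≃ₐ[ℂ] TwoParam.Wrs Q,
      ∀ (f : TwoParam.BMinus Q) (e : TwoParam.BPlus Q),
        (Φ (TwoParam.TwistedTensor.mk (TwoParam.sigmaTwist Q) f e) : TwoParam.Brs Q) =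
          (f : TwoParam.Brs Q) * (e : TwoParam.Brs Q) :=
  ⟨(AlgEquiv.ofInjective _ (TwoParam.braidedMul_injective Q)).trans
      (Subalgebra.equivOfEq _ _ (TwoParam.range_braidedMul Q)),
    TwoParam.braidedMul_mk Q⟩
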